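/- **Setting.** An instance of $mRmDc$ consists of finite sets $D$ of demands and $R\neq\emptyset$ of resource types; for each $r\in R$ a finite set $S^r$ of starting locations and numbers $l^r_s\in\mathbb Z_{\ge 0}$ of resources of type $r$ that start at $s\in S^r$; for each $d\in D$ a nonempty set $M_d\subseteq R$ of required types, a service start time $\tau_d\in\mathbb Z$, a duration $\Delta_d\in\mathbb Z_{\ge 0}$ and a reward $w_d\in\mathbb Z$; and travel times $f_{xd}\in\mathbb Z_{\ge0}$ and travel costs $c_{xd}\in\mathbb Z_{\ge 0}$ from every location $x$ (a starting location or the location of a demand) to the location of every demand $d$. Put $A_{ij}=1$ if $\tau_i+\Delta_i+f_{ij}\le\tau_j$ and $M_i\cap M_j\ne\emptyset$, and $A_{ij}=0$ otherwise; for $s\in S^r$ and $r\in M_d$ put $B_{sd}=1$ if $f_{sd}\le\tau_d$, and $B_{sd}=0$ otherwise. Travel times satisfy the triangle inequality $f_{xd}\le f_{xh}+f_{hd}$, and the digraph on $D$ with arcs $\{(i,j):A_{ij}=1\}$ is acyclic. A feasible solution is an assignment of values in $\{0,1\}$ to variables $y_d$ ($d\in D$), $x^r_{sd}$ ($s\in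 S^r$, $r\in M_d$, $B_{sd}=1$), $x^r_{ij}$ ($r\in M_i\cap M_j$, $A_{ij}=1$) and $x^r_{dt}$ ($r\in M_d$) such that (sums running over existing variables) $$\sum_{d}x^r_{sd}\le l^r_s\quad(s\in S^r,\ r\in R),\qquad \sum_{s}x^r_{si}+\sum_h x^r_{hi}=\sum_j x^r_{ij}+x^r_{it}\ \text{ and }\ \sum_{s}x^r_{si}+\sum_h x^r_{hi}\ge y_i\quad(i\in D,\ r\in M_i).$$ Its objective, to be maximized, is $\sum_d y_dw_d-\sum_r\big(\sum_{s,d}x^r_{sd}c_{sd}+\sum_{i,j}x^r_{ij}c_{ij}\big)$. **Algorithm $\mathcal A$.** Label the types $1,\dots,|R|$ so that their numbers of resources satisfy $m_1\le\dots\le m_{|R|}$. For $r=1,\dots,|R|$ let $E_r$ be the set of demands that require $r$ and none of $1,\dots,r-1$, and find an optimal solution of the one-type problem for type $r$ on $E_r$ without travel costs: a collection of paths $(s,d_1,\dots,d_q)$ with $q\ge1$, $s\in S^r$, all $d_i\in E_r$, $B_{sd_1}=1$ and $A_{d_id_{i+1}}=1$, such that no two paths share a demand and at most $l^r_s$ paths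 start at $s$, which maximizes the total reward of the demands on the paths. Among these $|R|$ solutions take one with the largest total reward (the last one, in case of ties). Output the solution in which exactly the demands on its paths are met, and every type $q$ follows these paths, skipping the demands that do not require $q$. **Theorem.** Consider the instances in which all resources, of all types, have the same starting location, and every travel cost is at most $\frac{1}{2|R|}\,w^{\min}$, where $w^{\min}=\min_{d\in D}w_d$. On these instances Algorithm $\mathcal A$ is a $2|R|$-approximation algorithm for $mRmDc$: every output of the algorithm is a feasible solution, its objective is at least $\frac1{2|R|}$ times the optimal objective, and the algorithm can be implemented to run in time polynomial in the size (binary encoding length) of the instance. Here running time is counted for programs over integer arrays with unit-cost addition, subtraction and comparison. -/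

import Mathlib

namespace MRMD

/-! ## Instances -/

/-- An instance of the heterogeneous multiple resource allocation problem with travel costs, with
demands `Fin n`, resource types `Fin k` and starting locations `Fin p`. A location is a starting
location (`Sum.inl s`) or the location of a demand (`Sum.inr d`). -/
structure Instance (n k p : ℕ) where
  /-- `startSet r` is the set `S^r` of starting locations of type `r`. -/
  startSet : Fin k → Finset (Fin p)
  /-- `count r s` is the number of resources of type `r` that start at `s`. -/
  count : Fin k → Fin p → ℕ
  /-- `req d` is the set `M_d` of resource types that demand `d` requires. -/
  req : Fin n → Finset (Fin k)
  /-- service start time -/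
  time : Fin n → ℤ
  /-- service duration -/
  dur : Fin n → ℕ
  /-- reward for meeting a demand -/
  reward : Fin n → ℤ
  /-- travel time from a location to the location of a demand -/
  travel : Fin p ⊕ Fin n → Fin n → ℕ
  /-- travel cost from a location to the location of a demand -/
  cost : Fin p ⊕ Fin n → Fin n → ℕ

variable {n k p : ℕ}

/-- `A_{ij} = 1`: demand `j` can be served by a resource immediately after demand `i`. -/
def Instance.Arc (I : Instance n k p) (i j : Fin n) : Prop :=
  I.time i + I.dur i + I.travel (Sum.inr i) j ≤ I.time j ∧ (I.req i ∩ I.req j).Nonempty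

/-- `B_{sd} = 1`, for type `r`: a resource of type `r` starting at `s` can serve `d` first. -/
def Instance.StartArc (I : Instance n k p) (r : Fin k) (s : Fin p) (d : Fin n) : Prop :=
  (I.travel (Sum.inl s) d : ℤ) ≤ I.time d ∧ s ∈ I.startSet r ∧ r ∈ I.req d

/-- The standing assumptions on instances: there is a resource type, every demand requires some
type, travel times satisfy the triangle inequality, and the digraph of arcs between demands is
acyclic. -/
structure Instance.Standing (I : Instance n k p) : Prop where
  types_pos : 0 < k
  req_nonempty : ∀ d, (I.req d).Nonempty
  triangle : ∀ x h d, I.travel x d ≤ I.travel x h + I.travel (Sum.inr h) d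
  acyclic : ∀ d, ¬ Relation.TransGen I.Arc d d

/-- All resources, of all types, have the same starting location. -/
def Instance.SameStart (I : Instance n k p) : Prop :=
  ∃ s, ∀ r, I.startSet r = {s}

/-- Every travel cost is at most `1 / (2|R|)` times the reward of every demand, that is, at most
`1 / (2|R|)` times the minimum reward. -/
def Instance.SmallCosts (I : Instance n k p) : Prop :=
  ∀ x d e, (I.cost x d : ℚ) ≤ 1 / (2 * k) * I.reward e

/-! ## The integer program with travel costs -/

/-- Values of the variables of the integer program. -/
structure Solution (n k p : ℕ) where
  /-- `y d`: demand `d` is satisfied -/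
  y : Fin n → ℤ
  /-- `xs r s d`: a resource of type `r` from `s` initially serves `d` -/
  xs : Fin k → Fin p → Fin n → ℤ
  /-- `x r i j`: a resource of type `r` serves `j` right after `i` -/
  x : Fin k → Fin n → Fin n → ℤ
  /-- `xt r d`: a resource of type `r` serves `d` last -/
  xt : Fin k → Fin n → ℤ

/-- The constraints of the integer program. All variables are binary, and variables whose index is
not in the domain of the program (missing arcs, types that are not required) are zero. -/
structure Instance.Feasible (I : Instance n k p) (z : Solution n k p) : Prop where
  supply : ∀ r, ∀ s ∈ I.startSet r, ∑ d, z.xs r s d ≤ I.count r s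
  conservation : ∀ i, ∀ r ∈ I.req i,
    ∑ s, z.xs r s i + ∑ h, z.x r h i = ∑ j, z.x r i j + z.xt r i
  service : ∀ i, ∀ r ∈ I.req i, z.y i ≤ ∑ s, z.xs r s i + ∑ h, z.x r h i
  y_binary : ∀ d, z.y d = 0 ∨ z.y d = 1
  xs_binary : ∀ r s d, z.xs r s d = 0 ∨ (z.xs r s d = 1 ∧ I.StartArc r s d)
  x_binary : ∀ r i j, z.x r i j = 0 ∨ (z.x r i j = 1 ∧ I.Arc i j ∧ r ∈ I.req i ∩ I.req j)
  xt_binary : ∀ r d, z.xt r d = 0 ∨ (z.xt r d = 1 ∧ r ∈ I.req d)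

/-- The objective: collected rewards minus travel costs. -/
def Instance.objective (I : Instance n k p) (z : Solution n k p) : ℤ :=
  ∑ d, z.y d * I.reward d -
    ∑ r, (∑ s, ∑ d, z.xs r s d * I.cost (Sum.inl s) d +
      ∑ i, ∑ j, z.x r i j * I.cost (Sum.inr i) j)

/-! ## Algorithm A -/

/-- A route of one resource: its starting location and the demands it serves, in order. -/
abbrev Route (n p : ℕ) := Fin p × List (Fin n)

/-- The demands served by a list of routes. -/
def served (W : List (Route n p)) : List (Fin n) := W.flatMap Prod.snd

/-- Feasible solutions of the one-type subproblem for type `r` and the demands `E` (all of which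
require `r`): paths from the starting locations, no two of which share a demand, at most
`count r s` of them from `s`. These are the path decompositions of the integral flows in the
minimum cost flow model of the subproblem, where each demand has capacity one and is met exactly if
it lies on a path. -/
structure Instance.RoutesFeasible (I : Instance n k p) (r : Fin k) (E : Finset (Fin n))
    (W : List (Route n p)) : Prop where
  stops_mem : ∀ d ∈ served W, d ∈ E
  first : ∀ ρ ∈ W, ∃ d, ρ.2.head? = some d ∧ I.StartArc r ρ.1 d
  chain : ∀ ρ ∈ W, ρ.2.IsChain I.Arc
  disjoint : (served W).Nodup
  supply : ∀ s, (W.map Prod.fst).count s ≤ I.count r s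

/-- The total reward of a list of routes; travel costs are ignored. -/
def Instance.routesValue (I : Instance n k p) (W : List (Route n p)) : ℤ :=
  ((served W).map I.reward).sum

/-- `W` is an optimal solution of the one-type subproblem. -/
def Instance.RoutesOptimal (I : Instance n k p) (r : Fin k) (E : Finset (Fin n))
    (W : List (Route n p)) : Prop :=
  I.RoutesFeasible r E W ∧ ∀ V, I.RoutesFeasible r E V → I.routesValue V ≤ I.routesValue W

/-- The number of resources of type `r`. -/
def Instance.numResources (I : Instance n k p) (r : Fin k) : ℕ :=
  ∑ s ∈ I.startSet r, I.count r s

/-- The demands of the subproblem of iteration `i`, when the types are processed in the order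
`σ 0, σ 1, …`: those that require type `σ i` and were not removed in an earlier iteration. -/
def Instance.remaining (I : Instance n k p) (σ : Equiv.Perm (Fin k)) (i : Fin k) :
    Finset (Fin n) :=
  Finset.univ.filter fun d => σ i ∈ I.req d ∧ ∀ j < i, σ j ∉ I.req d

/-- The part of a route that a resource of type `q` follows: it visits only the stops which
require `q`. -/
def Instance.restrict (I : Instance n k p) (q : Fin k) (ρ : Route n p) : List (Fin n) :=
  ρ.2.filter fun d => q ∈ I.req d

open Classical in
/-- The solution in which every demand on the routes `W` is met, and resources of every type that
is required by some stop follow the routes. -/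
noncomputable def Instance.follow (I : Instance n k p) (W : List (Route n p)) :
    Solution n k p where
  y d := if d ∈ served W then 1 else 0
  xs q s d := if ∃ ρ ∈ W, ρ.1 = s ∧ (I.restrict q ρ).head? = some d then 1 else 0
  x q i j := if ∃ ρ ∈ W, [i, j] <:+: I.restrict q ρ then 1 else 0
  xt q d := if ∃ ρ ∈ W, (I.restrict q ρ).getLast? = some d then 1 else 0

/-- `I.AlgorithmA z`: the solution `z` is a possible output of Algorithm A on `I`. The types are
sorted by their number of resources and processed in this order; iteration `i` solves the one-type
subproblem of type `σ i` on the remaining demands, and then removes all demands that require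
`σ i`. The best solution found (the last one, in case of ties) is used for all types. The order
among equal numbers of resources and the choice of optimal solutions are left open. -/
def Instance.AlgorithmA (I : Instance n k p) (z : Solution n k p) : Prop :=
  ∃ (σ : Equiv.Perm (Fin k)) (W : Fin k → List (Route n p)) (b : Fin k),
    (Monotone fun i => I.numResources (σ i)) ∧
    (∀ i, I.RoutesOptimal (σ i) (I.remaining σ i) (W i)) ∧
    (∀ i, I.routesValue (W i) ≤ I.routesValue (W b)) ∧
    (∀ i, b < i → I.routesValue (W i) < I.routesValue (W b)) ∧
    z = I.follow (W b)

/-! ## Machine model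

Random access programs over three-dimensional arrays of integers, with unit cost. The only
arithmetic operations are addition and subtraction, so that the bit length of the numbers grows by
at most a constant in each step, and polynomial time here is polynomial time on a Turing machine. -/

/-- The content of the memory: `s a i j l` is the entry `(i, j, l)` of array number `a`. -/
abbrev Store := ℕ → ℕ → ℕ → ℕ → ℤ

/-- Integer expressions. -/
inductive Expr where
  | const (c : ℤ)
  | read (a : ℕ) (e₁ e₂ e₃ : Expr)
  | add (e₁ e₂ : Expr)
  | sub (e₁ e₂ : Expr)

/-- The value of an expression; a negative array index is read as `0`. -/
def Expr.eval (s : Store) : Expr → ℤ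
  | const c => c
  | read a e₁ e₂ e₃ => s a (e₁.eval s).toNat (e₂.eval s).toNat (e₃.eval s).toNat
  | add e₁ e₂ => e₁.eval s + e₂.eval s
  | sub e₁ e₂ => e₁.eval s - e₂.eval s

/-- The number of steps for the evaluation of an expression. -/
def Expr.steps : Expr → ℕ
  | const _ => 1
  | read _ e₁ e₂ e₃ => e₁.steps + e₂.steps + e₃.steps + 1
  | add e₁ e₂ => e₁.steps + e₂.steps + 1
  | sub e₁ e₂ => e₁.steps + e₂.steps + 1

/-- Programs. `assign a e₁ e₂ e₃ e` stores the value of `e` in entry `(e₁, e₂, e₃)` of array `a`;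
`ifLe e₁ e₂ c₁ c₂` runs `c₁` if `e₁ ≤ e₂`, else `c₂`; `loop e c` evaluates `e` once and then runs
`c` as many times as this value says. -/
inductive Prog where
  | skip
  | assign (a : ℕ) (e₁ e₂ e₃ e : Expr)
  | seq (c₁ c₂ : Prog)
  | ifLe (e₁ e₂ : Expr) (c₁ c₂ : Prog)
  | loop (e : Expr) (c : Prog)

/-- Change one entry of the memory. -/
def Store.set (s : Store) (a i j l : ℕ) (v : ℤ) : Store :=
  fun a' i' j' l' => if a' = a ∧ i' = i ∧ j' = j ∧ l' = l then v else s a' i' j' l'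

/-- The memory after a run of the program, and the number of steps of the run. -/
def Prog.run : Prog → Store → Store × ℕ
  | skip, s => (s, 1)
  | assign a e₁ e₂ e₃ e, s =>
      (s.set a (e₁.eval s).toNat (e₂.eval s).toNat (e₃.eval s).toNat (e.eval s),
        e₁.steps + e₂.steps + e₃.steps + e.steps + 1)
  | seq c₁ c₂, s =>
      ((c₂.run (c₁.run s).1).1, (c₁.run s).2 + (c₂.run (c₁.run s).1).2 + 1)
  | ifLe e₁ e₂ c₁ c₂, s =>
      if e₁.eval s ≤ e₂.eval s then
        ((c₁.run s).1, e₁.steps + e₂.steps + (c₁.run s).2 + 1)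
      else
        ((c₂.run s).1, e₁.steps + e₂.steps + (c₂.run s).2 + 1)
  | loop e c, s =>
      (fun t : Store × ℕ => ((c.run t.1).1, t.2 + (c.run t.1).2 + 1))^[(e.eval s).toNat]
        (s, e.steps + 1)

/-! ## Input, output and input size -/

/-- A vector as an array, with zeros elsewhere. -/
def vecArray {a : ℕ} (v : Fin a → ℤ) : ℕ → ℕ → ℕ → ℤ :=
  fun i j l => if h : i < a ∧ j = 0 ∧ l = 0 then v ⟨i, h.1⟩ else 0

/-- A matrix as an array, with zeros elsewhere. -/
def matArray {a b : ℕ} (v : Fin a → Fin b → ℤ) : ℕ → ℕ → ℕ → ℤ :=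
  fun i j l => if h : i < a ∧ j < b ∧ l = 0 then v ⟨i, h.1⟩ ⟨j, h.2.1⟩ else 0

/-- The initial memory that holds the instance. -/
def Instance.encode (I : Instance n k p) : Store
  | 0 => vecArray ![(n : ℤ), (k : ℤ), (p : ℤ)]
  | 1 => matArray fun r s => if s ∈ I.startSet r then 1 else 0
  | 2 => matArray fun r s => (I.count r s : ℤ)
  | 3 => matArray fun d r => if r ∈ I.req d then 1 else 0
  | 4 => vecArray I.time
  | 5 => vecArray fun d => (I.dur d : ℤ)
  | 6 => vecArray I.reward
  | 7 => matArray fun s d => (I.travel (Sum.inl s) d : ℤ)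
  | 8 => matArray fun i j => (I.travel (Sum.inr i) j : ℤ)
  | 9 => matArray fun s d => (I.cost (Sum.inl s) d : ℤ)
  | 10 => matArray fun i j => (I.cost (Sum.inr i) j : ℤ)
  | _ => fun _ _ _ => 0

/-- The solution stored in arrays 11 to 14 of the memory. -/
def readSolution (n k p : ℕ) (s : Store) : Solution n k p where
  y d := s 11 d 0 0
  xs r u d := s 12 r u d
  x r i j := s 13 r i j
  xt r d := s 14 r d 0

/-- The length of the binary encoding of an integer, with a sign bit. -/
def bits (c : ℤ) : ℕ := c.natAbs.size + 1

/-- The size of an instance: the number of bits of a binary encoding. -/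
def Instance.size (I : Instance n k p) : ℕ :=
  n + k + p + ∑ r, ∑ s, (1 + bits (I.count r s)) + n * k +
    ∑ d, (bits (I.time d) + bits (I.dur d) + bits (I.reward d)) +
    ∑ x, ∑ d, (bits (I.travel x d) + bits (I.cost x d))

/-! ## Approximation algorithms -/

/-- An algorithm, given by the relation `A I z` that `z` is a possible output on the instance `I`,
is an `α`-approximation algorithm for the instances in the class `C`, where `α` may depend on the
number of resource types: every possible output on an instance in `C` is a feasible solution whose
objective is at least `1 / α` times the objective of every feasible solution (hence of an optimal
one), and the algorithm can be run in time polynomial in the size of the instance, that is, one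
program produces an output of the algorithm within such a number of steps on every instance
in `C`. -/
def IsApproxAlgorithm (C : ∀ {n k p : ℕ}, Instance n k p → Prop)
    (A : ∀ {n k p : ℕ}, Instance n k p → Solution n k p → Prop) (α : ℕ → ℚ) : Prop :=
  (∀ {n k p : ℕ} (I : Instance n k p), C I → ∀ z, A I z →
    I.Feasible z ∧ ∀ z', I.Feasible z' → 1 / α k * (I.objective z' : ℚ) ≤ I.objective z) ∧
  ∃ (P : Prog) (T : Polynomial ℕ), ∀ {n k p : ℕ} (I : Instance n k p), C I →
    A I (readSolution n k p (P.run I.encode).1) ∧ (P.run I.encode).2 ≤ T.eval I.size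

end MRMD

/-! By the triangle inequality, the time condition `Prec` alone is a strict partial order on the
demands, and between demands with a common type it coincides with `Arc`. A route is therefore a
chain of this order and remains one after demands are skipped, so every type can follow the routes
found for the best type `b` (`follow_feasible`). Supplies suffice: a demand left in iteration `b`
requires no type processed earlier, and the types are sorted by supply.

The ratio is a product of two losses. The factor 2 pays for travel: a type enters a met demand once,
at a cost of at most `1 / (2|R|)` of its reward, so all types together spend at most half of the
collected reward (`follow_objective`). The factor `|R|` comes from splitting the demands met by a
competing solution among the iterations. It suffices that the share of one iteration can be met by
routes of its own type, for then its reward is at most the optimum of that subproblem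
(`Instance.Feasible.objective_le`). The flow of that type may visit a demand several times, so
decomposing it into paths need not give disjoint routes. Instead, a cut argument bounds the
antichains through which the flow passes by the supply (`Instance.Feasible.card_antichain_le`), and
Dilworth's theorem, derived from Hall's theorem in `exists_routing`, covers the demands by that many
disjoint chains.

For the running time, a family of disjoint chains is encoded as a permutation of `n` demands and `n`
terminals, in which an unserved demand is a fixed point that costs its reward. A one-type problem is
then an assignment problem (`routesOptimal_of_optimal`). The Hungarian method solves it with
additions, subtractions and comparisons only; its correctness is linear programming duality
(`Matched.optimal`), and its state is tracked by loop invariants (`exec_forTo`). All loop lengths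
are sums of dimensions and small constants, so a polynomial time bound can be read off the program
text (`Prog.steps_le`). Finally `algorithm_spec` identifies the result as an output of Algorithm A.
-/

namespace MRMD

variable {n k p : ℕ}

/-! ## The order on the demands -/

/-- The time condition for serving `j` after `i`, for demands which may share no type. -/
def Instance.Prec (I : Instance n k p) (i j : Fin n) : Prop :=
  I.time i + I.dur i + I.travel (Sum.inr i) j ≤ I.time j

/-- A resource starting at `s` reaches the demand `d` in time. -/
def Instance.Reach (I : Instance n k p) (s : Fin p) (d : Fin n) : Prop :=
  (I.travel (Sum.inl s) d : ℤ) ≤ I.time d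

theorem Instance.Arc.prec {I : Instance n k p} {i j : Fin n} (h : I.Arc i j) : I.Prec i j := h.1

theorem Instance.Prec.arc {I : Instance n k p} {i j : Fin n} (h : I.Prec i j) {r : Fin k}
    (hi : r ∈ I.req i) (hj : r ∈ I.req j) : I.Arc i j :=
  ⟨h, r, Finset.mem_inter.2 ⟨hi, hj⟩⟩

/-- The detour through `j` is no shorter than the direct trip, and serving `j` takes nonnegative
time. `Arc` itself is not transitive, since `i` and `l` may share no type. -/
theorem Instance.Standing.prec_trans {I : Instance n k p} (hI : I.Standing) {i j l : Fin n}
    (hij : I.Prec i j) (hjl : I.Prec j l) : I.Prec i l := by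
  have h := hI.triangle (Sum.inr i) j l
  unfold Instance.Prec at *
  omega

/-- Every demand shares a type with itself, so `Prec i i` would be a loop of the acyclic digraph. -/
theorem Instance.Standing.prec_irrefl {I : Instance n k p} (hI : I.Standing) (i : Fin n) :
    ¬ I.Prec i i := by
  intro h
  obtain ⟨r, hr⟩ := hI.req_nonempty i
  exact hI.acyclic i (Relation.TransGen.single (h.arc hr hr))

theorem Instance.Standing.reach_of_prec {I : Instance n k p} (hI : I.Standing) {s : Fin p}
    {i j : Fin n} (hi : I.Reach s i) (hij : I.Prec i j) : I.Reach s j := by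
  have h := hI.triangle (Sum.inl s) i j
  unfold Instance.Prec at *
  unfold Instance.Reach at *
  omega

theorem Instance.Standing.prec_wellFounded {I : Instance n k p} (hI : I.Standing) :
    WellFounded I.Prec := by
  have : IsTrans (Fin n) I.Prec := ⟨fun _ _ _ => hI.prec_trans⟩
  have : Std.Irrefl I.Prec := ⟨hI.prec_irrefl⟩
  exact Finite.wellFounded_of_trans_of_irrefl I.Prec

/-! ## Consecutive entries of lists without repetitions -/

/-- Without repetitions `i` occurs at one position only, so any occurrence of the pair splits the
list at the given place. -/
theorem pair_infix_iff_getLast {α : Type*} {l₁ l₂ : List α} {h i : α}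
    (hl : (l₁ ++ i :: l₂).Nodup) : [h, i] <:+: l₁ ++ i :: l₂ ↔ l₁.getLast? = some h := by
  constructor
  · rintro ⟨a, b, hab⟩
    have hab' : (a ++ [h]) ++ i :: b = l₁ ++ i :: l₂ := by simpa using hab
    rw [← hab', List.nodup_middle] at hl
    have := (List.append_cons_inj_of_notMem
      (fun hm => (List.nodup_cons.1 hl).1 (List.mem_append_left _ hm))
      (fun hm => (List.nodup_cons.1 hl).1 (List.mem_append_right _ hm))).1 hab'
    rw [← this.1]
    simp
  · intro hh
    obtain ⟨a, rfl⟩ := List.getLast?_eq_some_iff.1 hh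
    exact ⟨a, l₂, by simp⟩

theorem pair_infix_iff_head {α : Type*} {l₁ l₂ : List α} {i j : α}
    (hl : (l₁ ++ i :: l₂).Nodup) : [i, j] <:+: l₁ ++ i :: l₂ ↔ l₂.head? = some j := by
  constructor
  · rintro ⟨a, b, hab⟩
    have hab' : a ++ i :: (j :: b) = l₁ ++ i :: l₂ := by simpa using hab
    rw [← hab', List.nodup_middle] at hl
    have := (List.append_cons_inj_of_notMem
      (fun hm => (List.nodup_cons.1 hl).1 (List.mem_append_left _ hm))
      (fun hm => (List.nodup_cons.1 hl).1 (List.mem_append_right _ hm))).1 hab'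
    rw [← this.2.2]
    simp
  · intro hh
    obtain ⟨b, rfl⟩ := List.head?_eq_some_iff.1 hh
    exact ⟨l₁, b, by simp⟩

theorem head_iff_nil {α : Type*} {l₁ l₂ : List α} {i : α} (hl : (l₁ ++ i :: l₂).Nodup) :
    (l₁ ++ i :: l₂).head? = some i ↔ l₁ = [] := by
  cases l₁ with
  | nil => simp
  | cons a l => simp at hl; simp; tauto

theorem getLast_iff_nil {α : Type*} {l₁ l₂ : List α} {i : α} (hl : (l₁ ++ i :: l₂).Nodup) :
    (l₁ ++ i :: l₂).getLast? = some i ↔ l₂ = [] := by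
  rcases List.eq_nil_or_concat l₂ with rfl | ⟨l, a, rfl⟩
  · simp
  · have h' : l₁ ++ i :: l.concat a = (l₁ ++ i :: l) ++ [a] := by
      rw [List.concat_eq_append, List.append_assoc, List.cons_append]
    rw [h'] at hl
    rw [h', List.getLast?_concat]
    have h2 := (List.nodup_append.1 hl).2.2 i (List.mem_append_right _ List.mem_cons_self) a
      List.mem_cons_self
    simp only [Option.some.injEq, List.concat_eq_append, List.append_eq_nil_iff,
      List.cons_ne_self, and_false, iff_false]
    exact fun h => h2 h.symm

/-! ## Routes -/

theorem mem_served {W : List (Route n p)} {d : Fin n} : d ∈ served W ↔ ∃ ρ ∈ W, d ∈ ρ.2 := by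
  simp [served]

theorem route_unique {W : List (Route n p)} (hW : (served W).Nodup) {ρ ρ' : Route n p}
    (hρ : ρ ∈ W) (hρ' : ρ' ∈ W) {d : Fin n} (hd : d ∈ ρ.2) (hd' : d ∈ ρ'.2) : ρ = ρ' := by
  by_contra hne
  have h := (List.nodup_flatMap.1 hW).2
  have hsym : Std.Symm (Function.onFun List.Disjoint (Prod.snd : Route n p → List (Fin n))) :=
    ⟨fun a b h => List.Disjoint.symm h⟩
  exact h.forall hρ hρ' hne hd hd'

theorem route_nodup {W : List (Route n p)} (hW : (served W).Nodup) {ρ : Route n p}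
    (hρ : ρ ∈ W) : ρ.2.Nodup :=
  (List.nodup_flatMap.1 hW).1 ρ hρ

theorem mem_restrict {I : Instance n k p} {q : Fin k} {ρ : Route n p} {d : Fin n} :
    d ∈ I.restrict q ρ ↔ d ∈ ρ.2 ∧ q ∈ I.req d := by
  simp [Instance.restrict]

theorem restrict_nodup {I : Instance n k p} {W : List (Route n p)} (hW : (served W).Nodup)
    {ρ : Route n p} (hρ : ρ ∈ W) (q : Fin k) : (I.restrict q ρ).Nodup :=
  (route_nodup hW hρ).filter _

/-! ### The variables of the followed solution at a single demand. -/

section Follow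

variable {I : Instance n k p} {W : List (Route n p)} {q : Fin k} {i : Fin n} {ρ : Route n p}
  {l₁ l₂ : List (Fin n)}

/-- The stop `i` lies on a single route, so an existential over routes that forces `i` onto the
route is decided there. This makes the indicator variables of `follow` computable. -/
theorem exists_route_iff (hW : (served W).Nodup) (hρ : ρ ∈ W) (hi : i ∈ ρ.2)
    {P : Route n p → Prop} (hP : ∀ ρ', P ρ' → i ∈ I.restrict q ρ') :
    (∃ ρ' ∈ W, P ρ') ↔ P ρ := by
  constructor
  · rintro ⟨ρ', h, hp⟩
    rwa [route_unique hW hρ h hi (mem_restrict.1 (hP _ hp)).1]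
  · exact fun h => ⟨ρ, hρ, h⟩

/-- The position of `i` on its restricted route determines every variable at `i`: the neighbours in
the list, or the start and the end of the route where there are none. -/
theorem follow_at (hW : (served W).Nodup) (hρ : ρ ∈ W) (hl : I.restrict q ρ = l₁ ++ i :: l₂) :
    (∀ s, (I.follow W).xs q s i = if ρ.1 = s then (if l₁ = [] then 1 else 0) else 0) ∧
    (∀ h, (I.follow W).x q h i = if l₁.getLast? = some h then 1 else 0) ∧
    (∀ j, (I.follow W).x q i j = if l₂.head? = some j then 1 else 0) ∧
    (I.follow W).xt q i = if l₂ = [] then 1 else 0 := by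
  have hn := restrict_nodup (I := I) hW hρ q
  have hm : i ∈ I.restrict q ρ := by rw [hl]; simp
  have hi := (mem_restrict.1 hm).1
  rw [hl] at hn
  refine ⟨fun s => ?_, fun h => ?_, fun j => ?_, ?_⟩
  · simp only [Instance.follow]
    rw [← ite_and]
    refine if_congr ?_ rfl rfl
    rw [exists_route_iff (I := I) (q := q) hW hρ hi, hl, head_iff_nil hn]
    rintro ρ' ⟨-, h⟩
    exact List.mem_of_mem_head? h
  · simp only [Instance.follow]
    refine if_congr ?_ rfl rfl
    rw [exists_route_iff (I := I) (q := q) hW hρ hi, hl, pair_infix_iff_getLast hn]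
    intro ρ' h
    exact h.subset (by simp)
  · simp only [Instance.follow]
    refine if_congr ?_ rfl rfl
    rw [exists_route_iff (I := I) (q := q) hW hρ hi, hl, pair_infix_iff_head hn]
    intro ρ' h
    exact h.subset (by simp)
  · simp only [Instance.follow]
    refine if_congr ?_ rfl rfl
    rw [exists_route_iff (I := I) (q := q) hW hρ hi, hl, getLast_iff_nil hn]
    intro ρ' h
    exact List.mem_of_getLast? h

/-- Conservation, the service constraint and the bound on the travel costs all rest on this count.
-/
theorem follow_inflow (hW : (served W).Nodup) (hi : i ∈ served W) (hq : q ∈ I.req i) :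
    ∑ s, (I.follow W).xs q s i + ∑ h, (I.follow W).x q h i = 1 ∧
    ∑ j, (I.follow W).x q i j + (I.follow W).xt q i = 1 := by
  obtain ⟨ρ, hρ, hiρ⟩ := mem_served.1 hi
  obtain ⟨l₁, l₂, hl⟩ := List.append_of_mem (mem_restrict.2 ⟨hiρ, hq⟩)
  obtain ⟨h1, h2, h3, h4⟩ := follow_at hW hρ hl
  simp only [h1, h2, h3, h4]
  constructor
  · rcases List.eq_nil_or_concat l₁ with rfl | ⟨l, a, rfl⟩ <;> simp
  · cases l₂ <;> simp

theorem follow_not_served (hi : ¬ (i ∈ served W ∧ q ∈ I.req i)) :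
    (∀ s, (I.follow W).xs q s i = 0) ∧ (∀ h, (I.follow W).x q h i = 0) ∧
    (∀ j, (I.follow W).x q i j = 0) ∧ (I.follow W).xt q i = 0 := by
  have key : ∀ ρ ∈ W, i ∉ I.restrict q ρ := fun ρ hρ hm =>
    hi ⟨mem_served.2 ⟨ρ, hρ, (mem_restrict.1 hm).1⟩, (mem_restrict.1 hm).2⟩
  refine ⟨fun s => if_neg ?_, fun s => if_neg ?_, fun s => if_neg ?_, if_neg ?_⟩
  · rintro ⟨ρ, hρ, -, h⟩
    exact key ρ hρ (List.mem_of_mem_head? h)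
  · rintro ⟨ρ, hρ, h⟩
    exact key ρ hρ (h.subset (by simp))
  · rintro ⟨ρ, hρ, h⟩
    exact key ρ hρ (h.subset (by simp))
  · rintro ⟨ρ, hρ, h⟩
    exact key ρ hρ (List.mem_of_getLast? h)

end Follow

/-- Passing from consecutive stops to all pairs by transitivity is what makes skipping stops
harmless. -/
theorem route_pairwise {I : Instance n k p} (hI : I.Standing) {l : List (Fin n)}
    (hl : l.IsChain I.Arc) : l.Pairwise I.Prec := by
  have : IsTrans (Fin n) I.Prec := ⟨fun _ _ _ => hI.prec_trans⟩
  exact List.isChain_iff_pairwise.1 (hl.imp fun _ _ h => h.prec)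

theorem Instance.RoutesFeasible.reach {I : Instance n k p} (hI : I.Standing) {r : Fin k}
    {E : Finset (Fin n)} {W : List (Route n p)} (hW : I.RoutesFeasible r E W) {ρ : Route n p}
    (hρ : ρ ∈ W) {d : Fin n} (hd : d ∈ ρ.2) : I.Reach ρ.1 d ∧ ρ.1 ∈ I.startSet r := by
  obtain ⟨e, he, hs⟩ := hW.first ρ hρ
  obtain ⟨l, hl⟩ := List.head?_eq_some_iff.1 he
  refine ⟨?_, hs.2.1⟩
  have hp := route_pairwise hI (hW.chain ρ hρ)
  rw [hl] at hp hd
  rcases List.mem_cons.1 hd with rfl | hd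
  · exact hs.1
  · exact hI.reach_of_prec hs.1 (List.rel_of_pairwise_cons hp hd)

/-- Sending an element to a route through it is injective, because no route contains two elements.
This serves both for the first stops of one type and for antichains. -/
theorem card_le_of_routes {W : List (Route n p)} (s : Fin p)
    (X : Finset (Fin n)) (h : ∀ d ∈ X, ∃ ρ ∈ W, ρ.1 = s ∧ d ∈ ρ.2)
    (hX : ∀ d ∈ X, ∀ e ∈ X, ∀ ρ ∈ W, d ∈ ρ.2 → e ∈ ρ.2 → d = e) :
    X.card ≤ (W.map Prod.fst).count s := by
  classical
  have h1 : (W.map Prod.fst).count s = (W.filter fun ρ => ρ.1 = s).length := by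
    rw [List.count, List.countP_map, List.countP_eq_length_filter]
    rfl
  rw [h1]
  rcases X.eq_empty_or_nonempty with rfl | ⟨d₀, hd₀⟩
  · simp
  have : Nonempty (Route n p) := ⟨(h d₀ hd₀).choose⟩
  choose! f hf using h
  calc X.card = (X.image f).card := by
        rw [Finset.card_image_of_injOn]
        intro d hd e he hde
        exact hX d hd e he (f d) (hf d hd).1 (hf d hd).2.2 (by rw [hde]; exact (hf e he).2.2)
    _ ≤ (W.filter fun ρ => ρ.1 = s).toFinset.card := by
        apply Finset.card_le_card
        intro ρ hρ
        obtain ⟨d, hd, rfl⟩ := Finset.mem_image.1 hρ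
        simp only [List.mem_toFinset, List.mem_filter, decide_eq_true_eq]
        exact ⟨(hf d hd).1, (hf d hd).2.1⟩
    _ ≤ _ := List.toFinset_card_le _

/-- Following routes for one type gives a feasible solution for all types. -/
theorem follow_feasible {I : Instance n k p} (hI : I.Standing) {s₀ : Fin p}
    (hs : ∀ r, I.startSet r = {s₀}) {r : Fin k} {E : Finset (Fin n)} {W : List (Route n p)}
    (hW : I.RoutesFeasible r E W)
    (hc : ∀ q, ∀ d ∈ E, q ∈ I.req d → I.count r s₀ ≤ I.count q s₀) :
    I.Feasible (I.follow W) := by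
  have hstart : ∀ ρ ∈ W, ρ.1 = s₀ := by
    intro ρ hρ
    obtain ⟨d, -, h⟩ := hW.first ρ hρ
    simpa [hs] using h.2.1
  refine ⟨?_, ?_, ?_, ?_, ?_, ?_, ?_⟩
  · intro q s hsq
    obtain rfl : s = s₀ := by simpa [hs] using hsq
    classical
    set X : Finset (Fin n) := Finset.univ.filter fun d =>
      ∃ ρ ∈ W, ρ.1 = s ∧ (I.restrict q ρ).head? = some d with hX
    have h1 : ∑ d, (I.follow W).xs q s d = X.card := by
      simp only [Instance.follow, hX]
      rw [Finset.sum_boole]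
    rw [h1]
    -- Supplies of `q` and `r` are comparable only if some stop requires `q`; without such a stop
    -- there is nothing to bound.
    rcases X.eq_empty_or_nonempty with h | ⟨d, hd⟩
    · simp [h]
    · obtain ⟨ρ, hρ, -, hh⟩ := (Finset.mem_filter.1 hd).2
      have hm := mem_restrict.1 (List.mem_of_mem_head? hh)
      have h2 := hc q d (hW.stops_mem d (mem_served.2 ⟨ρ, hρ, hm.1⟩)) hm.2
      have h3 : X.card ≤ (W.map Prod.fst).count s := by
        apply card_le_of_routes
        · intro d hd
          obtain ⟨ρ, hρ, h, hh⟩ := (Finset.mem_filter.1 hd).2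
          exact ⟨ρ, hρ, h, (mem_restrict.1 (List.mem_of_mem_head? hh)).1⟩
        · intro d hd e he ρ hρ hdρ heρ
          obtain ⟨ρ₁, hρ₁, -, hh₁⟩ := (Finset.mem_filter.1 hd).2
          obtain ⟨ρ₂, hρ₂, -, hh₂⟩ := (Finset.mem_filter.1 he).2
          have e1 := route_unique hW.disjoint hρ hρ₁ hdρ
            (mem_restrict.1 (List.mem_of_mem_head? hh₁)).1
          have e2 := route_unique hW.disjoint hρ hρ₂ heρ
            (mem_restrict.1 (List.mem_of_mem_head? hh₂)).1
          rw [← e1] at hh₁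
          rw [← e2, hh₁] at hh₂
          exact Option.some.inj hh₂
      exact_mod_cast (h3.trans (hW.supply s)).trans h2
  · intro i q hq
    by_cases hi : i ∈ served W
    · rw [(follow_inflow hW.disjoint hi hq).1, (follow_inflow hW.disjoint hi hq).2]
    · obtain ⟨h1, h2, h3, h4⟩ := follow_not_served (I := I) (q := q) fun h => hi h.1
      simp [h1, h2, h3, h4]
  · intro i q hq
    by_cases hi : i ∈ served W
    · rw [(follow_inflow hW.disjoint hi hq).1]
      simp only [Instance.follow]
      split_ifs <;> simp
    · obtain ⟨h1, h2, h3, h4⟩ := follow_not_served (I := I) (q := q) fun h => hi h.1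
      simp only [h1, h2]
      simp [Instance.follow, hi]
  · intro d
    simp only [Instance.follow]
    split_ifs <;> simp
  · intro q s d
    simp only [Instance.follow]
    split_ifs with h
    · right
      obtain ⟨ρ, hρ, rfl, hh⟩ := h
      have hm := mem_restrict.1 (List.mem_of_mem_head? hh)
      exact ⟨rfl, (hW.reach hI hρ hm.1).1, by simp [hs, hstart ρ hρ], hm.2⟩
    · simp
  · intro q i j
    simp only [Instance.follow]
    split_ifs with h
    · right
      obtain ⟨ρ, hρ, hh⟩ := h
      have hi := (mem_restrict.1 (hh.subset (List.mem_cons_self : i ∈ [i, j]))).2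
      have hj := (mem_restrict.1 (hh.subset (by simp : j ∈ [i, j]))).2
      -- Neighbours on the restricted route need not be neighbours on the route, but pairwise
      -- precedence passes to sublists.
      have hp : (I.restrict q ρ).Pairwise I.Prec :=
        (route_pairwise hI (hW.chain ρ hρ)).sublist List.filter_sublist
      have := hp.sublist hh.sublist
      simp at this
      exact ⟨rfl, this.arc hi hj, Finset.mem_inter.2 ⟨hi, hj⟩⟩
    · simp
  · intro q d
    simp only [Instance.follow]
    split_ifs with h
    · right
      obtain ⟨ρ, hρ, hh⟩ := h
      exact ⟨rfl, (mem_restrict.1 (List.mem_of_getLast? hh)).2⟩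
    · simp

/-! ## The objective of the output -/

theorem routesValue_eq_sum {I : Instance n k p} {W : List (Route n p)} (hW : (served W).Nodup) :
    I.routesValue W = ∑ d ∈ (served W).toFinset, I.reward d := by
  classical
  unfold Instance.routesValue
  rw [← List.sum_toFinset _ hW]

theorem routesValue_eq {I : Instance n k p} {W : List (Route n p)} (hW : (served W).Nodup) :
    I.routesValue W = ∑ d, (I.follow W).y d * I.reward d := by
  classical
  rw [routesValue_eq_sum hW]
  simp [Instance.follow, ← Finset.sum_filter]
  congr 1
  ext d
  simp

theorem Instance.SmallCosts.le {I : Instance n k p} (hC : I.SmallCosts) (hk : 0 < k)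
    (x : Fin p ⊕ Fin n) (d e : Fin n) : 2 * (k : ℤ) * I.cost x d ≤ I.reward e := by
  have h := hC x d e
  have hk' : (0 : ℚ) < 2 * k := by positivity
  rw [one_div, inv_mul_eq_div, le_div_iff₀ hk'] at h
  have h2 : (2 * (k : ℚ) * I.cost x d) ≤ I.reward e := by linarith
  exact_mod_cast h2

/-- Instances allow negative rewards; the bound on any one nonnegative cost excludes them here. -/
theorem Instance.SmallCosts.reward_nonneg {I : Instance n k p} (hC : I.SmallCosts) (hk : 0 < k)
    (e : Fin n) : 0 ≤ I.reward e :=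
  le_trans (by positivity) (hC.le hk (Sum.inr e) e e)

/-- Travel costs consume at most half of the reward. -/
theorem follow_objective {I : Instance n k p} (hk : 0 < k) (hC : I.SmallCosts)
    {W : List (Route n p)} (hW : (served W).Nodup) :
    I.routesValue W ≤ 2 * I.objective (I.follow W) := by
  have h2 : ∀ r : Fin k, 2 * (k : ℤ) *
      (∑ s, ∑ d, (I.follow W).xs r s d * I.cost (Sum.inl s) d +
        ∑ i, ∑ j, (I.follow W).x r i j * I.cost (Sum.inr i) j) ≤ I.routesValue W := by
    intro r
    -- Each travel cost is charged to the demand at the head of its arc.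
    rw [routesValue_eq hW, Finset.sum_comm, Finset.sum_comm (f := fun i j =>
      (I.follow W).x r i j * (I.cost (Sum.inr i) j : ℤ)), ← Finset.sum_add_distrib,
      Finset.mul_sum]
    apply Finset.sum_le_sum
    intro d _
    have hxs : ∀ s, 0 ≤ (I.follow W).xs r s d := by
      intro s; simp only [Instance.follow]; split_ifs <;> simp
    have hx : ∀ i, 0 ≤ (I.follow W).x r i d := by
      intro s; simp only [Instance.follow]; split_ifs <;> simp
    calc 2 * (k : ℤ) * (∑ s, (I.follow W).xs r s d * I.cost (Sum.inl s) d +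
          ∑ i, (I.follow W).x r i d * I.cost (Sum.inr i) d)
        = ∑ s, (I.follow W).xs r s d * (2 * (k : ℤ) * I.cost (Sum.inl s) d) +
          ∑ i, (I.follow W).x r i d * (2 * (k : ℤ) * I.cost (Sum.inr i) d) := by
          rw [mul_add, Finset.mul_sum, Finset.mul_sum]
          congr 1 <;> exact Finset.sum_congr rfl fun _ _ => by ring
      _ ≤ ∑ s, (I.follow W).xs r s d * I.reward d + ∑ i, (I.follow W).x r i d * I.reward d :=
          add_le_add
            (Finset.sum_le_sum fun s _ => mul_le_mul_of_nonneg_left (hC.le hk _ _ _) (hxs s))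
            (Finset.sum_le_sum fun s _ => mul_le_mul_of_nonneg_left (hC.le hk _ _ _) (hx s))
      _ = (∑ s, (I.follow W).xs r s d + ∑ i, (I.follow W).x r i d) * I.reward d := by
          rw [← Finset.sum_mul, ← Finset.sum_mul, add_mul]
      _ ≤ (I.follow W).y d * I.reward d := by
          apply mul_le_mul_of_nonneg_right _ (hC.reward_nonneg hk d)
          by_cases h : d ∈ served W ∧ r ∈ I.req d
          · rw [(follow_inflow hW h.1 h.2).1]
            simp [Instance.follow, h.1]
          · obtain ⟨h1, h2, -, -⟩ := follow_not_served h
            simp only [h1, h2]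
            simp only [Instance.follow]
            split_ifs <;> simp
  -- Summed over the `k` types, `2k` times the total cost is at most `k` times the value; then `k`
  -- cancels.
  have h3 := Finset.sum_le_sum fun r (_ : r ∈ (Finset.univ : Finset (Fin k))) => h2 r
  rw [← Finset.mul_sum] at h3
  simp only [Finset.sum_const, Finset.card_univ, Fintype.card_fin, nsmul_eq_mul] at h3
  rw [mul_comm 2 (k : ℤ), mul_assoc] at h3
  have h4 := le_of_mul_le_mul_left h3 (by exact_mod_cast hk)
  have h5 := routesValue_eq (I := I) hW
  unfold Instance.objective
  linarith

/-! ## Flows through antichains -/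

/-- The number of visits of resources of type `r` at `d`. -/
def inflow (z : Solution n k p) (r : Fin k) (d : Fin n) : ℤ :=
  ∑ s, z.xs r s d + ∑ h, z.x r h d

section Flow

variable {I : Instance n k p} {z : Solution n k p}

theorem Instance.Feasible.xs_nonneg (hz : I.Feasible z) (r : Fin k) (s : Fin p) (d : Fin n) :
    0 ≤ z.xs r s d := by
  rcases hz.xs_binary r s d with h | h <;> omega

theorem Instance.Feasible.x_nonneg (hz : I.Feasible z) (r : Fin k) (i j : Fin n) :
    0 ≤ z.x r i j := by
  rcases hz.x_binary r i j with h | h <;> omega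

theorem Instance.Feasible.xs_sum (hz : I.Feasible z) {r : Fin k} {s₀ : Fin p}
    (hs : I.startSet r = {s₀}) (d : Fin n) : ∑ s, z.xs r s d = z.xs r s₀ d := by
  apply Finset.sum_eq_single s₀
  · intro s _ hne
    rcases hz.xs_binary r s d with h | ⟨-, -, h, -⟩
    · exact h
    · simp [hs, hne] at h
  · simp

/-- A cut argument. Let `L` be the demands of type `r` strictly below `X`. Whatever enters `X ∪ L`
comes from the start or from `L`, and what leaves `L` is at most the inflow of `L`. Cancelling the
inflow of `L` leaves the inflow of `X`, which is at least the cardinality of `X`, below the supply.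
-/
theorem Instance.Feasible.card_antichain_le (hI : I.Standing) (hz : I.Feasible z) {r : Fin k}
    {s₀ : Fin p} (hs : I.startSet r = {s₀}) {X : Finset (Fin n)}
    (hX : ∀ d ∈ X, ∀ e ∈ X, ¬ I.Prec d e) (hflow : ∀ d ∈ X, 1 ≤ inflow z r d) :
    X.card ≤ I.count r s₀ := by
  classical
  set L : Finset (Fin n) := Finset.univ.filter fun v => r ∈ I.req v ∧ ∃ x ∈ X, I.Prec v x with hL
  have hmem : ∀ v, v ∈ L ↔ r ∈ I.req v ∧ ∃ x ∈ X, I.Prec v x := by simp [hL]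
  have hdisj : Disjoint X L := by
    rw [Finset.disjoint_left]
    intro d hd hdL
    obtain ⟨-, x, hx, h⟩ := (hmem d).1 hdL
    exact hX d hd x hx h
  have hin : ∀ v ∈ X ∪ L, ∑ h, z.x r h v = ∑ h ∈ L, z.x r h v := by
    intro v hv
    symm
    apply Finset.sum_subset (Finset.subset_univ _)
    intro h _ hh
    rcases hz.x_binary r h v with h0 | ⟨-, ha, hr⟩
    · exact h0
    · exfalso
      apply hh
      rw [hmem]
      refine ⟨(Finset.mem_inter.1 hr).1, ?_⟩
      rcases Finset.mem_union.1 hv with hv | hv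
      · exact ⟨v, hv, ha.prec⟩
      · obtain ⟨-, x, hx, h⟩ := (hmem v).1 hv
        exact ⟨x, hx, hI.prec_trans ha.prec h⟩
  have hout : ∑ h ∈ L, ∑ v ∈ X ∪ L, z.x r h v ≤ ∑ h ∈ L, inflow z r h := by
    apply Finset.sum_le_sum
    intro h hh
    have hc := hz.conservation h r ((hmem h).1 hh).1
    have hxt : 0 ≤ z.xt r h := by rcases hz.xt_binary r h with h | h <;> omega
    have : ∑ v ∈ X ∪ L, z.x r h v ≤ ∑ v, z.x r h v :=
      Finset.sum_le_sum_of_subset_of_nonneg (Finset.subset_univ _)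
        fun v _ _ => hz.x_nonneg r h v
    unfold inflow
    linarith
  rw [Finset.sum_comm, Finset.sum_union hdisj] at hout
  have e1 : ∑ h ∈ L, inflow z r h = ∑ h ∈ L, z.xs r s₀ h + ∑ v ∈ L, ∑ h ∈ L, z.x r h v := by
    rw [← Finset.sum_add_distrib]
    refine Finset.sum_congr rfl fun v hv => ?_
    rw [inflow, hz.xs_sum hs, hin v (Finset.mem_union_right _ hv)]
  have e2 : ∑ h ∈ X, inflow z r h = ∑ h ∈ X, z.xs r s₀ h + ∑ v ∈ X, ∑ h ∈ L, z.x r h v := by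
    rw [← Finset.sum_add_distrib]
    refine Finset.sum_congr rfl fun v hv => ?_
    rw [inflow, hz.xs_sum hs, hin v (Finset.mem_union_left _ hv)]
  have e3 : ∑ h ∈ X, z.xs r s₀ h + ∑ h ∈ L, z.xs r s₀ h ≤ ∑ h, z.xs r s₀ h := by
    rw [← Finset.sum_union hdisj]
    exact Finset.sum_le_sum_of_subset_of_nonneg (Finset.subset_univ _)
      fun v _ _ => hz.xs_nonneg r s₀ v
  have e4 := hz.supply r s₀ (by simp [hs])
  have e5 : (X.card : ℤ) ≤ ∑ h ∈ X, inflow z r h := by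
    have := Finset.sum_le_sum hflow
    simpa using this
  have : (X.card : ℤ) ≤ I.count r s₀ := by linarith
  exact_mod_cast this

/-- Flow is traced backwards: it enters `d` from the start, or from an earlier demand that again has
positive inflow. The backward walk ends because `Prec` is well-founded, and reachability propagates
forward by the triangle inequality. -/
theorem Instance.Feasible.reach (hI : I.Standing) (hz : I.Feasible z) {r : Fin k} {s₀ : Fin p}
    (hs : I.startSet r = {s₀}) {d : Fin n} : 1 ≤ inflow z r d → I.Reach s₀ d := by
  induction d using hI.prec_wellFounded.induction with
  | _ d ih =>
    intro hd
    unfold inflow at hd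
    rw [hz.xs_sum hs] at hd
    rcases hz.xs_binary r s₀ d with h0 | ⟨-, h, -⟩
    · have : ∃ h, z.x r h d ≠ 0 := by
        by_contra! hall
        simp [hall, h0] at hd
      obtain ⟨h, hh⟩ := this
      obtain ⟨h1, ha, hr⟩ := (hz.x_binary r h d).resolve_left hh
      refine hI.reach_of_prec (ih h ha.prec ?_) ha.prec
      unfold inflow
      rw [hz.conservation h r (Finset.mem_inter.1 hr).1]
      have hxt : 0 ≤ z.xt r h := by rcases hz.xt_binary r h with h | h <;> omega
      have := Finset.single_le_sum (f := fun j => z.x r h j) (fun j _ => hz.x_nonneg r h j)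
        (Finset.mem_univ d)
      omega
    · exact h

end Flow

/-! ## Routings as permutations -/

/-- A permutation of the demands and `n` terminals which describes routes from `s` for demands
in `E`, at most `c` in number: terminals are mapped to the first demands of routes, demands to their
successors, and demands which are not served to themselves. -/
structure Instance.Routing (I : Instance n k p) (s : Fin p) (E : Finset (Fin n)) (c : ℕ)
    (π : Equiv.Perm (Fin n ⊕ Fin n)) : Prop where
  step : ∀ d e, π (Sum.inl d) = Sum.inl e → d ≠ e → I.Prec d e
  start : ∀ a e, π (Sum.inr a) = Sum.inl e → (a : ℕ) < c
  moved : ∀ d, π (Sum.inl d) ≠ Sum.inl d → d ∈ E ∧ I.Reach s d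

/-- A set of demands without antichains of more than `c` elements can be served by `c` routes. -/
theorem exists_routing {I : Instance n k p} (hI : I.Standing) {s : Fin p} {E : Finset (Fin n)}
    {c : ℕ} {Y : Finset (Fin n)} (hE : ∀ d ∈ Y, d ∈ E ∧ I.Reach s d)
    (hY : ∀ X ⊆ Y, (∀ d ∈ X, ∀ e ∈ X, ¬ I.Prec d e) → X.card ≤ c) :
    ∃ π, I.Routing s E c π ∧ ∀ d, π (Sum.inl d) ≠ Sum.inl d ↔ d ∈ Y := by
  classical
  set C : Finset (Fin n) := Finset.univ.filter fun a => (a : ℕ) < c with hC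
  have hCcard : C.card = min c n := by
    rw [hC, Fin.card_filter_val_lt, min_comm]
  -- The possible successors of `y`: a later demand of `Y`, or a terminal below `c`, which ends the
  -- chain. A system of distinct successors is a cover by disjoint chains.
  let t : Y → Finset (Fin n ⊕ Fin n) := fun y => (Y.filter fun e => I.Prec y e).disjSum C
  have hall : ∀ A : Finset Y, A.card ≤ (A.biUnion t).card := by
    intro A
    rcases A.eq_empty_or_nonempty with rfl | ⟨a₀, ha₀⟩
    · simp
    set B : Finset (Fin n) := A.map (Function.Embedding.subtype _) with hB
    set N : Finset (Fin n) := Y.filter fun e => ∃ a ∈ B, I.Prec a e with hN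
    have hBY : B ⊆ Y := by
      intro b hb
      simp [hB] at hb
      exact hb.1
    have h1 : N.disjSum C ⊆ A.biUnion t := by
      intro x hx
      rw [Finset.mem_biUnion]
      rcases Finset.mem_disjSum.1 hx with ⟨e, he, rfl⟩ | ⟨a, ha, rfl⟩
      · obtain ⟨heY, b, hb, hbe⟩ := Finset.mem_filter.1 he
        obtain ⟨y, hy, rfl⟩ := Finset.mem_map.1 hb
        exact ⟨y, hy, Finset.inl_mem_disjSum.2 (Finset.mem_filter.2 ⟨heY, hbe⟩)⟩
      · exact ⟨a₀, ha₀, Finset.inr_mem_disjSum.2 ha⟩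
    -- The members of `B` not preceded by a member of `B` form an antichain. The bound `n` is needed
    -- because there are only `n` terminals.
    have h2 : (B \ N).card ≤ min c n := by
      apply le_min
      · apply hY _ (Finset.sdiff_subset.trans hBY)
        intro d hd e he hde
        rw [Finset.mem_sdiff] at hd he
        exact he.2 (Finset.mem_filter.2 ⟨hBY he.1, d, hd.1, hde⟩)
      · simpa using Finset.card_le_univ (B \ N)
    have h3 : B.card ≤ (B \ N).card + N.card := by
      have := Finset.le_card_sdiff N B
      omega
    calc A.card = B.card := by simp [hB]
      _ ≤ N.card + C.card := by omega
      _ = (N.disjSum C).card := (Finset.card_disjSum _ _).symm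
      _ ≤ _ := Finset.card_le_card h1
  obtain ⟨g, hg, hgt⟩ := (Finset.all_card_le_biUnion_card_iff_exists_injective t).1 hall
  set S : Finset (Fin n ⊕ Fin n) := Y.disjSum C with hS
  have hgS : ∀ y, g y ∈ S := by
    intro y
    have := hgt y
    simp only [t] at this
    rcases Finset.mem_disjSum.1 this with ⟨e, he, h⟩ | ⟨a, ha, h⟩
    · rw [← h]
      exact Finset.inl_mem_disjSum.2 (Finset.mem_filter.1 he).1
    · rw [← h]
      exact Finset.inr_mem_disjSum.2 ha
  -- The injection `g` on `Y` extends to a permutation of `Y` and the terminals in `C`. The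
  -- extension sends terminals to the demands that are nobody's successor, which are the first
  -- demands of the chains.
  let f : S → Fin n ⊕ Fin n := fun x =>
    if h : ∃ y : Y, x.1 = Sum.inl y.1 then g h.choose else x.1
  have hf : ∀ (y : Y) (h : Sum.inl y.1 ∈ S), f ⟨Sum.inl y.1, h⟩ = g y := by
    intro y h
    have hex : ∃ y' : Y, (Sum.inl y.1 : Fin n ⊕ Fin n) = Sum.inl y'.1 := ⟨y, rfl⟩
    have : hex.choose = y := Subtype.ext (Sum.inl.inj hex.choose_spec).symm
    simp only [f]
    rw [dif_pos hex, this]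
  obtain ⟨e, he⟩ := Set.MapsTo.exists_equiv_extend_of_card_eq (t := S) (by simp)
    (s := {x : S | ∃ y : Y, x.1 = Sum.inl y.1}) (f := f)
    (by
      rintro ⟨x, hx⟩ ⟨y, rfl⟩
      rw [hf]
      exact hgS y)
    (by
      rintro ⟨x, hx⟩ ⟨y, rfl⟩ ⟨x', hx'⟩ ⟨y', rfl⟩ h
      rw [hf, hf] at h
      rw [Subtype.mk.injEq, hg h])
  set π : Equiv.Perm (Fin n ⊕ Fin n) := Equiv.Perm.ofSubtype (p := fun x => x ∈ S) e with hπ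
  have hπY : ∀ y : Y, π (Sum.inl y.1) = g y := by
    intro y
    have hy : (Sum.inl y.1 : Fin n ⊕ Fin n) ∈ S := Finset.inl_mem_disjSum.2 y.2
    rw [hπ, Equiv.Perm.ofSubtype_apply_of_mem _ hy, ← hf y hy]
    exact he ⟨_, hy⟩ ⟨y, rfl⟩
  have hπn : ∀ x, x ∉ S → π x = x := fun x hx => Equiv.Perm.ofSubtype_apply_of_not_mem _ hx
  have hY' : ∀ d, π (Sum.inl d) ≠ Sum.inl d → d ∈ Y := by
    intro d hd
    by_contra hdY
    exact hd (hπn _ (by rw [Finset.inl_mem_disjSum]; exact hdY))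
  have hstep : ∀ d e, d ∈ Y → π (Sum.inl d) = Sum.inl e → I.Prec d e := by
    intro d e hd h
    have := hgt ⟨d, hd⟩
    rw [← hπY ⟨d, hd⟩, h] at this
    exact (Finset.mem_filter.1 (Finset.inl_mem_disjSum.1 this)).2
  refine ⟨π, ⟨?_, ?_, fun d hd => hE d (hY' d hd)⟩, fun d => ⟨hY' d, ?_⟩⟩
  · intro d e h hne
    apply hstep d e (hY' d ?_) h
    rw [h]
    simpa using hne.symm
  · intro a e h
    by_contra hac
    have : π (Sum.inr a) = Sum.inr a := hπn _ (by
      rw [Finset.inr_mem_disjSum, hC]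
      simpa using hac)
    rw [this] at h
    simp at h
  · intro hd h
    exact hI.prec_irrefl d (hstep d d hd h)

/-- The demands met when following `π` from `x` for at most `m` steps. -/
def trail (π : Equiv.Perm (Fin n ⊕ Fin n)) : ℕ → Fin n ⊕ Fin n → List (Fin n)
  | 0, _ => []
  | _ + 1, Sum.inr _ => []
  | m + 1, Sum.inl d => d :: trail π m (π (Sum.inl d))

/-- The routes described by a permutation. -/
def routesOf (s : Fin p) (π : Equiv.Perm (Fin n ⊕ Fin n)) : List (Route n p) :=
  ((List.finRange n).filter fun a => (π (Sum.inr a)).isLeft).map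
    fun a => (s, trail π n (π (Sum.inr a)))

/-- Move to the next demand unless the current demand requires type `q`. -/
def Instance.chase (I : Instance n k p) (q : Fin k) (π : Equiv.Perm (Fin n ⊕ Fin n)) :
    Fin n ⊕ Fin n → Fin n ⊕ Fin n
  | Sum.inl d => if q ∈ I.req d then Sum.inl d else π (Sum.inl d)
  | Sum.inr a => Sum.inr a

open Classical in
/-- A bound on the number of demands on a trail from `x`. -/
noncomputable def Instance.height (I : Instance n k p) : Fin n ⊕ Fin n → ℕ
  | Sum.inl d => (Finset.univ.filter fun e => I.Prec d e).card + 1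
  | Sum.inr _ => 0

/-- `x` is a terminal or a demand which is served. -/
def Active (π : Equiv.Perm (Fin n ⊕ Fin n)) (x : Fin n ⊕ Fin n) : Prop :=
  ∀ d, x = Sum.inl d → π x ≠ x

/-! ### Trails of a routing, and the routes they form. -/

section Routing

variable {I : Instance n k p} {s : Fin p} {E : Finset (Fin n)} {c : ℕ}
  {π : Equiv.Perm (Fin n ⊕ Fin n)}

theorem active_next {x : Fin n ⊕ Fin n} (hx : Active π x) : Active π (π x) := by
  intro e he h
  have hxe : π x = x := π.injective h
  rw [hxe] at he
  exact hx e he hxe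

theorem height_le (hI : I.Standing) (x : Fin n ⊕ Fin n) : I.height x ≤ n := by
  classical
  rcases x with d | a
  · have : (Finset.univ.filter fun e => I.Prec d e).card < (Finset.univ : Finset (Fin n)).card := by
      apply Finset.card_lt_card
      rw [Finset.filter_ssubset]
      exact ⟨d, Finset.mem_univ _, hI.prec_irrefl d⟩
    simp only [Finset.card_univ, Fintype.card_fin] at this
    exact this
  · exact Nat.zero_le _

/-- By transitivity and irreflexivity, fewer demands lie above the successor than above `d`. -/
theorem Instance.Routing.height_lt (hI : I.Standing) (hπ : I.Routing s E c π) {d : Fin n}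
    (hd : Active π (Sum.inl d)) : I.height (π (Sum.inl d)) < I.height (Sum.inl d) := by
  classical
  rcases h : π (Sum.inl d) with e | a
  · have hne : d ≠ e := by
      rintro rfl
      exact hd d rfl h
    have hde := hπ.step d e h hne
    simp only [Instance.height]
    apply Nat.succ_lt_succ
    apply Finset.card_lt_card
    rw [Finset.ssubset_iff_of_subset]
    · exact ⟨e, by simpa using hde, by simpa using hI.prec_irrefl e⟩
    · intro f hf
      simp only [Finset.mem_filter, Finset.mem_univ, true_and] at hf ⊢
      exact hI.prec_trans hde hf
  · simp [Instance.height]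

/-- The step bound in `trail` is fuel; a trail has at most `height` demands, so fuel beyond the
height is not used. -/
theorem Instance.Routing.trail_succ (hI : I.Standing) (hπ : I.Routing s E c π) (m : ℕ) :
    ∀ x, Active π x → I.height x ≤ m → trail π (m + 1) x = trail π m x := by
  induction m with
  | zero =>
    rintro (d | a) hx hm
    · simp [Instance.height] at hm
    · rfl
  | succ m ih =>
    rintro (d | a) hx hm
    · rw [trail, trail, ih _ (active_next hx)]
      have := hπ.height_lt hI hx
      omega
    · rfl

theorem Instance.Routing.trail_eq (hI : I.Standing) (hπ : I.Routing s E c π) {x : Fin n ⊕ Fin n}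
    (hx : Active π x) {m : ℕ} (hm : I.height x ≤ m) : trail π m x = trail π n x := by
  have h : ∀ l, trail π (I.height x + l) x = trail π (I.height x) x := by
    intro l
    induction l with
    | zero => rfl
    | succ l ih =>
      rw [← ih, ← hπ.trail_succ hI (I.height x + l) x hx (by omega)]
      rfl
  obtain ⟨l, rfl⟩ := Nat.exists_eq_add_of_le hm
  obtain ⟨l', hl'⟩ := Nat.exists_eq_add_of_le (height_le hI x)
  have h' : trail π n x = trail π (I.height x + l') x := congrArg (fun m => trail π m x) hl'
  rw [h, h', h]

/-- Since `n` bounds all heights, unfolding a trail need not lower its fuel. Later arguments use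
this recursion instead of the definition. -/
theorem Instance.Routing.trail_inl (hI : I.Standing) (hπ : I.Routing s E c π) {d : Fin n}
    (hd : Active π (Sum.inl d)) :
    trail π n (Sum.inl d) = d :: trail π n (π (Sum.inl d)) := by
  have h2 := height_le hI (Sum.inl d)
  rw [← hπ.trail_eq hI hd (h2.trans n.le_succ), trail]

theorem trail_inr (m : ℕ) (a : Fin n) : trail π m (Sum.inr a) = [] := by
  cases m <;> rfl

/-- Induction along the trails. -/
theorem Instance.Routing.induction (hI : I.Standing) (hπ : I.Routing s E c π)
    {P : Fin n ⊕ Fin n → Prop} (h₁ : ∀ a, P (Sum.inr a))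
    (h₂ : ∀ d, Active π (Sum.inl d) → P (π (Sum.inl d)) → P (Sum.inl d)) {x : Fin n ⊕ Fin n}
    (hx : Active π x) : P x := by
  induction hm : I.height x using Nat.strong_induction_on generalizing x with
  | _ m ih =>
    rcases x with d | a
    · exact h₂ d hx (ih _ (hm ▸ hπ.height_lt hI hx) (active_next hx) rfl)
    · exact h₁ a

theorem Instance.Routing.trail_active (hI : I.Standing) (hπ : I.Routing s E c π)
    {x : Fin n ⊕ Fin n} (hx : Active π x) : ∀ d ∈ trail π n x, Active π (Sum.inl d) := by
  refine hπ.induction hI (P := fun x => ∀ d ∈ trail π n x, Active π (Sum.inl d))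
    (fun a => by simp [trail_inr]) ?_ hx
  intro d hd ih e he
  rw [hπ.trail_inl hI hd] at he
  rcases List.mem_cons.1 he with rfl | he
  · exact hd
  · exact ih e he

/-- What follows a demand on a trail depends on that demand alone, not on where the trail began. -/
theorem Instance.Routing.trail_split (hI : I.Standing) (hπ : I.Routing s E c π)
    {x : Fin n ⊕ Fin n} (hx : Active π x) :
    ∀ d ∈ trail π n x, ∃ l, trail π n x = l ++ d :: trail π n (π (Sum.inl d)) := by
  refine hπ.induction hI
    (P := fun x => ∀ d ∈ trail π n x, ∃ l, trail π n x = l ++ d :: trail π n (π (Sum.inl d)))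
    (fun a => by simp [trail_inr]) ?_ hx
  intro d hd ih e he
  rw [hπ.trail_inl hI hd] at he ⊢
  rcases List.mem_cons.1 he with rfl | he
  · exact ⟨[], rfl⟩
  · obtain ⟨l, hl⟩ := ih e he
    exact ⟨d :: l, by rw [hl]; rfl⟩

theorem Instance.Routing.trail_pred (hI : I.Standing) (hπ : I.Routing s E c π)
    {x : Fin n ⊕ Fin n} (hx : Active π x) :
    ∀ d ∈ trail π n x, x = Sum.inl d ∨ ∃ e ∈ trail π n x, π (Sum.inl e) = Sum.inl d := by
  refine hπ.induction hI
    (P := fun x => ∀ d ∈ trail π n x, x = Sum.inl d ∨ ∃ e ∈ trail π n x, π (Sum.inl e) = Sum.inl d)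
    (fun a => by simp [trail_inr]) ?_ hx
  intro d hd ih e he
  rw [hπ.trail_inl hI hd] at he ⊢
  rcases List.mem_cons.1 he with rfl | he
  · exact Or.inl rfl
  · right
    rcases ih e he with h | ⟨f, hf, h⟩
    · exact ⟨d, List.mem_cons_self, h⟩
    · exact ⟨f, List.mem_cons_of_mem _ hf, h⟩

theorem Instance.Routing.trail_pairwise (hI : I.Standing) (hπ : I.Routing s E c π)
    {x : Fin n ⊕ Fin n} (hx : Active π x) : (trail π n x).IsChain I.Prec := by
  refine hπ.induction hI (P := fun x => (trail π n x).IsChain I.Prec)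
    (fun a => by simp [trail_inr]) ?_ hx
  intro d hd ih
  rw [hπ.trail_inl hI hd]
  rcases h : π (Sum.inl d) with e | a
  · have he : Active π (Sum.inl e) := h ▸ active_next hd
    rw [h, hπ.trail_inl hI he] at ih
    rw [hπ.trail_inl hI he, List.isChain_cons_cons]
    refine ⟨hπ.step d e h ?_, ih⟩
    rintro rfl
    exact hd d rfl h
  · simp [trail_inr]

theorem active_inr (a : Fin n) : Active π (Sum.inr a) := fun d h => by simp at h

theorem active_source (a : Fin n) : Active π (π (Sum.inr a)) := active_next (active_inr a)

/-- For the converse, `π` is followed backwards from a moved demand. Predecessors decrease in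
`Prec`, so a terminal is reached: there are no cycles of demands other than fixed points. -/
theorem Instance.Routing.mem_trail_iff (hI : I.Standing) (hπ : I.Routing s E c π) (d : Fin n) :
    (∃ a, d ∈ trail π n (π (Sum.inr a))) ↔ π (Sum.inl d) ≠ Sum.inl d := by
  constructor
  · rintro ⟨a, ha⟩
    exact hπ.trail_active hI (active_source a) d ha d rfl
  · induction d using hI.prec_wellFounded.induction with
    | _ d ih =>
      intro hd
      have hda : Active π (Sum.inl d) := fun _ _ => hd
      obtain ⟨x, hx⟩ := π.surjective (Sum.inl d)
      rcases x with e | a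
      · have hed : e ≠ d := by
          rintro rfl
          exact hd hx
        have hea : π (Sum.inl e) ≠ Sum.inl e := by
          rw [hx]
          simpa using hed.symm
        obtain ⟨a, ha⟩ := ih e (hπ.step e d hx hed) hea
        refine ⟨a, ?_⟩
        obtain ⟨l, hl⟩ := hπ.trail_split hI (active_source a) e ha
        rw [hl, hx, hπ.trail_inl hI hda]
        simp
      · refine ⟨a, ?_⟩
        rw [hx, hπ.trail_inl hI hda]
        simp

/-- Two trails that share a demand share its predecessor, since `π` is injective; going back, they
start at the same terminal. This makes the routes disjoint. -/
theorem Instance.Routing.trail_source (hI : I.Standing) (hπ : I.Routing s E c π) (d : Fin n) :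
    ∀ a b, d ∈ trail π n (π (Sum.inr a)) → d ∈ trail π n (π (Sum.inr b)) → a = b := by
  induction d using hI.prec_wellFounded.induction with
  | _ d ih =>
    intro a b ha hb
    rcases hπ.trail_pred hI (active_source a) d ha with h | ⟨e, he, h⟩ <;>
      rcases hπ.trail_pred hI (active_source b) d hb with h' | ⟨e', he', h'⟩
    · exact Sum.inr.inj (π.injective (h.trans h'.symm))
    · simpa using π.injective (h.trans h'.symm)
    · simpa using π.injective (h.trans h'.symm)
    · obtain rfl := Sum.inl.inj (π.injective (h.trans h'.symm))
      refine ih e (hπ.step e d h ?_) a b he he'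
      rintro rfl
      exact hπ.trail_active hI (active_source a) e he e rfl h

theorem mem_routesOf {ρ : Route n p} : ρ ∈ routesOf s π ↔
    ∃ a, (π (Sum.inr a)).isLeft ∧ ρ = (s, trail π n (π (Sum.inr a))) := by
  simp only [routesOf, List.mem_map, List.mem_filter, List.mem_finRange, true_and]
  exact exists_congr fun a => and_congr_right fun _ => eq_comm

theorem mem_served_routesOf {d : Fin n} :
    d ∈ served (routesOf s π) ↔ ∃ a, d ∈ trail π n (π (Sum.inr a)) := by
  rw [mem_served]
  constructor
  · rintro ⟨ρ, hρ, hd⟩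
    obtain ⟨a, -, rfl⟩ := mem_routesOf.1 hρ
    exact ⟨a, hd⟩
  · rintro ⟨a, ha⟩
    refine ⟨_, mem_routesOf.2 ⟨a, ?_, rfl⟩, ha⟩
    rcases h : π (Sum.inr a) with e | b
    · rfl
    · rw [h, trail_inr] at ha
      simp at ha

theorem Instance.Routing.served_iff (hI : I.Standing) (hπ : I.Routing s E c π) (d : Fin n) :
    d ∈ served (routesOf s π) ↔ π (Sum.inl d) ≠ Sum.inl d :=
  mem_served_routesOf.trans (hπ.mem_trail_iff hI d)

/-- Steps of `π` satisfy only the time condition; they are arcs because all moved demands lie in `E`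
and so require `r`. The supply bound holds because only terminals below the supply start a trail. -/
theorem Instance.Routing.routesFeasible (hI : I.Standing) {r : Fin k}
    (hs : I.startSet r = {s}) (hE : ∀ d ∈ E, r ∈ I.req d)
    (hπ : I.Routing s E (I.count r s) π) : I.RoutesFeasible r E (routesOf s π) := by
  have hmem : ∀ d ∈ served (routesOf s π), d ∈ E := fun d hd =>
    (hπ.moved d ((hπ.served_iff hI d).1 hd)).1
  have hreq : ∀ a, ∀ d ∈ trail π n (π (Sum.inr a)), r ∈ I.req d := fun a d hd =>
    hE d (hmem d (mem_served_routesOf.2 ⟨a, hd⟩))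
  refine ⟨hmem, ?_, ?_, ?_, ?_⟩
  · intro ρ hρ
    obtain ⟨a, ha, rfl⟩ := mem_routesOf.1 hρ
    rcases h : π (Sum.inr a) with e | b
    · have hea : Active π (Sum.inl e) := h ▸ active_source a
      refine ⟨e, by simp [hπ.trail_inl hI hea], (hπ.moved e (hea e rfl)).2, by simp [hs], ?_⟩
      exact hE e (hπ.moved e (hea e rfl)).1
    · simp [h] at ha
  · intro ρ hρ
    obtain ⟨a, ha, rfl⟩ := mem_routesOf.1 hρ
    refine List.IsChain.imp_of_mem_imp ?_ (hπ.trail_pairwise hI (active_source a))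
    intro d e hd he h
    exact h.arc (hreq a d hd) (hreq a e he)
  · have : IsTrans (Fin n) I.Prec := ⟨fun _ _ _ => hI.prec_trans⟩
    rw [served, List.nodup_flatMap]
    constructor
    · intro ρ hρ
      obtain ⟨a, ha, rfl⟩ := mem_routesOf.1 hρ
      refine (List.isChain_iff_pairwise.1 (hπ.trail_pairwise hI (active_source a))).imp ?_
      rintro d e h rfl
      exact hI.prec_irrefl d h
    · unfold routesOf
      rw [List.pairwise_map]
      refine (((List.nodup_finRange n).filter _)).imp ?_
      intro a b hab d hd hd'
      exact hab (hπ.trail_source hI d a b hd hd')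
  · intro s'
    classical
    rw [routesOf, List.map_map]
    by_cases hss : s' = s
    · subst hss
      refine List.count_le_length.trans ?_
      rw [List.length_map]
      have hnd := (List.nodup_finRange n).filter fun a => (π (Sum.inr a)).isLeft
      rw [← List.toFinset_card_of_nodup hnd]
      calc _ ≤ (Finset.univ.filter fun a : Fin n => (a : ℕ) < I.count r s').card := by
            apply Finset.card_le_card
            intro a ha
            simp only [List.mem_toFinset, List.mem_filter, List.mem_finRange, true_and] at ha
            obtain ⟨e, he⟩ := Sum.isLeft_iff.1 ha
            simpa using hπ.start a e he
        _ ≤ _ := by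
            rw [Fin.card_filter_val_lt]
            exact min_le_right _ _
    · rw [List.count_eq_zero_of_not_mem]
      · exact Nat.zero_le _
      · simp only [List.mem_map, Function.comp]
        rintro ⟨a, -, rfl⟩
        exact hss rfl

/-! ### Skipping demands along a routing. -/

theorem chase_fixed {q : Fin k} {d : Fin n} (hq : q ∈ I.req d) (m : ℕ) :
    (I.chase q π)^[m] (Sum.inl d) = Sum.inl d :=
  Function.iterate_fixed (by simp [Instance.chase, hq]) m

theorem chase_inr {q : Fin k} {a : Fin n} (m : ℕ) :
    (I.chase q π)^[m] (Sum.inr a) = Sum.inr a :=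
  Function.iterate_fixed rfl m

/-- `chase` rests at the first demand of the trail that requires `q`, or at a terminal. Every real
move lowers the height, so `height` rounds suffice and further rounds change nothing. -/
theorem Instance.Routing.chase_eq (hI : I.Standing) (hπ : I.Routing s E c π) (q : Fin k) (m : ℕ) :
    ∀ x, Active π x → I.height x ≤ m →
      ((I.chase q π)^[m] x).getLeft? = ((trail π n x).filter fun d => q ∈ I.req d).head? := by
  induction m with
  | zero =>
    rintro (d | a) hx hm
    · simp [Instance.height] at hm
    · simp [trail_inr]
  | succ m ih =>
    rintro (d | a) hx hm
    · rw [hπ.trail_inl hI hx]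
      by_cases hq : q ∈ I.req d
      · rw [chase_fixed hq]
        simp [hq]
      · have := hπ.height_lt hI hx
        rw [Function.iterate_succ_apply]
        have h2 : I.chase q π (Sum.inl d) = π (Sum.inl d) := by simp [Instance.chase, hq]
        rw [h2, ih _ (active_next hx) (by omega), List.filter_cons]
        simp [hq]
    · rw [chase_inr]
      simp [trail_inr]

theorem Instance.Routing.chase_iff (hI : I.Standing) (hπ : I.Routing s E c π) (q : Fin k)
    {x : Fin n ⊕ Fin n} (hx : Active π x) (d : Fin n) :
    (I.chase q π)^[n] x = Sum.inl d ↔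
      ((trail π n x).filter fun d => q ∈ I.req d).head? = some d := by
  rw [← hπ.chase_eq hI q n x hx (height_le hI x), Sum.getLeft?_eq_some_iff]

open Classical in
/-- The variables of the solution that follows the routes of a permutation. -/
theorem Instance.Routing.follow_eq (hI : I.Standing) {r : Fin k} (hs : I.startSet r = {s})
    (hE : ∀ d ∈ E, r ∈ I.req d) (hπ : I.Routing s E (I.count r s) π) :
    I.follow (routesOf s π) =
      { y := fun d => if π (Sum.inl d) ≠ Sum.inl d then 1 else 0
        xs := fun q s' d =>
          if s' = s ∧ ∃ a, (I.chase q π)^[n] (π (Sum.inr a)) = Sum.inl d then 1 else 0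
        x := fun q i j => if (π (Sum.inl i) ≠ Sum.inl i ∧ q ∈ I.req i) ∧
          (I.chase q π)^[n] (π (Sum.inl i)) = Sum.inl j then 1 else 0
        xt := fun q i => if (π (Sum.inl i) ≠ Sum.inl i ∧ q ∈ I.req i) ∧
          ((I.chase q π)^[n] (π (Sum.inl i))).isRight then 1 else 0 } := by
  have hF := hπ.routesFeasible hI hs hE
  -- Behind the stop `i`, the restricted route is the filtered trail from `π i`. Its head is what
  -- the chase finds, and it is empty exactly if the chase ends at a terminal.
  have hsplit : ∀ q i ρ, ρ ∈ routesOf s π → i ∈ I.restrict q ρ →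
      (π (Sum.inl i) ≠ Sum.inl i ∧ q ∈ I.req i) ∧ ∃ l, I.restrict q ρ =
        l ++ i :: ((trail π n (π (Sum.inl i))).filter fun d => q ∈ I.req d) := by
    intro q i ρ hρ hi
    obtain ⟨a, ha, rfl⟩ := mem_routesOf.1 hρ
    have hi' := mem_restrict.1 hi
    refine ⟨⟨(hπ.mem_trail_iff hI i).1 ⟨a, hi'.1⟩, hi'.2⟩, ?_⟩
    obtain ⟨l, hl⟩ := hπ.trail_split hI (active_source a) i hi'.1
    refine ⟨l.filter fun d => q ∈ I.req d, ?_⟩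
    simp only [Instance.restrict]
    rw [hl, List.filter_append, List.filter_cons]
    simp [hi'.2]
  have hex : ∀ q i, (π (Sum.inl i) ≠ Sum.inl i ∧ q ∈ I.req i) →
      ∃ ρ ∈ routesOf s π, i ∈ I.restrict q ρ := by
    rintro q i ⟨hi, hq⟩
    obtain ⟨ρ, hρ, h⟩ := mem_served.1 ((hπ.served_iff hI i).2 hi)
    exact ⟨ρ, hρ, mem_restrict.2 ⟨h, hq⟩⟩
  have hact : ∀ i, π (Sum.inl i) ≠ Sum.inl i → Active π (π (Sum.inl i)) := fun i hi =>
    active_next fun _ _ => hi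
  unfold Instance.follow
  congr 1
  · funext d
    exact if_congr (hπ.served_iff hI d) rfl rfl
  · funext q s' d
    refine if_congr ?_ rfl rfl
    constructor
    · rintro ⟨ρ, hρ, h, hh⟩
      obtain ⟨a, -, rfl⟩ := mem_routesOf.1 hρ
      exact ⟨h.symm, a, (hπ.chase_iff hI q (active_source a) d).2 hh⟩
    · rintro ⟨rfl, a, ha⟩
      refine ⟨_, mem_routesOf.2 ⟨a, ?_, rfl⟩, rfl, (hπ.chase_iff hI q (active_source a) d).1 ha⟩
      rcases h : π (Sum.inr a) with e | b
      · rfl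
      · rw [h, chase_inr] at ha
        simp at ha
  · funext q i j
    refine if_congr ?_ rfl rfl
    constructor
    · rintro ⟨ρ, hρ, h⟩
      obtain ⟨hi, l, hl⟩ := hsplit q i ρ hρ (h.subset (by simp))
      have hn := restrict_nodup (I := I) hF.disjoint hρ q
      rw [hl] at h hn
      exact ⟨hi, (hπ.chase_iff hI q (hact i hi.1) j).2 ((pair_infix_iff_head hn).1 h)⟩
    · rintro ⟨hi, h⟩
      obtain ⟨ρ, hρ, hiρ⟩ := hex q i hi
      obtain ⟨-, l, hl⟩ := hsplit q i ρ hρ hiρ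
      have hn := restrict_nodup (I := I) hF.disjoint hρ q
      refine ⟨ρ, hρ, ?_⟩
      rw [hl] at hn ⊢
      exact (pair_infix_iff_head hn).2 ((hπ.chase_iff hI q (hact i hi.1) j).1 h)
  · funext q i
    have hnil : π (Sum.inl i) ≠ Sum.inl i → (((I.chase q π)^[n] (π (Sum.inl i))).isRight ↔
        ((trail π n (π (Sum.inl i))).filter fun d => q ∈ I.req d) = []) := by
      intro hi
      rw [← List.head?_eq_none_iff, ← hπ.chase_eq hI q n _ (hact i hi) (height_le hI _),
        Sum.getLeft?_eq_none_iff]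
    refine if_congr ?_ rfl rfl
    constructor
    · rintro ⟨ρ, hρ, h⟩
      obtain ⟨hi, l, hl⟩ := hsplit q i ρ hρ (List.mem_of_getLast? h)
      have hn := restrict_nodup (I := I) hF.disjoint hρ q
      rw [hl] at h hn
      exact ⟨hi, (hnil hi.1).2 ((getLast_iff_nil hn).1 h)⟩
    · rintro ⟨hi, h⟩
      obtain ⟨ρ, hρ, hiρ⟩ := hex q i hi
      obtain ⟨-, l, hl⟩ := hsplit q i ρ hρ hiρ
      have hn := restrict_nodup (I := I) hF.disjoint hρ q
      refine ⟨ρ, hρ, ?_⟩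
      rw [hl] at hn ⊢
      exact (getLast_iff_nil hn).2 ((hnil hi.1).1 h)

end Routing

/-! ## The approximation guarantee -/

theorem numResources_eq {I : Instance n k p} {s : Fin p} {r : Fin k} (hs : I.startSet r = {s}) :
    I.numResources r = I.count r s := by
  simp [Instance.numResources, hs]

theorem mem_remaining {I : Instance n k p} {σ : Equiv.Perm (Fin k)} {i : Fin k} {d : Fin n} :
    d ∈ I.remaining σ i ↔ σ i ∈ I.req d ∧ ∀ j < i, σ j ∉ I.req d := by
  simp [Instance.remaining]

/-- A demand belongs to the first iteration whose type it requires. -/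
theorem exists_remaining {I : Instance n k p} (hI : I.Standing) (σ : Equiv.Perm (Fin k))
    (d : Fin n) : ∃ i, d ∈ I.remaining σ i := by
  classical
  obtain ⟨r, hr⟩ := hI.req_nonempty d
  obtain ⟨i, hi, hmin⟩ := Finset.exists_min_image (Finset.univ.filter fun i => σ i ∈ I.req d) id
    ⟨σ.symm r, by simpa using hr⟩
  refine ⟨i, mem_remaining.2 ⟨by simpa using hi, fun j hj hjd => ?_⟩⟩
  exact absurd (hmin j (by simpa using hjd)) (not_le.2 hj)

/-- The demands of a set without large antichains are the demands served by some routes. -/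
theorem exists_routes {I : Instance n k p} (hI : I.Standing) {s : Fin p} {r : Fin k}
    (hs : I.startSet r = {s}) {E Y : Finset (Fin n)} (hE : ∀ d ∈ E, r ∈ I.req d)
    (hYE : ∀ d ∈ Y, d ∈ E ∧ I.Reach s d)
    (hY : ∀ X ⊆ Y, (∀ d ∈ X, ∀ e ∈ X, ¬ I.Prec d e) → X.card ≤ I.count r s) :
    ∃ V, I.RoutesFeasible r E V ∧ I.routesValue V = ∑ d ∈ Y, I.reward d := by
  obtain ⟨π, hπ, hmov⟩ := exists_routing hI hYE hY
  refine ⟨_, hπ.routesFeasible hI hs hE, ?_⟩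
  rw [routesValue_eq_sum (hπ.routesFeasible hI hs hE).disjoint]
  congr 1
  ext d
  rw [List.mem_toFinset, hπ.served_iff hI, hmov]

/-- Travel costs of the competitor are dropped. The demands it meets are covered by the `k`
iterations, and each share has antichains no larger than the supply of its type, so some feasible
routes of that subproblem serve exactly this share. -/
theorem Instance.Feasible.objective_le {I : Instance n k p} (hI : I.Standing) {s : Fin p}
    (hs : ∀ r, I.startSet r = {s}) (hC : I.SmallCosts) {z : Solution n k p} (hz : I.Feasible z)
    {σ : Equiv.Perm (Fin k)} {W : Fin k → List (Route n p)} {v : ℤ}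
    (hW : ∀ i, I.RoutesOptimal (σ i) (I.remaining σ i) (W i)) (hv : ∀ i, I.routesValue (W i) ≤ v) :
    I.objective z ≤ k * v := by
  classical
  set Y : Finset (Fin n) := Finset.univ.filter fun d => z.y d = 1 with hYdef
  have hpart : ∀ i, ∑ d ∈ Y ∩ I.remaining σ i, I.reward d ≤ v := by
    intro i
    have hflow : ∀ d ∈ Y ∩ I.remaining σ i, 1 ≤ inflow z (σ i) d := by
      intro d hd
      rw [Finset.mem_inter] at hd
      have h1 := hz.service d (σ i) (mem_remaining.1 hd.2).1
      rwa [(Finset.mem_filter.1 hd.1).2] at h1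
    obtain ⟨V, hV, hval⟩ := exists_routes hI (hs (σ i)) (E := I.remaining σ i)
      (Y := Y ∩ I.remaining σ i) (fun d hd => (mem_remaining.1 hd).1)
      (fun d hd => ⟨(Finset.mem_inter.1 hd).2, hz.reach hI (hs _) (hflow d hd)⟩)
      (fun X hX hanti => hz.card_antichain_le hI (hs _) hanti fun d hd => hflow d (hX hd))
    rw [← hval]
    exact ((hW i).2 V hV).trans (hv i)
  have h1 : ∑ d, z.y d * I.reward d = ∑ d ∈ Y, I.reward d := by
    rw [hYdef, Finset.sum_filter]
    refine Finset.sum_congr rfl fun d _ => ?_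
    rcases hz.y_binary d with h | h <;> simp [h]
  -- The shares only need to cover `Y`, because rewards are nonnegative.
  have h2 : ∑ d ∈ Y, I.reward d ≤ ∑ i, ∑ d ∈ Y ∩ I.remaining σ i, I.reward d := by
    simp only [← Finset.filter_mem_eq_inter, Finset.sum_filter]
    rw [Finset.sum_comm]
    refine Finset.sum_le_sum fun d _ => ?_
    obtain ⟨i, hi⟩ := exists_remaining hI σ d
    have hnn := hC.reward_nonneg hI.types_pos d
    have := Finset.single_le_sum (f := fun i => if d ∈ I.remaining σ i then I.reward d else 0)
      (fun j _ => by split_ifs <;> simp [hnn]) (Finset.mem_univ i)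
    simpa [hi] using this
  have h3 : ∑ i, ∑ d ∈ Y ∩ I.remaining σ i, I.reward d ≤ k * v := by
    have := Finset.sum_le_sum fun i (_ : i ∈ (Finset.univ : Finset (Fin k))) => hpart i
    simpa using this
  have h4 : 0 ≤ ∑ r, (∑ s, ∑ d, z.xs r s d * (I.cost (Sum.inl s) d : ℤ) +
      ∑ i, ∑ j, z.x r i j * (I.cost (Sum.inr i) j : ℤ)) :=
    Finset.sum_nonneg fun r _ => add_nonneg
      (Finset.sum_nonneg fun s _ => Finset.sum_nonneg fun d _ =>
        mul_nonneg (hz.xs_nonneg r s d) (by positivity))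
      (Finset.sum_nonneg fun s _ => Finset.sum_nonneg fun d _ =>
        mul_nonneg (hz.x_nonneg r s d) (by positivity))
  unfold Instance.objective
  linarith

theorem Instance.AlgorithmA.guarantee {I : Instance n k p} (hI : I.Standing) (hS : I.SameStart)
    (hC : I.SmallCosts) {z : Solution n k p} (hz : I.AlgorithmA z) :
    I.Feasible z ∧ ∀ z', I.Feasible z' →
      1 / (2 * (k : ℚ)) * (I.objective z' : ℚ) ≤ I.objective z := by
  obtain ⟨s, hs⟩ := hS
  obtain ⟨σ, W, b, hσ, hW, hb, -, rfl⟩ := hz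
  constructor
  · refine follow_feasible hI hs (hW b).1 ?_
    intro q d hd hq
    -- A demand that requires a type processed before iteration `b` has been removed by then.
    have hle : b ≤ σ.symm q := by
      by_contra hlt
      exact (mem_remaining.1 hd).2 _ (not_le.1 hlt) (by simpa using hq)
    have := hσ hle
    simpa [numResources_eq (hs _)] using this
  · intro z' hz'
    have h1 := hz'.objective_le hI hs hC hW hb
    have h2 := follow_objective hI.types_pos hC (hW b).1.disjoint
    have hk : (0 : ℚ) < 2 * k := by
      have := hI.types_pos
      positivity
    rw [one_div, inv_mul_eq_div, div_le_iff₀ hk]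
    have h3 : I.objective z' ≤ I.objective (I.follow (W b)) * (2 * k) := by
      have : (k : ℤ) * I.routesValue (W b) ≤ k * (2 * I.objective (I.follow (W b))) :=
        mul_le_mul_of_nonneg_left h2 (by positivity)
      linarith
    exact_mod_cast h3

/-! ## One-type problems as assignment problems -/

open Classical in
/-- The cost of `x` being the successor of `y`: the lost reward if `x = y`, and `M` for pairs that
are not allowed. -/
noncomputable def Instance.entry (I : Instance n k p) (s : Fin p) (E : Finset (Fin n)) (c : ℕ)
    (M : ℤ) : Fin n ⊕ Fin n → Fin n ⊕ Fin n → ℤ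
  | Sum.inr _, _ => 0
  | Sum.inl e, Sum.inl d =>
      if d = e then I.reward e else if (e ∈ E ∧ I.Reach s e) ∧ I.Prec d e then 0 else M
  | Sum.inl e, Sum.inr a => if (e ∈ E ∧ I.Reach s e) ∧ (a : ℕ) < c then 0 else M

section Assignment

variable {I : Instance n k p} {s : Fin p} {E : Finset (Fin n)} {c : ℕ} {M : ℤ}
  {π : Equiv.Perm (Fin n ⊕ Fin n)}

theorem entry_nonneg (hw : ∀ d, 0 ≤ I.reward d) (hM : 0 ≤ M) (x y : Fin n ⊕ Fin n) :
    0 ≤ I.entry s E c M x y := by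
  rcases x with e | b <;> rcases y with d | a <;> simp only [Instance.entry] <;>
    (try split_ifs) <;> simp [hw, hM]

-- A routing uses no forbidden pair, so only its fixed demands contribute, each with its lost
-- reward.
open Classical in
theorem Instance.Routing.sum_entry (hπ : I.Routing s E c π) :
    ∑ x, I.entry s E c M (π x) x =
      ∑ d, I.reward d - ∑ d with π (Sum.inl d) ≠ Sum.inl d, I.reward d := by
  have hmov : ∀ x d, π x = Sum.inl d → x ≠ Sum.inl d → d ∈ E ∧ I.Reach s d := by
    intro x d h hne
    apply hπ.moved
    intro h'
    exact hne (π.injective (h.trans h'.symm))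
  have h1 : ∀ d, I.entry s E c M (π (Sum.inl d)) (Sum.inl d) =
      if π (Sum.inl d) = Sum.inl d then I.reward d else 0 := by
    intro d
    split_ifs with h
    · simp [h, Instance.entry]
    · rcases h' : π (Sum.inl d) with e | a
      · have hne : d ≠ e := by
          rintro rfl
          exact h h'
        simp [Instance.entry, hne, hmov _ _ h' (by simpa using hne), hπ.step d e h' hne]
      · rfl
  have h2 : ∀ a, I.entry s E c M (π (Sum.inr a)) (Sum.inr a) = 0 := by
    intro a
    rcases h' : π (Sum.inr a) with e | b
    · simp [Instance.entry, hmov _ _ h' (by simp), hπ.start a e h']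
    · rfl
  rw [Fintype.sum_sum_type]
  simp only [h1, h2, Finset.sum_const_zero, add_zero]
  rw [eq_sub_iff_add_eq, ← Finset.sum_filter]
  exact Finset.sum_filter_add_sum_filter_not _ _ _

theorem routing_one : I.Routing s E c 1 :=
  ⟨fun d e h hne => absurd (Sum.inl.inj h) hne, fun a e h => by simp at h, fun d h => absurd rfl h⟩

/-- An optimal assignment is a routing. -/
theorem routing_of_optimal (hw : ∀ d, 0 ≤ I.reward d) (hM : ∑ d, I.reward d < M)
    (hopt : ∀ ρ : Equiv.Perm (Fin n ⊕ Fin n),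
      ∑ x, I.entry s E c M (π x) x ≤ ∑ x, I.entry s E c M (ρ x) x) : I.Routing s E c π := by
  classical
  have hS : 0 ≤ ∑ d, I.reward d := Finset.sum_nonneg fun d _ => hw d
  -- The identity costs the total reward, which is less than `M`; as entries are nonnegative, an
  -- optimum cannot afford a single forbidden pair.
  have h0 : ∀ x, I.entry s E c M (π x) x ≠ M := by
    intro x hx
    have h1 := hopt 1
    rw [routing_one.sum_entry] at h1
    have h2 := Finset.single_le_sum (f := fun x => I.entry s E c M (π x) x)
      (fun x _ => entry_nonneg hw (by omega) _ _) (Finset.mem_univ x)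
    simp at h1 h2
    omega
  refine ⟨?_, ?_, ?_⟩
  · intro d e h hne
    have := h0 (Sum.inl d)
    rw [h, Instance.entry, if_neg hne] at this
    by_contra hp
    rw [if_neg (fun h => hp h.2)] at this
    exact this rfl
  · intro a e h
    have := h0 (Sum.inr a)
    rw [h, Instance.entry] at this
    by_contra hp
    rw [if_neg (fun h => hp h.2)] at this
    exact this rfl
  · intro d hd
    obtain ⟨x, hx⟩ := π.surjective (Sum.inl d)
    have := h0 x
    rw [hx] at this
    by_contra hp
    rcases x with e | a
    · have hne : e ≠ d := by
        rintro rfl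
        exact hd hx
      rw [Instance.entry, if_neg hne, if_neg (fun h => hp h.1)] at this
      exact this rfl
    · rw [Instance.entry, if_neg (fun h => hp h.1)] at this
      exact this rfl

theorem routesValue_routesOf (hI : I.Standing) {r : Fin k} (hs : I.startSet r = {s})
    (hE : ∀ d ∈ E, r ∈ I.req d) (hπ : I.Routing s E (I.count r s) π) :
    I.routesValue (routesOf s π) =
      ∑ d, I.reward d - ∑ x, I.entry s E (I.count r s) M (π x) x := by
  classical
  rw [hπ.sum_entry, routesValue_eq_sum (hπ.routesFeasible hI hs hE).disjoint, sub_sub_cancel]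
  congr 1
  ext d
  rw [List.mem_toFinset, hπ.served_iff hI]
  simp

/-- The routes of an optimal assignment are optimal. -/
theorem routesOptimal_of_optimal (hI : I.Standing) (hw : ∀ d, 0 ≤ I.reward d) {r : Fin k}
    (hs : I.startSet r = {s}) (hE : ∀ d ∈ E, r ∈ I.req d) (hM : ∑ d, I.reward d < M)
    (hopt : ∀ ρ : Equiv.Perm (Fin n ⊕ Fin n), ∑ x, I.entry s E (I.count r s) M (π x) x ≤
      ∑ x, I.entry s E (I.count r s) M (ρ x) x) :
    I.RoutesOptimal r E (routesOf s π) := by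
  classical
  have hπ := routing_of_optimal hw hM hopt
  refine ⟨hπ.routesFeasible hI hs hE, fun V hV => ?_⟩
  have hstart : ∀ ρ ∈ V, ρ.1 = s := by
    intro ρ hρ
    obtain ⟨d, -, h⟩ := hV.first ρ hρ
    simpa [hs] using h.2.1
  have hmem : ∀ d ∈ (served V).toFinset, ∃ ρ ∈ V, ρ.1 = s ∧ d ∈ ρ.2 := by
    intro d hd
    obtain ⟨ρ, hρ, h⟩ := mem_served.1 (List.mem_toFinset.1 hd)
    exact ⟨ρ, hρ, hstart ρ hρ, h⟩
  -- The competing routes `V` yield a routing that serves the same demands, since an antichain meets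
  -- each of their chains at most once. The assignment optimum can then be compared with it.
  obtain ⟨ρ, hρ, hmov⟩ := exists_routing hI (s := s) (E := E) (c := I.count r s)
    (Y := (served V).toFinset)
    (by
      intro d hd
      obtain ⟨ρ, hρ, h, hdρ⟩ := hmem d hd
      exact ⟨hV.stops_mem d (List.mem_toFinset.1 hd), h ▸ (hV.reach hI hρ hdρ).1⟩)
    (by
      intro X hX hanti
      refine (card_le_of_routes s X (fun d hd => hmem d (hX hd)) ?_).trans (hV.supply s)
      intro d hd e he ρ hρ hdρ heρ
      by_contra hne
      have hsym : Std.Symm fun d e => I.Prec d e ∨ I.Prec e d := ⟨fun _ _ h => h.symm⟩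
      have hpw : ρ.2.Pairwise fun d e => I.Prec d e ∨ I.Prec e d :=
        (route_pairwise hI (hV.chain ρ hρ)).imp Or.inl
      rcases hpw.forall hdρ heρ hne with h | h
      · exact hanti d hd e he h
      · exact hanti e he d hd h)
  have h1 := hopt ρ
  rw [hρ.sum_entry] at h1
  rw [routesValue_routesOf (M := M) hI hs hE hπ, routesValue_eq_sum hV.disjoint]
  have h2 : (Finset.univ.filter fun d => ρ (Sum.inl d) ≠ Sum.inl d) = (served V).toFinset := by
    ext d
    rw [← hmov d]
    simp
  rw [h2] at h1
  linarith

end Assignment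

/-! ## Reasoning about programs -/

/-- The memory after a run of a program. -/
def exec (c : Prog) (s : Store) : Store := (c.run s).1

/-- The arrays that a program may change. -/
def Prog.writes : Prog → List ℕ
  | skip => []
  | assign a _ _ _ _ => [a]
  | seq c₁ c₂ => c₁.writes ++ c₂.writes
  | ifLe _ _ c₁ c₂ => c₁.writes ++ c₂.writes
  | loop _ c => c.writes

/-- Sums of entries of array `0` with constant indices and constants up to `1`. -/
def Expr.isDim : Expr → Bool
  | const c => decide (c ≤ 1)
  | read a (const _) (const _) (const _) => decide (a = 0)
  | add e₁ e₂ => e₁.isDim && e₂.isDim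
  | _ => false

/-- All loop lengths are sums of entries of array `0` and constants up to `1`. -/
def Prog.loopsDim : Prog → Bool
  | skip => true
  | assign _ _ _ _ _ => true
  | seq c₁ c₂ => c₁.loopsDim && c₂.loopsDim
  | ifLe _ _ c₁ c₂ => c₁.loopsDim && c₂.loopsDim
  | loop e c => e.isDim && c.loopsDim

open Polynomial in
/-- A bound on the number of steps, in terms of a bound on the entries of array `0`. -/
noncomputable def Prog.timeBound : Prog → ℕ[X]
  | skip => 1
  | assign _ e₁ e₂ e₃ e => C (e₁.steps + e₂.steps + e₃.steps + e.steps + 1)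
  | seq c₁ c₂ => c₁.timeBound + c₂.timeBound + 1
  | ifLe e₁ e₂ c₁ c₂ => C (e₁.steps + e₂.steps) + c₁.timeBound + c₂.timeBound + 1
  | loop e c => C (e.steps + 1) + C e.steps * (X + 1) * (c.timeBound + 1)

/-! ### Semantics of programs, unchanged arrays and step counts. -/

theorem Store.set_apply (s : Store) (a i j l : ℕ) (v : ℤ) (a' i' j' l' : ℕ) :
    s.set a i j l v a' i' j' l' = if a' = a ∧ i' = i ∧ j' = j ∧ l' = l then v else s a' i' j' l' :=
  (rfl)

theorem Store.set_ne (s : Store) {a a' : ℕ} (i j l : ℕ) (v : ℤ) (h : a' ≠ a) :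
    s.set a i j l v a' = s a' := by
  funext i' j' l'
  simp [Store.set, h]

theorem exec_loop (e : Expr) (c : Prog) (s : Store) :
    exec (Prog.loop e c) s = (exec c)^[(e.eval s).toNat] s := by
  have h : ∀ m t, ((fun t : Store × ℕ => ((c.run t.1).1, t.2 + (c.run t.1).2 + 1))^[m] t).1 =
      (exec c)^[m] t.1 := by
    intro m
    induction m with
    | zero => intro t; rfl
    | succ m ih =>
      intro t
      rw [Function.iterate_succ_apply, ih, Function.iterate_succ_apply]
      rfl
  exact h _ _

theorem exec_skip (s : Store) : exec Prog.skip s = s := rfl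

theorem exec_seq (c₁ c₂ : Prog) (s : Store) : exec (Prog.seq c₁ c₂) s = exec c₂ (exec c₁ s) := rfl

theorem exec_ifLe (e₁ e₂ : Expr) (c₁ c₂ : Prog) (s : Store) :
    exec (Prog.ifLe e₁ e₂ c₁ c₂) s = if e₁.eval s ≤ e₂.eval s then exec c₁ s else exec c₂ s := by
  simp only [exec, Prog.run]
  split_ifs <;> rfl

theorem exec_assign (a : ℕ) (e₁ e₂ e₃ e : Expr) (s : Store) :
    exec (Prog.assign a e₁ e₂ e₃ e) s =
      s.set a (e₁.eval s).toNat (e₂.eval s).toNat (e₃.eval s).toNat (e.eval s) := rfl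

/-- A program leaves the other arrays unchanged. -/
theorem exec_frame {a : ℕ} {c : Prog} (h : a ∉ c.writes) (s : Store) : exec c s a = s a := by
  induction c generalizing s with
  | skip => rfl
  | assign b e₁ e₂ e₃ e =>
    rw [exec_assign, Store.set_ne]
    simpa [Prog.writes] using h
  | seq c₁ c₂ ih₁ ih₂ =>
    simp only [Prog.writes, List.mem_append, not_or] at h
    rw [exec_seq, ih₂ h.2, ih₁ h.1]
  | ifLe e₁ e₂ c₁ c₂ ih₁ ih₂ =>
    simp only [Prog.writes, List.mem_append, not_or] at h
    rw [exec_ifLe]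
    split_ifs
    · exact ih₁ h.1 s
    · exact ih₂ h.2 s
  | loop e c ih =>
    rw [exec_loop]
    induction (e.eval s).toNat with
    | zero => rfl
    | succ m ihm => rw [Function.iterate_succ_apply', ih h, ihm]

/-- Each summand is at most `x + 1`, and there are at most `steps` summands. -/
theorem Expr.eval_le_of_isDim {s : Store} {x : ℕ} (hs : ∀ i j l, s 0 i j l ≤ x) (e : Expr)
    (he : e.isDim = true) : e.eval s ≤ (e.steps * (x + 1) : ℕ) := by
  fun_induction Expr.isDim e with
  | case1 c =>
    simp only [decide_eq_true_eq] at he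
    simp only [Expr.eval, Expr.steps]
    omega
  | case2 a c₁ c₂ c₃ =>
    simp only [decide_eq_true_eq] at he
    subst he
    simp only [Expr.eval, Expr.steps]
    have := hs c₁.toNat c₂.toNat c₃.toNat
    push_cast
    omega
  | case3 e₁ e₂ ih₁ ih₂ =>
    simp only [Bool.and_eq_true] at he
    have h₁ := ih₁ he.1
    have h₂ := ih₂ he.2
    simp only [Expr.eval, Expr.steps]
    push_cast at h₁ h₂ ⊢
    nlinarith
  | case4 => simp at he

/-- Programs whose loop lengths are bounded by the dimensions run in polynomial time. -/
theorem Prog.steps_le (c : Prog) (hc : c.loopsDim = true) (h0 : 0 ∉ c.writes) {x : ℕ} (s : Store)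
    (hs : ∀ i j l, s 0 i j l ≤ x) : (c.run s).2 ≤ c.timeBound.eval x := by
  induction c generalizing s with
  | skip => simp [Prog.run, Prog.timeBound]
  | assign b e₁ e₂ e₃ e => simp [Prog.run, Prog.timeBound]
  | seq c₁ c₂ ih₁ ih₂ =>
    simp only [Prog.writes, List.mem_append, not_or] at h0
    simp only [Prog.loopsDim, Bool.and_eq_true] at hc
    have h₁ := ih₁ hc.1 h0.1 s hs
    have h₂ := ih₂ hc.2 h0.2 (c₁.run s).1 (by
      intro i j l
      have := exec_frame h0.1 s
      rw [exec] at this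
      rw [this]
      exact hs i j l)
    simp only [Prog.run, Prog.timeBound, Polynomial.eval_add, Polynomial.eval_one]
    omega
  | ifLe e₁ e₂ c₁ c₂ ih₁ ih₂ =>
    simp only [Prog.writes, List.mem_append, not_or] at h0
    simp only [Prog.loopsDim, Bool.and_eq_true] at hc
    have h₁ := ih₁ hc.1 h0.1 s hs
    have h₂ := ih₂ hc.2 h0.2 s hs
    simp only [Prog.run, Prog.timeBound, Polynomial.eval_add, Polynomial.eval_one,
      Polynomial.eval_C]
    split_ifs <;> simp only <;> omega
  | loop e c ih =>
    simp only [Prog.loopsDim, Bool.and_eq_true] at hc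
    -- Array `0` is carried along as unchanged, so that the bound for the body applies in every
    -- iteration.
    have h : ∀ m b, ((fun t : Store × ℕ => ((c.run t.1).1, t.2 + (c.run t.1).2 + 1))^[m] (s, b)).2 ≤
        b + m * (c.timeBound.eval x + 1) ∧
        ((fun t : Store × ℕ => ((c.run t.1).1, t.2 + (c.run t.1).2 + 1))^[m] (s, b)).1 0 = s 0 := by
      intro m b
      induction m with
      | zero => simp
      | succ m ihm =>
        rw [Function.iterate_succ_apply']
        have h1 := ih hc.2 h0
          ((fun t : Store × ℕ => ((c.run t.1).1, t.2 + (c.run t.1).2 + 1))^[m] (s, b)).1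
          (by rw [ihm.2]; exact hs)
        refine ⟨?_, ?_⟩
        · simp only
          rw [add_mul]
          have := ihm.1
          omega
        · have := exec_frame (c := c) h0
            ((fun t : Store × ℕ => ((c.run t.1).1, t.2 + (c.run t.1).2 + 1))^[m] (s, b)).1
          rw [exec, ihm.2] at this
          exact this
    have h1 := (h (e.eval s).toNat (e.steps + 1)).1
    have h2 : (e.eval s).toNat ≤ e.steps * (x + 1) := by
      have := e.eval_le_of_isDim hs hc.1
      omega
    simp only [Prog.run, Prog.timeBound, Polynomial.eval_add, Polynomial.eval_mul,
      Polynomial.eval_one, Polynomial.eval_C, Polynomial.eval_X]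
    exact h1.trans (Nat.add_le_add_left (Nat.mul_le_mul_right _ h2) _)

/-! ## Abbreviations -/

/-- A scalar variable. -/
def Expr.var (a : ℕ) : Expr := .read a (.const 0) (.const 0) (.const 0)
/-- An entry of a vector. -/
def Expr.vec (a : ℕ) (e : Expr) : Expr := .read a e (.const 0) (.const 0)
/-- An entry of a matrix. -/
def Expr.mat (a : ℕ) (e₁ e₂ : Expr) : Expr := .read a e₁ e₂ (.const 0)
/-- Assignment to a scalar variable. -/
def Prog.setVar (a : ℕ) (e : Expr) : Prog := .assign a (.const 0) (.const 0) (.const 0) e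
/-- Assignment to an entry of a vector. -/
def Prog.setVec (a : ℕ) (e₁ e : Expr) : Prog := .assign a e₁ (.const 0) (.const 0) e
/-- Assignment to an entry of a matrix. -/
def Prog.setMat (a : ℕ) (e₁ e₂ e : Expr) : Prog := .assign a e₁ e₂ (.const 0) e
/-- Case distinction on equality. -/
def Prog.ifEq (e₁ e₂ : Expr) (c₁ c₂ : Prog) : Prog := .ifLe e₁ e₂ (.ifLe e₂ e₁ c₁ c₂) c₂
/-- Case distinction on strict inequality. -/
def Prog.ifLt (e₁ e₂ : Expr) (c₁ c₂ : Prog) : Prog := .ifLe e₂ e₁ c₂ c₁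
/-- Run `c` for the values `0, 1, …, e - 1` of the variable `i`. -/
def Prog.forTo (i : ℕ) (e : Expr) (c : Prog) : Prog :=
  .seq (.setVar i (.const 0)) (.loop e (.seq c (.setVar i (.add (.var i) (.const 1)))))

theorem eval_const (s : Store) (c : ℤ) : (Expr.const c).eval s = c := (rfl)

theorem eval_add (s : Store) (e₁ e₂ : Expr) :
    (Expr.add e₁ e₂).eval s = e₁.eval s + e₂.eval s := (rfl)

theorem eval_sub (s : Store) (e₁ e₂ : Expr) :
    (Expr.sub e₁ e₂).eval s = e₁.eval s - e₂.eval s := (rfl)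

theorem eval_var (s : Store) (a : ℕ) : (Expr.var a).eval s = s a 0 0 0 := (rfl)

theorem eval_vec (s : Store) (a : ℕ) (e : Expr) :
    (Expr.vec a e).eval s = s a (e.eval s).toNat 0 0 := (rfl)

theorem eval_mat (s : Store) (a : ℕ) (e₁ e₂ : Expr) :
    (Expr.mat a e₁ e₂).eval s = s a (e₁.eval s).toNat (e₂.eval s).toNat 0 := (rfl)

theorem exec_setVar (a : ℕ) (e : Expr) (s : Store) :
    exec (Prog.setVar a e) s = s.set a 0 0 0 (e.eval s) := rfl

theorem exec_setVec (a : ℕ) (e₁ e : Expr) (s : Store) :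
    exec (Prog.setVec a e₁ e) s = s.set a (e₁.eval s).toNat 0 0 (e.eval s) := rfl

theorem exec_setMat (a : ℕ) (e₁ e₂ e : Expr) (s : Store) :
    exec (Prog.setMat a e₁ e₂ e) s =
      s.set a (e₁.eval s).toNat (e₂.eval s).toNat 0 (e.eval s) := rfl

theorem exec_ifEq (e₁ e₂ : Expr) (c₁ c₂ : Prog) (s : Store) :
    exec (Prog.ifEq e₁ e₂ c₁ c₂) s = if e₁.eval s = e₂.eval s then exec c₁ s else exec c₂ s := by
  simp only [Prog.ifEq, exec_ifLe]
  split_ifs <;> first | rfl | omega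

theorem exec_ifLt (e₁ e₂ : Expr) (c₁ c₂ : Prog) (s : Store) :
    exec (Prog.ifLt e₁ e₂ c₁ c₂) s = if e₁.eval s < e₂.eval s then exec c₁ s else exec c₂ s := by
  simp only [Prog.ifLt, exec_ifLe]
  split_ifs <;> first | rfl | omega

/-- The rule for loops with an invariant. -/
theorem exec_forTo {i : ℕ} {e : Expr} {c : Prog} {s : Store} {m : ℕ} (J : ℕ → Store → Prop)
    (hi : i ∉ c.writes) (he : e.eval (s.set i 0 0 0 0) = m) (h0 : J 0 (s.set i 0 0 0 0))
    (hs : ∀ (j : ℕ) (t : Store), j < m → (∀ a, a ≠ i → a ∉ c.writes → t a = s a) →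
      t i 0 0 0 = j → J j t → J (j + 1) ((exec c t).set i 0 0 0 ((j + 1 : ℕ) : ℤ))) :
    J m (exec (Prog.forTo i e c) s) := by
  have key : ∀ j : ℕ, j ≤ m → ∀ t : Store,
      t = (exec (.seq c (.setVar i (.add (.var i) (.const 1)))))^[j] (s.set i 0 0 0 0) →
      J j t ∧ t i 0 0 0 = j ∧ ∀ a, a ≠ i → a ∉ c.writes → t a = s a := by
    intro j
    induction j with
    | zero =>
      rintro - t rfl
      exact ⟨h0, by simp [Store.set_apply], fun a ha _ => Store.set_ne _ _ _ _ _ ha⟩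
    | succ j ih =>
      rintro hj t rfl
      rw [Function.iterate_succ_apply']
      obtain ⟨h1, h2, h3⟩ := ih (by omega) _ rfl
      set t := (exec (.seq c (.setVar i (.add (.var i) (.const 1)))))^[j] (s.set i 0 0 0 0)
      have h4 : exec (.seq c (.setVar i (.add (.var i) (.const 1)))) t =
          (exec c t).set i 0 0 0 ((j + 1 : ℕ) : ℤ) := by
        rw [exec_seq, exec_setVar, eval_add, eval_var, eval_const, exec_frame hi, h2]
        rfl
      rw [h4]
      refine ⟨hs j t (by omega) h3 h2 h1, by simp [Store.set_apply], fun a ha hc => ?_⟩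
      rw [Store.set_ne _ _ _ _ _ ha, exec_frame hc, h3 a ha hc]
  have h1 : exec (Prog.forTo i e c) s =
      (exec (.seq c (.setVar i (.add (.var i) (.const 1)))))^[m] (s.set i 0 0 0 0) := by
    rw [Prog.forTo, exec_seq, exec_setVar, exec_loop, eval_const, he, Int.toNat_natCast]
  exact (key m le_rfl _ h1).1

/-! ## The Hungarian method -/

/-- A partial assignment of the rows `0, …, m - 1` to columns, where `P c` is the row of the column
`c`, or `-1`, with dual variables `u` and `v`. -/
structure Matched (N m : ℕ) (a : ℕ → ℕ → ℤ) (u v P : ℕ → ℤ) : Prop where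
  feas : ∀ i < N, ∀ j < N, u i + v j ≤ a i j
  range : ∀ c < N, P c = -1 ∨ ∃ i < m, P c = (i : ℕ)
  inj : ∀ c < N, ∀ d < N, ∀ i : ℕ, P c = i → P d = i → c = d
  surj : ∀ i < m, ∃ c < N, P c = (i : ℕ)
  tight : ∀ c < N, ∀ i : ℕ, P c = i → u i + v c = a i c

/-- A tree of tight edges, rooted at the virtual column `N` of the row `m`. The columns of the tree
are those with `0 < used c`, numbered in the order of their discovery, and `way` is the parent
column. -/
structure Tree (N m : ℕ) (a : ℕ → ℕ → ℤ) (u v P used way : ℕ → ℤ) (g : ℕ) : Prop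
    extends Matched N m a u v P where
  root : P N = m
  used_root : used N = 1
  used_le : ∀ c ≤ N, used c ≤ g + 1
  tree : ∀ c < N, 0 < used c → ∃ d ≤ N, way c = (d : ℕ) ∧ 0 < used d ∧ used d < used c ∧
    ∃ i : ℕ, P d = i ∧ u i + v c = a i c

/-- An assignment of the rows `0, …, m` to the columns other than `h`. -/
structure Hole (N m : ℕ) (a : ℕ → ℕ → ℤ) (u v P used way : ℕ → ℤ) (h : ℕ) : Prop where
  feas : ∀ i < N, ∀ j < N, u i + v j ≤ a i j
  le : h ≤ N
  used_hole : 0 < used h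
  used_root : used N = 1
  range : ∀ c ≤ N, c ≠ h → P c = -1 ∨ ∃ i < m + 1, P c = (i : ℕ)
  inj : ∀ c ≤ N, ∀ d ≤ N, c ≠ h → d ≠ h → ∀ i : ℕ, P c = i → P d = i → c = d
  surj : ∀ i < m + 1, ∃ c ≤ N, c ≠ h ∧ P c = (i : ℕ)
  tight : ∀ c < N, c ≠ h → ∀ i : ℕ, P c = i → u i + v c = a i c
  tree : ∀ c < N, 0 < used c → used c ≤ used h → ∃ d ≤ N, way c = (d : ℕ) ∧ 0 < used d ∧
    used d < used c ∧ ∃ i : ℕ, P d = i ∧ u i + v c = a i c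

/-! ### Invariants of the Hungarian method, independent of any program. -/

section Hungarian

variable {N m g : ℕ} {a : ℕ → ℕ → ℤ} {u v P used way u' v' P' used' way' : ℕ → ℤ}

/-- The columns below `N` hold rows below `m` or `-1`, so the row `m` of the root does not collide
with them. -/
theorem Tree.inj_root (T : Tree N m a u v P used way g) {c d i : ℕ} (hc : c ≤ N) (hd : d ≤ N)
    (h : P c = i) (h' : P d = i) : c = d := by
  have hroot := T.root
  have key : ∀ e < N, P e ≠ (m : ℕ) := by
    intro e he hem
    rcases T.range e he with h | ⟨i, hi, h⟩ <;> omega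
  rcases hc.lt_or_eq with hc | rfl <;> rcases hd.lt_or_eq with hd | rfl
  · exact T.inj c hc d hd i h h'
  · exact absurd (by omega) (key c hc)
  · exact absurd (by omega) (key d hd)
  · rfl

theorem Tree.init (M : Matched N m a u v P) (hP : ∀ c < N, P' c = P c) (hroot : P' N = m)
    (hused : ∀ c < N, used c = 0) (hN : used N = 1) : Tree N m a u v P' used way 0 where
  feas := M.feas
  range c hc := by rw [hP c hc]; exact M.range c hc
  inj c hc d hd := by rw [hP c hc, hP d hd]; exact M.inj c hc d hd
  surj i hi := by
    obtain ⟨c, hc, h⟩ := M.surj i hi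
    exact ⟨c, hc, by rw [hP c hc, h]⟩
  tight c hc := by rw [hP c hc]; exact M.tight c hc
  root := hroot
  used_root := hN
  used_le c hc := by
    rcases hc.lt_or_eq with hc | rfl
    · rw [hused c hc]; simp
    · rw [hN]; simp
  tree c hc h := by rw [hused c hc] at h; omega

/-- The tree grows by the tight edge that a change of the dual variables makes available. -/
theorem Tree.grow (T : Tree N m a u v P used way g)
    {cf ct i₀ : ℕ} {δ : ℤ} (hcf : cf ≤ N) (hcfu : 0 < used cf) (hct : ct < N) (hctu : used ct ≤ 0)
    (hi₀ : P cf = i₀) (hδ : δ = a i₀ ct - u i₀ - v ct)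
    (hmin : ∀ c ≤ N, 0 < used c → ∀ i : ℕ, P c = i → ∀ d < N, used d ≤ 0 → δ ≤ a i d - u i - v d)
    (hu₁ : ∀ c ≤ N, 0 < used c → ∀ i : ℕ, P c = i → u' i = u i + δ)
    (hu₂ : ∀ i : ℕ, (∀ c ≤ N, 0 < used c → P c ≠ i) → u' i = u i)
    (hv : ∀ c < N, v' c = if 0 < used c then v c - δ else v c)
    (hused : ∀ c, used' c = if c = ct then (g : ℤ) + 2 else used c)
    (hway : ∀ c, way' c = if c = ct then (cf : ℤ) else way c) (hδ₀ : 0 ≤ δ) :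
    Tree N m a u' v' P used' way' (g + 1) where
  feas i hi j hj := by
    have h0 := T.feas i hi j hj
    rw [hv j hj]
    -- Tree rows gain `δ` and tree columns lose it. Slack shrinks only on edges from a tree row to a
    -- column outside the tree, where it is at least `δ`.
    by_cases h : ∃ c ≤ N, 0 < used c ∧ P c = i
    · obtain ⟨c, hc, hcu, hci⟩ := h
      rw [hu₁ c hc hcu i hci]
      split_ifs with hj'
      · omega
      · have := hmin c hc hcu i hci j hj (by omega)
        omega
    · rw [hu₂ i fun c hc hcu hci => h ⟨c, hc, hcu, hci⟩]
      split_ifs <;> omega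
  range := T.range
  inj := T.inj
  surj := T.surj
  tight c hc i hi := by
    have h0 := T.tight c hc i hi
    rw [hv c hc]
    -- A matched column lies in the tree exactly if its row belongs to the tree, so the changes
    -- cancel on matched edges.
    split_ifs with h
    · rw [hu₁ c hc.le h i hi]
      omega
    · rw [hu₂ i ?_]
      · omega
      · intro d hd hdu hdi
        obtain rfl := T.inj_root hc.le hd hi hdi
        exact h hdu
  root := T.root
  used_root := by
    rw [hused, if_neg (by omega)]
    exact T.used_root
  used_le c hc := by
    have := T.used_le c hc
    rw [hused]
    split_ifs <;> push_cast <;> omega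
  tree c hc h := by
    by_cases h1 : c = ct
    · have h4 := T.used_le cf hcf
      refine ⟨cf, hcf, by rw [hway, if_pos h1], ?_, ?_, i₀, hi₀, ?_⟩
      · rw [hused, if_neg (by rintro rfl; omega)]
        exact hcfu
      -- The new number `g + 2` exceeds all earlier ones, which are at most `g + 1`.
      · rw [hused, hused, if_pos h1, if_neg (by rintro rfl; omega)]
        omega
      · rw [hu₁ cf hcf hcfu i₀ hi₀, hv c hc, h1, if_neg (by omega)]
        omega
    · rw [hused, if_neg h1] at h
      obtain ⟨d, hd, h5, h6, h7, i, h8, h9⟩ := T.tree c hc h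
      have hdct : d ≠ ct := by rintro rfl; omega
      refine ⟨d, hd, by rw [hway, if_neg h1, h5], ?_, ?_, i, h8, ?_⟩
      · rwa [hused, if_neg hdct]
      · rwa [hused, hused, if_neg hdct, if_neg h1]
      · rw [hu₁ d hd h6 i h8, hv c hc, if_pos h]
        omega

/-- A tree with all columns would have more columns than there are rows. -/
theorem Tree.exists_unused (T : Tree N m a u v P used way g) (hm : m < N)
    (hmat : ∀ c < N, 0 < used c → ∃ i : ℕ, P c = i) : ∃ d < N, used d ≤ 0 := by
  by_contra! hall
  have h1 : ∀ c < N, ∃ i < m, P c = (i : ℕ) := by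
    intro c hc
    obtain ⟨i, hi⟩ := hmat c hc (hall c hc)
    rcases T.range c hc with h | h
    · omega
    · exact h
  choose! f hf using h1
  have h2 : (Finset.range N).card ≤ (Finset.range m).card := by
    apply Finset.card_le_card_of_injOn f
    · intro c hc
      simp only [Finset.coe_range, Set.mem_Iio] at hc ⊢
      exact (hf c hc).1
    · intro c hc d hd h
      simp only [Finset.coe_range, Set.mem_Iio] at hc hd
      exact T.inj c hc d hd (f c) (hf c hc).2 (by rw [(hf d hd).2, h])
  simp at h2
  omega

/-- Once the root counts as a column that holds the row `m`, all rows up to `m` are assigned and the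
free column `h` is the hole. -/
theorem Tree.hole (T : Tree N m a u v P used way g) {h : ℕ} (hh : h < N) (hu : 0 < used h)
    (hP : P h = -1) : Hole N m a u v P used way h where
  feas := T.feas
  le := hh.le
  used_hole := hu
  used_root := T.used_root
  range c hc _ := by
    rcases hc.lt_or_eq with hc | rfl
    · rcases T.range c hc with h | ⟨i, hi, h⟩
      · exact Or.inl h
      · exact Or.inr ⟨i, by omega, h⟩
    · exact Or.inr ⟨m, by omega, T.root⟩
  inj c hc d hd _ _ i hi hi' := T.inj_root hc hd hi hi'
  surj i hi := by
    rcases (Nat.lt_succ_iff.1 hi).lt_or_eq with hi | rfl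
    · obtain ⟨c, hc, h⟩ := T.surj i hi
      exact ⟨c, hc.le, by rintro rfl; omega, h⟩
    · exact ⟨N, le_rfl, by omega, T.root⟩
  tight c hc _ := T.tight c hc
  tree c hc h _ := T.tree c hc h

/-- The row of the parent `d` moves to `h` along a tight tree edge, which frees `d`. Only the entry
at `h` changes, and `h` was discovered after `d`, so the part of the tree needed to continue from
`d` is intact. -/
theorem Hole.step {h : ℕ} (H : Hole N m a u v P used way h) (hN : h ≠ N) :
    ∃ d : ℕ, way h = d ∧ used d < used h ∧ 0 ≤ P d ∧ ∀ P' : ℕ → ℤ,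
      (∀ c, P' c = if c = h then P d else P c) → Hole N m a u v P' used way d := by
  have hlt : h < N := lt_of_le_of_ne H.le hN
  obtain ⟨d, hd, h1, h2, h3, i, h4, h5⟩ := H.tree h hlt H.used_hole le_rfl
  have hdh : d ≠ h := by rintro rfl; omega
  refine ⟨d, h1, h3, by omega, fun P' hP => ⟨H.feas, hd, h2, H.used_root, ?_, ?_, ?_, ?_, ?_⟩⟩
  · intro c hc hcd
    rw [hP]
    split_ifs with hch
    · exact H.range d hd hdh
    · exact H.range c hc hch
  · intro c hc e he hcd hed j hj hj'
    rw [hP] at hj hj'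
    split_ifs at hj hj' with h6 h7 h7
    · rw [h6, h7]
    · exact absurd (H.inj d hd e he hdh h7 j hj hj') (Ne.symm hed)
    · exact absurd (H.inj c hc d hd h6 hdh j hj hj') hcd
    · exact H.inj c hc e he h6 h7 j hj hj'
  · intro j hj
    obtain ⟨c, hc, hch, hcj⟩ := H.surj j hj
    by_cases hcd : c = d
    · subst hcd
      exact ⟨h, H.le, hdh.symm, by rw [hP, if_pos rfl, hcj]⟩
    · exact ⟨c, hc, hcd, by rw [hP, if_neg hch, hcj]⟩
  · intro c hc hcd j hj
    rw [hP] at hj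
    split_ifs at hj with hch
    · have : j = i := by omega
      rw [hch, this]
      exact h5
    · exact H.tight c hc hch j hj
  · intro c hc hcu hcd
    obtain ⟨e, he, h6, h7, h8, j, h9, h10⟩ := H.tree c hc hcu (by omega)
    refine ⟨e, he, h6, h7, h8, j, ?_, h10⟩
    rw [hP, if_neg]
    · exact h9
    · rintro rfl
      omega

theorem Hole.matched (H : Hole N m a u v P used way N) : Matched N (m + 1) a u v P where
  feas := H.feas
  range c hc := H.range c hc.le hc.ne
  inj c hc d hd := H.inj c hc.le d hd.le hc.ne hd.ne
  surj i hi := by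
    obtain ⟨c, hc, hcN, h⟩ := H.surj i hi
    exact ⟨c, lt_of_le_of_ne hc hcN, h⟩
  tight c hc := H.tight c hc hc.ne

/-- A complete assignment with dual variables is optimal. -/
theorem Matched.optimal (M : Matched N N a u v P) :
    ∃ f : Equiv.Perm (Fin N), (∀ c : Fin N, P c = (f c : ℕ)) ∧
      ∀ ρ : Equiv.Perm (Fin N), ∑ c : Fin N, a (f c) c ≤ ∑ c : Fin N, a (ρ c) c := by
  choose! q hq using M.surj
  let q' : Fin N → Fin N := fun i => ⟨q i, (hq i i.2).1⟩
  have hinj : Function.Injective q' := by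
    intro i j h
    have h1 := (hq i i.2).2
    have h2 := (hq j j.2).2
    have h3 : q i = q j := congrArg Fin.val h
    rw [h3, h2] at h1
    exact Fin.ext (by omega)
  let e : Equiv.Perm (Fin N) := Equiv.ofBijective q' (Finite.injective_iff_bijective.1 hinj)
  have hP : ∀ c : Fin N, P c = ((e.symm c : Fin N) : ℕ) := by
    intro c
    have h1 : e (e.symm c) = c := e.apply_symm_apply c
    have h2 := (hq (e.symm c) (e.symm c).2).2
    have h3 : q (e.symm c) = c := congrArg Fin.val h1
    rwa [h3] at h2
  refine ⟨e.symm, hP, fun ρ => ?_⟩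
  -- Weak duality: tightness makes the cost equal to the sum of all dual variables, which bounds
  -- every assignment from below.
  have h1 : ∑ c : Fin N, a (e.symm c) c = ∑ c : Fin N, (u (e.symm c) + v c) :=
    Finset.sum_congr rfl fun c _ => (M.tight c c.2 _ (hP c)).symm
  rw [h1, Finset.sum_add_distrib, Equiv.sum_comp e.symm (fun i : Fin N => u i),
    ← Equiv.sum_comp ρ (fun i : Fin N => u i), ← Finset.sum_add_distrib]
  exact Finset.sum_le_sum fun c _ => M.feas _ (ρ c).2 _ c.2

end Hungarian

/-! ## The Hungarian method as a program

The rows and columns are `0, …, N - 1` with `N = 2 n`, and column `N` is the root of the trees. -/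

notation "arrA" => (18 : ℕ)
notation "arrU" => (19 : ℕ)
notation "arrV" => (20 : ℕ)
notation "arrP" => (21 : ℕ)
notation "arrUsed" => (22 : ℕ)
notation "arrWay" => (23 : ℕ)
notation "varDelta" => (24 : ℕ)
notation "varFrom" => (25 : ℕ)
notation "varTo" => (26 : ℕ)
notation "varHole" => (27 : ℕ)
notation "varSlack" => (28 : ℕ)
notation "idxC" => (29 : ℕ)
notation "idxD" => (30 : ℕ)
notation "idxG" => (31 : ℕ)
notation "idxM" => (32 : ℕ)

open _root_.MRMD.Expr _root_.MRMD.Prog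

/-- The number `n` of demands. -/
def dimN : Expr := var 0
/-- The number `2 n` of rows. -/
def dimNN : Expr := add dimN dimN

/-- Compare the slack of the edge between the columns `idxC` and `idxD` with the minimum so far. -/
def scanBody : Prog :=
  ifLe (vec arrUsed (var idxD)) (const 0)
    (seq (setVar varSlack (sub (sub (mat arrA (vec arrP (var idxC)) (var idxD))
        (vec arrU (vec arrP (var idxC)))) (vec arrV (var idxD))))
      (ifLe (const 0) (var varDelta)
        (ifLt (var varSlack) (var varDelta)
          (seq (setVar varDelta (var varSlack))
            (seq (setVar varFrom (var idxC)) (setVar varTo (var idxD)))) skip)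
        (seq (setVar varDelta (var varSlack))
          (seq (setVar varFrom (var idxC)) (setVar varTo (var idxD))))))
    skip

/-- Find the edge of minimum slack that leaves the tree. -/
def scan : Prog :=
  seq (setVar varDelta (const (-1)))
    (forTo idxC (add dimNN (const 1))
      (ifLe (const 1) (vec arrUsed (var idxC)) (forTo idxD dimNN scanBody) skip))

/-- Change the dual variables of the tree. -/
def raise : Prog :=
  forTo idxC (add dimNN (const 1))
    (ifLe (const 1) (vec arrUsed (var idxC))
      (seq (setVec arrU (vec arrP (var idxC)) (add (vec arrU (vec arrP (var idxC))) (var varDelta)))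
        (setVec arrV (var idxC) (sub (vec arrV (var idxC)) (var varDelta)))) skip)

/-- Add a column to the tree. -/
def growTree : Prog :=
  ifLt (var varHole) (const 0)
    (seq scan (seq raise (seq (setVec arrWay (var varTo) (var varFrom))
      (seq (setVec arrUsed (var varTo) (add (var idxG) (const 2)))
        (ifLt (vec arrP (var varTo)) (const 0) (setVar varHole (var varTo)) skip)))))
    skip

/-- Move the unmatched column towards the root. -/
def augment : Prog :=
  ifLt (var varHole) dimNN
    (seq (setVec arrP (var varHole) (vec arrP (vec arrWay (var varHole))))
      (setVar varHole (vec arrWay (var varHole))))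
    skip

/-- Match the row `idxM`. -/
def insertRow : Prog :=
  seq (setVec arrP dimNN (var idxM))
    (seq (forTo idxC dimNN (setVec arrUsed (var idxC) (const 0)))
      (seq (setVec arrUsed dimNN (const 1))
        (seq (setVar varHole (const (-1)))
          (seq (forTo idxG dimNN growTree) (loop (add dimNN (const 1)) augment)))))

/-- The Hungarian method: an assignment of minimum cost for the matrix `arrA`. -/
def hungarian : Prog :=
  seq (forTo idxC dimNN (seq (setVec arrP (var idxC) (const (-1)))
      (seq (setVec arrU (var idxC) (const 0)) (setVec arrV (var idxC) (const 0)))))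
    (forTo idxM dimNN insertRow)

/-- The slack of the edge between the row of the column `c` and the column `d`. -/
def slack (s : Store) (c d : ℕ) : ℤ :=
  s arrA (s arrP c 0 0).toNat d 0 - s arrU (s arrP c 0 0).toNat 0 0 - s arrV d 0 0

/-- The edge `(varFrom, varTo)` has minimum slack `varDelta` among the edges in `Q` that leave the
tree. The matching and the tree are those of the memory `s`. -/
structure ScanInv (N : ℕ) (s t : Store) (Q : ℕ → ℕ → Prop) : Prop where
  min : ∀ c d, Q c d → c ≤ N → d < N → 0 < s arrUsed c 0 0 → s arrUsed d 0 0 ≤ 0 →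
    0 ≤ t varDelta 0 0 0 ∧ t varDelta 0 0 0 ≤ slack s c d
  attained : t varDelta 0 0 0 = -1 ∨ ∃ c d : ℕ, c ≤ N ∧ d < N ∧ 0 < s arrUsed c 0 0 ∧
    s arrUsed d 0 0 ≤ 0 ∧ t varFrom 0 0 0 = c ∧ t varTo 0 0 0 = d ∧ t varDelta 0 0 0 = slack s c d

theorem ScanInv.mono {N : ℕ} {s t t' : Store} {Q Q' : ℕ → ℕ → Prop} (h : ScanInv N s t Q)
    (hQ : ∀ c d, Q' c d → c ≤ N → d < N → 0 < s arrUsed c 0 0 → s arrUsed d 0 0 ≤ 0 → Q c d)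
    (h₁ : t' varDelta = t varDelta) (h₂ : t' varFrom = t varFrom) (h₃ : t' varTo = t varTo) :
    ScanInv N s t' Q' := by
  refine ⟨fun c d h4 h5 h6 h7 h8 => ?_, ?_⟩
  · rw [h₁]
    exact h.min c d (hQ c d h4 h5 h6 h7 h8) h5 h6 h7 h8
  · rw [h₁, h₂, h₃]
    exact h.attained

/-- The value `-1` of `varDelta` means that no edge has been seen yet. As slacks are nonnegative, it
cannot be confused with a minimum. -/
theorem scanBody_spec {N : ℕ} {s t : Store} {Q Q' : ℕ → ℕ → Prop} (h : ScanInv N s t Q) {c d : ℕ}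
    (hs : ∀ c ≤ N, 0 < s arrUsed c 0 0 → ∀ d < N, s arrUsed d 0 0 ≤ 0 → 0 ≤ slack s c d)
    (hQ : ∀ c' d', Q' c' d' → Q c' d' ∨ (c' = c ∧ d' = d)) (hc : c ≤ N) (hd : d < N)
    (hcu : 0 < s arrUsed c 0 0) (hC : t idxC 0 0 0 = c) (hD : t idxD 0 0 0 = d)
    (hA : t arrA = s arrA) (hU : t arrU = s arrU) (hV : t arrV = s arrV) (hP : t arrP = s arrP)
    (hused : t arrUsed = s arrUsed) : ScanInv N s (exec scanBody t) Q' := by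
  have hsl : t arrA (t arrP c 0 0).toNat d 0 - t arrU (t arrP c 0 0).toNat 0 0 - t arrV d 0 0 =
      slack s c d := by rw [hA, hU, hV, hP]; rfl
  simp only [scanBody, exec_ifLe, exec_ifLt, exec_seq, exec_setVar, exec_skip, eval_vec, eval_var,
    eval_const, eval_sub, eval_mat, hC, hD, Int.toNat_natCast, hsl, hused, Store.set_apply,
    Nat.reduceEqDiff, false_and, if_false, and_self, if_true]
  split_ifs with h1 h2 h3
  · refine ⟨fun c' d' hq hc' hd' hcu' hdu' => ?_, Or.inr ⟨c, d, hc, hd, hcu, h1, ?_, ?_, ?_⟩⟩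
    · simp only [Store.set_apply]
      rcases hQ c' d' hq with hq | ⟨rfl, rfl⟩
      · have := h.min c' d' hq hc' hd' hcu' hdu'
        have := hs c hc hcu d hd h1
        simp
        omega
      · have := hs c' hc hcu d' hd h1
        simpa using this
    · simp [Store.set_apply]
    · simp [Store.set_apply]
    · simp [Store.set_apply]
  · refine ⟨fun c' d' hq hc' hd' hcu' hdu' => ?_, ?_⟩
    · simp only [Store.set_apply]
      rcases hQ c' d' hq with hq | ⟨rfl, rfl⟩
      · have := h.min c' d' hq hc' hd' hcu' hdu'
        simpa using this
      · simp
        omega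
    · simpa [Store.set_apply] using h.attained
  · refine ⟨fun c' d' hq hc' hd' hcu' hdu' => ?_, Or.inr ⟨c, d, hc, hd, hcu, h1, ?_, ?_, ?_⟩⟩
    · simp only [Store.set_apply]
      rcases hQ c' d' hq with hq | ⟨rfl, rfl⟩
      · have := h.min c' d' hq hc' hd' hcu' hdu'
        omega
      · have := hs c' hc hcu d' hd h1
        simpa using this
    · simp [Store.set_apply]
    · simp [Store.set_apply]
    · simp [Store.set_apply]
  · refine h.mono (fun c' d' hq _ _ _ hdu' => ?_) rfl rfl rfl
    rcases hQ c' d' hq with hq | ⟨rfl, rfl⟩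
    · exact hq
    · exact absurd hdu' h1

theorem eval_dimNN (s : Store) : dimNN.eval s = s 0 0 0 0 + s 0 0 0 0 := (rfl)

theorem scan_spec {N : ℕ} {s : Store} (hN : s 0 0 0 0 + s 0 0 0 0 = N)
    (hs : ∀ c ≤ N, 0 < s arrUsed c 0 0 → ∀ d < N, s arrUsed d 0 0 ≤ 0 → 0 ≤ slack s c d) :
    ScanInv N s (exec scan s) fun _ _ => True := by
  have h1 : ScanInv N s (exec scan s) fun c _ => c < N + 1 := by
    rw [scan, exec_seq]
    refine exec_forTo (fun j t => ScanInv N s t fun c _ => c < j) (by decide) ?_ ?_ ?_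
    · simp [eval_dimNN, eval_add, eval_const, exec_setVar, Store.set_apply, hN]
    · exact ⟨fun c d h => absurd h (Nat.not_lt_zero c),
        Or.inl (by simp [exec_setVar, Store.set_apply, eval_const])⟩
    · intro c t hc hf hC hJ
      have hf' : ∀ b, b ≠ idxC → b ≠ varDelta →
          b ∉ (ifLe (const 1) (vec arrUsed (var idxC)) (forTo idxD dimNN scanBody) skip).writes →
          t b = s b := fun b h₁ h₂ h₃ => by
        rw [hf b h₁ h₃, exec_setVar, Store.set_ne _ _ _ _ _ h₂]
      have hA := hf' arrA (by decide) (by decide) (by decide)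
      have hU := hf' arrU (by decide) (by decide) (by decide)
      have hV := hf' arrV (by decide) (by decide) (by decide)
      have hP := hf' arrP (by decide) (by decide) (by decide)
      have hused := hf' arrUsed (by decide) (by decide) (by decide)
      have hdim := hf' 0 (by decide) (by decide) (by decide)
      refine ScanInv.mono (t := exec (ifLe (const 1) (vec arrUsed (var idxC))
        (forTo idxD dimNN scanBody) skip) t) (Q := fun c' _ => c' < c + 1) ?_
        (fun c' d' h _ _ _ _ => h) (Store.set_ne _ _ _ _ _ (by decide))
        (Store.set_ne _ _ _ _ _ (by decide)) (Store.set_ne _ _ _ _ _ (by decide))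
      rw [exec_ifLe]
      simp only [eval_const, eval_vec, eval_var, hC, Int.toNat_natCast, hused]
      split_ifs with hcu
      · refine (exec_forTo (m := N)
          (fun j t => ScanInv N s t fun c' d' => c' < c ∨ (c' = c ∧ d' < j))
          (by decide) ?_ ?_ ?_).mono (fun c' d' h _ hd' _ _ => ?_) rfl rfl rfl
        · simp [eval_dimNN, Store.set_apply, hdim, hN]
        · refine hJ.mono (fun c' d' h _ _ _ _ => ?_) (Store.set_ne _ _ _ _ _ (by decide))
            (Store.set_ne _ _ _ _ _ (by decide)) (Store.set_ne _ _ _ _ _ (by decide))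
          omega
        · intro d t' hd hg hD hJ'
          refine ScanInv.mono (t := exec scanBody t')
            (Q := fun c' d' => c' < c ∨ (c' = c ∧ d' < d + 1)) ?_
            (fun c' d' h _ _ _ _ => h) (Store.set_ne _ _ _ _ _ (by decide))
            (Store.set_ne _ _ _ _ _ (by decide)) (Store.set_ne _ _ _ _ _ (by decide))
          refine scanBody_spec hJ' hs (fun c' d' h => ?_) (Nat.lt_succ_iff.1 hc) hd (by omega)
            ?_ hD ?_ ?_ ?_ ?_ ?_
          · omega
          · rw [hg idxC (by decide) (by decide), hC]
          · rw [hg arrA (by decide) (by decide), hA]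
          · rw [hg arrU (by decide) (by decide), hU]
          · rw [hg arrV (by decide) (by decide), hV]
          · rw [hg arrP (by decide) (by decide), hP]
          · rw [hg arrUsed (by decide) (by decide), hused]
        · omega
      · refine hJ.mono (fun c' d' h _ _ hcu' _ => ?_) rfl rfl rfl
        rcases (Nat.lt_succ_iff.1 h).lt_or_eq with h | rfl
        · exact h
        · exact absurd hcu' (by omega)
  exact h1.mono (fun c d _ hc _ _ _ => Nat.lt_succ_iff.2 hc) rfl rfl rfl

/-- The program reaches rows through the columns that hold them, so injectivity is needed for each
row to be raised only once. The loop includes column `N`, because the row of the root belongs to the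
tree. -/
theorem raise_spec {N : ℕ} {s : Store} (hN : s 0 0 0 0 + s 0 0 0 0 = N)
    (hmat : ∀ c ≤ N, 0 < s arrUsed c 0 0 → ∃ i : ℕ, s arrP c 0 0 = i)
    (hinj : ∀ c ≤ N, ∀ d ≤ N, ∀ i : ℕ, s arrP c 0 0 = i → s arrP d 0 0 = i → c = d) :
    (∀ c ≤ N, 0 < s arrUsed c 0 0 → ∀ i : ℕ, s arrP c 0 0 = i →
      exec raise s arrU i 0 0 = s arrU i 0 0 + s varDelta 0 0 0) ∧
    (∀ i : ℕ, (∀ c ≤ N, 0 < s arrUsed c 0 0 → s arrP c 0 0 ≠ i) →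
      exec raise s arrU i 0 0 = s arrU i 0 0) ∧
    ∀ c ≤ N, exec raise s arrV c 0 0 =
      if 0 < s arrUsed c 0 0 then s arrV c 0 0 - s varDelta 0 0 0 else s arrV c 0 0 := by
  have key : (∀ c ≤ N, 0 < s arrUsed c 0 0 → ∀ i : ℕ, s arrP c 0 0 = i →
      exec raise s arrU i 0 0 =
        if c < N + 1 then s arrU i 0 0 + s varDelta 0 0 0 else s arrU i 0 0) ∧
    (∀ i : ℕ, (∀ c ≤ N, 0 < s arrUsed c 0 0 → s arrP c 0 0 ≠ i) →
      exec raise s arrU i 0 0 = s arrU i 0 0) ∧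
    ∀ c ≤ N, exec raise s arrV c 0 0 = if c < N + 1 ∧ 0 < s arrUsed c 0 0 then
      s arrV c 0 0 - s varDelta 0 0 0 else s arrV c 0 0 := by
    refine exec_forTo (m := N + 1) (fun j t =>
      (∀ c ≤ N, 0 < s arrUsed c 0 0 → ∀ i : ℕ, s arrP c 0 0 = i →
        t arrU i 0 0 = if c < j then s arrU i 0 0 + s varDelta 0 0 0 else s arrU i 0 0) ∧
      (∀ i : ℕ, (∀ c ≤ N, 0 < s arrUsed c 0 0 → s arrP c 0 0 ≠ i) →
        t arrU i 0 0 = s arrU i 0 0) ∧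
      ∀ c ≤ N, t arrV c 0 0 = if c < j ∧ 0 < s arrUsed c 0 0 then
        s arrV c 0 0 - s varDelta 0 0 0 else s arrV c 0 0) (by decide) ?_ ?_ ?_
    · simp [eval_dimNN, eval_add, eval_const, Store.set_apply, hN]
    · simp [Store.set_apply]
    · rintro j t hj hf hC ⟨h1, h2, h3⟩
      have hP := hf arrP (by decide) (by decide)
      have hused := hf arrUsed (by decide) (by decide)
      have hD := hf varDelta (by decide) (by decide)
      rw [exec_ifLe]
      simp only [eval_const, eval_vec, eval_var, hC, Int.toNat_natCast, hused]
      split_ifs with hju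
      · obtain ⟨i₀, hi₀⟩ := hmat j (by omega) (by omega)
        have h4 := h1 j (by omega) (by omega) i₀ hi₀
        have h5 := h3 j (by omega)
        simp only [lt_irrefl, if_false, false_and] at h4 h5
        simp only [exec_seq, exec_setVec, eval_add, eval_sub, eval_vec, eval_var, hC, hP, hi₀, hD,
          Int.toNat_natCast, Store.set_apply, Nat.reduceEqDiff, false_and, if_false, true_and,
          and_true, h4, h5]
        refine ⟨?_, ?_, ?_⟩
        · intro c hc hcu i hi
          have h6 := h1 c hc hcu i hi
          split_ifs with h7 h8 h8
          · rw [h7]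
          · exfalso
            have := hinj c hc j (by omega) i₀ (by omega) hi₀
            omega
          · rw [h6, if_pos]
            have : c ≠ j := by
              rintro rfl
              omega
            omega
          · rw [h6, if_neg (by omega)]
        · intro i hi
          rw [if_neg, h2 i hi]
          rintro rfl
          exact hi j (by omega) (by omega) hi₀
        · intro c hc
          have h6 := h3 c hc
          by_cases hcj : c = j
          · subst hcj
            rw [if_pos rfl, if_pos ⟨by omega, by omega⟩]
          · rw [if_neg hcj, h6]
            exact if_congr (by omega) rfl rfl
      · rw [exec_skip]
        simp only [Store.set_apply, Nat.reduceEqDiff, false_and, if_false]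
        refine ⟨fun c hc hcu i hi => ?_, h2, fun c hc => ?_⟩
        · rw [h1 c hc hcu i hi]
          have : c ≠ j := by
            rintro rfl
            omega
          exact if_congr (by omega) rfl rfl
        · rw [h3 c hc]
          refine if_congr ?_ rfl rfl
          constructor
          · rintro ⟨h, h'⟩
            exact ⟨by omega, h'⟩
          · rintro ⟨h, h'⟩
            refine ⟨?_, h'⟩
            have : c ≠ j := by
              rintro rfl
              omega
            omega
  obtain ⟨h1, h2, h3⟩ := key
  refine ⟨fun c hc hcu i hi => ?_, h2, fun c hc => ?_⟩
  · rw [h1 c hc hcu i hi, if_pos (by omega)]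
  · rw [h3 c hc]
    exact if_congr (by omega) rfl rfl

/-- The matching in the memory. -/
def MatchedIn (N m : ℕ) (s : Store) : Prop :=
  Matched N m (fun i j => s arrA i j 0) (fun i => s arrU i 0 0) (fun i => s arrV i 0 0)
    (fun i => s arrP i 0 0)

/-- The tree in the memory. -/
def TreeIn (N m : ℕ) (s : Store) (g : ℕ) : Prop :=
  Tree N m (fun i j => s arrA i j 0) (fun i => s arrU i 0 0) (fun i => s arrV i 0 0)
    (fun i => s arrP i 0 0) (fun i => s arrUsed i 0 0) (fun i => s arrWay i 0 0) g

/-- The matching with a hole in the memory. -/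
def HoleIn (N m : ℕ) (s : Store) (h : ℕ) : Prop :=
  Hole N m (fun i j => s arrA i j 0) (fun i => s arrU i 0 0) (fun i => s arrV i 0 0)
    (fun i => s arrP i 0 0) (fun i => s arrUsed i 0 0) (fun i => s arrWay i 0 0) h

/-- The state after `g` rounds of the search for an unmatched column. -/
def GrowInv (N m g : ℕ) (s : Store) : Prop :=
  (s varHole 0 0 0 < 0 ∧ TreeIn N m s g ∧
    (∀ c < N, 0 < s arrUsed c 0 0 → ∃ i : ℕ, s arrP c 0 0 = i) ∧
    ((Finset.range N).filter fun c => 0 < s arrUsed c 0 0).card = g) ∨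
  ∃ h : ℕ, s varHole 0 0 0 = h ∧ HoleIn N m s h ∧ s arrUsed h 0 0 ≤ N + 1

theorem growTree_spec {N m g : ℕ} {s : Store} (hN : s 0 0 0 0 + s 0 0 0 0 = N) (hm : m < N)
    (hg : g < N) (hG : s idxG 0 0 0 = g) (hI : GrowInv N m g s) :
    GrowInv N m (g + 1) (exec growTree s) := by
  rw [growTree, exec_ifLt]
  simp only [eval_var, eval_const]
  rcases hI with ⟨hneg, T, hmat, hcard⟩ | ⟨h, hh, H, hle⟩
  swap
  · rw [if_neg (by omega)]
    exact Or.inr ⟨h, hh, H, hle⟩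
  rw [if_pos hneg]
  have hmat' : ∀ c ≤ N, 0 < s arrUsed c 0 0 → ∃ i : ℕ, s arrP c 0 0 = i := by
    intro c hc hcu
    rcases hc.lt_or_eq with hc | rfl
    · exact hmat c hc hcu
    · exact ⟨m, T.root⟩
  have hmatlt : ∀ c ≤ N, ∀ i : ℕ, s arrP c 0 0 = i → i < N := by
    intro c hc i hi
    rcases hc.lt_or_eq with hc | rfl
    · rcases T.range c hc with h | ⟨j, hj, h⟩ <;> omega
    · have := T.root
      omega
  have hsl : ∀ c ≤ N, 0 < s arrUsed c 0 0 → ∀ d < N, s arrUsed d 0 0 ≤ 0 → 0 ≤ slack s c d := by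
    intro c hc hcu d hd hdu
    obtain ⟨i, hi⟩ := hmat' c hc hcu
    have := T.feas i (hmatlt c hc i hi) d hd
    rw [slack, hi, Int.toNat_natCast]
    omega
  obtain ⟨d₀, hd₀, hdu₀⟩ := T.exists_unused hm hmat
  have hscan := scan_spec hN hsl
  have hroot := T.used_root
  -- The root is in the tree and `d₀` is not, so some edge was scanned and `varDelta` is not `-1`.
  have hδ₀ := (hscan.min N d₀ trivial le_rfl hd₀ (by omega) hdu₀).1
  obtain ⟨cf, ct, hcf, hct, hcfu, hctu, hFrom, hTo, hδ⟩ := hscan.attained.resolve_left (by omega)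
  obtain ⟨i₀, hi₀⟩ := hmat' cf hcf hcfu
  rw [exec_seq, exec_seq]
  set s₁ := exec scan s with hs₁
  have f₁ : ∀ b, b ∉ scan.writes → s₁ b = s b := fun b hb => exec_frame hb s
  have hP₁ := f₁ arrP (by decide)
  have hU₁ := f₁ arrU (by decide)
  have hV₁ := f₁ arrV (by decide)
  have hused₁ := f₁ arrUsed (by decide)
  obtain ⟨r1, r2, r3⟩ := raise_spec (N := N) (s := s₁) (by rw [f₁ 0 (by decide), hN])
    (by rw [hP₁, hused₁]; exact hmat')
    (by rw [hP₁]; exact fun c hc d hd i => T.inj_root hc hd)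
  rw [hP₁, hU₁, hused₁] at r1 r2
  rw [hV₁, hused₁] at r3
  set s₂ := exec raise s₁ with hs₂
  have f₂ : ∀ b, b ∉ raise.writes → s₂ b = s₁ b := fun b hb => exec_frame hb s₁
  have hP₂ : s₂ arrP = s arrP := (f₂ _ (by decide)).trans hP₁
  have hA₂ : s₂ arrA = s arrA := (f₂ _ (by decide)).trans (f₁ _ (by decide))
  have hused₂ : s₂ arrUsed = s arrUsed := (f₂ _ (by decide)).trans hused₁
  have hway₂ : s₂ arrWay = s arrWay := (f₂ _ (by decide)).trans (f₁ _ (by decide))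
  have hG₂ : s₂ idxG = s idxG := (f₂ _ (by decide)).trans (f₁ _ (by decide))
  have hhole₂ : s₂ varHole = s varHole := (f₂ _ (by decide)).trans (f₁ _ (by decide))
  have hTo₂ : s₂ varTo 0 0 0 = ct := by rw [f₂ _ (by decide), hTo]
  have hFrom₂ : s₂ varFrom 0 0 0 = cf := by rw [f₂ _ (by decide), hFrom]
  have T' := T.grow (cf := cf) (ct := ct) (i₀ := i₀) (δ := s₁ varDelta 0 0 0)
    (u' := fun i => s₂ arrU i 0 0) (v' := fun i => s₂ arrV i 0 0)
    (used' := fun c => if c = ct then (g : ℤ) + 2 else s arrUsed c 0 0)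
    (way' := fun c => if c = ct then (cf : ℤ) else s arrWay c 0 0) hcf hcfu hct hctu hi₀
    (by rw [hδ, slack, hi₀, Int.toNat_natCast])
    (by
      intro c hc hcu i hi d hd hdu
      have := (hscan.min c d trivial hc hd hcu hdu).2
      rwa [slack, hi, Int.toNat_natCast] at this)
    r1 r2 (fun c hc => r3 c hc.le) (fun c => rfl) (fun c => rfl) hδ₀
  have e₁ : (fun c => if c = ct then (g : ℤ) + 2 else s arrUsed c 0 0) = fun c =>
      ((s₂.set arrWay ct 0 0 cf).set arrUsed ct 0 0 (g + 2)) arrUsed c 0 0 := by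
    funext c
    simp [Store.set_apply, hused₂]
  have e₂ : (fun c => if c = ct then (cf : ℤ) else s arrWay c 0 0) = fun c =>
      ((s₂.set arrWay ct 0 0 cf).set arrUsed ct 0 0 (g + 2)) arrWay c 0 0 := by
    funext c
    simp [Store.set_apply, hway₂]
  simp only [exec_seq, exec_setVec, exec_ifLt, exec_setVar, exec_skip, eval_var, eval_vec,
    eval_add, eval_const, Store.set_apply, Nat.reduceEqDiff, false_and, if_false, hTo₂, hFrom₂,
    hG₂, hG, hP₂, Int.toNat_natCast]
  set s₃ := (s₂.set arrWay ct 0 0 cf).set arrUsed ct 0 0 ((g : ℤ) + 2) with hs₃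
  have T₃ : TreeIn N m s₃ (g + 1) := by
    have a1 : s₃ arrA = s arrA := by
      rw [hs₃, Store.set_ne _ _ _ _ _ (by decide), Store.set_ne _ _ _ _ _ (by decide), hA₂]
    have a2 : s₃ arrP = s arrP := by
      rw [hs₃, Store.set_ne _ _ _ _ _ (by decide), Store.set_ne _ _ _ _ _ (by decide), hP₂]
    have a3 : s₃ arrU = s₂ arrU := by
      rw [hs₃, Store.set_ne _ _ _ _ _ (by decide), Store.set_ne _ _ _ _ _ (by decide)]
    have a4 : s₃ arrV = s₂ arrV := by
      rw [hs₃, Store.set_ne _ _ _ _ _ (by decide), Store.set_ne _ _ _ _ _ (by decide)]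
    rw [e₁, e₂] at T'
    unfold TreeIn
    rw [a1, a2, a3, a4]
    exact T'
  have hused₃ : ∀ c, s₃ arrUsed c 0 0 = if c = ct then (g : ℤ) + 2 else s arrUsed c 0 0 :=
    fun c => (congrFun e₁ c).symm
  have hP₃ : s₃ arrP = s arrP := by
    rw [hs₃, Store.set_ne _ _ _ _ _ (by decide), Store.set_ne _ _ _ _ _ (by decide), hP₂]
  have hct₃ : 0 < s₃ arrUsed ct 0 0 := by
    rw [hused₃, if_pos rfl]
    omega
  -- A free column becomes the hole and ends the search; a matched one makes its row a new tree row,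
  -- and the count rises to `g + 1`.
  rcases T.range ct hct with hfree | ⟨i, hi, hPi⟩
  · rw [if_pos (by omega)]
    right
    refine ⟨ct, by simp [Store.set_apply], ?_, ?_⟩
    · exact T₃.hole hct hct₃ (by simp only [hP₃]; exact hfree)
    · have := T₃.used_le ct hct.le
      simp only [Store.set_apply, Nat.reduceEqDiff, false_and, if_false]
      push_cast at this
      omega
  · rw [if_neg (by omega)]
    left
    refine ⟨?_, T₃, ?_, ?_⟩
    · rw [hs₃, Store.set_ne _ _ _ _ _ (by decide), Store.set_ne _ _ _ _ _ (by decide), hhole₂]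
      exact hneg
    · intro c hc hcu
      rw [hP₃]
      rw [hused₃] at hcu
      split_ifs at hcu with hcct
      · exact ⟨i, hcct ▸ hPi⟩
      · exact hmat c hc hcu
    · have : (Finset.range N).filter (fun c => 0 < s₃ arrUsed c 0 0) =
          insert ct ((Finset.range N).filter fun c => 0 < s arrUsed c 0 0) := by
        ext c
        simp only [Finset.mem_filter, Finset.mem_range, Finset.mem_insert, hused₃]
        by_cases hcct : c = ct
        · subst hcct
          simp [hct]
          omega
        · simp [hcct]
      rw [this, Finset.card_insert_of_notMem, hcard]
      simp only [Finset.mem_filter, not_and]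
      intro _
      omega

/-- The discovery number of the hole starts at most at `N + 1`, stays positive and falls with each
move. Hence `N + 1` rounds bring the hole to the root, where further rounds do nothing. -/
theorem augment_spec {N m : ℕ} {s : Store} (hN : s 0 0 0 0 + s 0 0 0 0 = N) {h : ℕ}
    (hh : s varHole 0 0 0 = h) (H : HoleIn N m s h) (hle : s arrUsed h 0 0 ≤ N + 1) :
    MatchedIn N (m + 1) (exec (loop (add dimNN (const 1)) augment) s) := by
  have hloop : ((add dimNN (const 1)).eval s).toNat = N + 1 := by
    rw [eval_add, eval_dimNN, hN, eval_const]
    omega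
  rw [exec_loop, hloop]
  have key : ∀ j : ℕ, ∃ h : ℕ, ((exec augment)^[j] s) varHole 0 0 0 = h ∧
      HoleIn N m ((exec augment)^[j] s) h ∧
      (h = N ∨ ((exec augment)^[j] s) arrUsed h 0 0 + j ≤ N + 1) ∧
      ((exec augment)^[j] s) 0 = s 0 := by
    intro j
    induction j with
    | zero => exact ⟨h, hh, H, Or.inr (by simpa using hle), rfl⟩
    | succ j ih =>
      rw [Function.iterate_succ_apply']
      set t := (exec augment)^[j] s
      obtain ⟨h, hh, H, hle, h0⟩ := ih
      have hfr : exec augment t 0 = s 0 := by rw [exec_frame (by decide), h0]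
      by_cases hhN : h = N
      · refine ⟨h, ?_, ?_, Or.inl hhN, hfr⟩
        all_goals
          rw [augment, exec_ifLt, if_neg, exec_skip]
          · assumption
          · rw [eval_dimNN, eval_var, h0, hN, hh, hhN]
            omega
      · obtain ⟨d, hway, hlt, -, hstep⟩ := H.step hhN
        have hlt' := lt_of_le_of_ne H.le hhN
        have hex : exec augment t =
            (t.set arrP h 0 0 (t arrP d 0 0)).set varHole 0 0 0 d := by
          rw [augment, exec_ifLt, if_pos]
          · simp only [exec_seq, exec_setVec, exec_setVar, eval_var, eval_vec, hh, hway,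
              Int.toNat_natCast, Store.set_apply, Nat.reduceEqDiff, false_and, if_false]
          · rw [eval_dimNN, eval_var, h0, hN, hh]
            omega
        rw [hex] at hfr ⊢
        refine ⟨d, by simp [Store.set_apply], ?_, Or.inr ?_, hfr⟩
        · have := hstep
            (fun c => ((t.set arrP h 0 0 (t arrP d 0 0)).set varHole 0 0 0 d) arrP c 0 0)
            (fun c => by simp [Store.set_apply])
          exact this
        · simp only [Store.set_apply, Nat.reduceEqDiff, false_and, if_false]
          have := hle.resolve_left hhN
          push_cast
          omega
  obtain ⟨h, -, H, hle, -⟩ := key (N + 1)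
  have hu := H.used_hole
  obtain rfl : h = N := by
    rcases hle with h1 | h1
    · exact h1
    · push_cast at h1
      omega
  exact H.matched

theorem insertRow_spec {N m : ℕ} {s : Store} (hN : s 0 0 0 0 + s 0 0 0 0 = N) (hm : m < N)
    (hM : s idxM 0 0 0 = m) (M : MatchedIn N m s) : MatchedIn N (m + 1) (exec insertRow s) := by
  have hNN : ∀ t : Store, t 0 = s 0 → dimNN.eval t = N := fun t ht => by rw [eval_dimNN, ht, hN]
  simp only [insertRow, exec_seq]
  set s₁ := exec (setVec arrP dimNN (var idxM)) s with hs₁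
  have hs₁' : s₁ = s.set arrP N 0 0 m := by
    rw [hs₁, exec_setVec, hNN s rfl, eval_var, hM, Int.toNat_natCast]
  have h0₁ : s₁ 0 = s 0 := by rw [hs₁', Store.set_ne _ _ _ _ _ (by decide)]
  set s₂ := exec (forTo idxC dimNN (setVec arrUsed (var idxC) (const 0))) s₁ with hs₂
  have f₂ : ∀ b, b ≠ idxC → b ≠ arrUsed → s₂ b = s₁ b := fun b h₁ h₂ => by
    rw [hs₂]
    apply exec_frame
    simp [forTo, writes, setVec, setVar, h₁, h₂]
  have hused₂ : ∀ c < N, s₂ arrUsed c 0 0 = 0 := by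
    refine exec_forTo (m := N) (fun j t => ∀ c < j, t arrUsed c 0 0 = 0) (by decide) ?_ ?_ ?_
    · apply hNN
      rw [Store.set_ne _ _ _ _ _ (by decide), h0₁]
    · intro c hc
      omega
    · intro j t hj hf hC hJ c hc
      simp only [exec_setVec, eval_var, hC, Int.toNat_natCast, eval_const, Store.set_apply,
        Nat.reduceEqDiff, false_and, if_false, and_true, true_and]
      split_ifs with hcj
      · rfl
      · exact hJ c (by omega)
  have h0₂ : s₂ 0 = s 0 := by rw [f₂ 0 (by decide) (by decide), h0₁]
  set s₃ := exec (setVec arrUsed dimNN (const 1)) s₂ with hs₃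
  have hs₃' : s₃ = s₂.set arrUsed N 0 0 1 := by
    rw [hs₃, exec_setVec, hNN s₂ h0₂, eval_const, Int.toNat_natCast]
  set s₄ := exec (setVar varHole (const (-1))) s₃ with hs₄
  have hs₄' : s₄ = (s₂.set arrUsed N 0 0 1).set varHole 0 0 0 (-1) := by
    rw [hs₄, exec_setVar, hs₃', eval_const]
  have f₄ : ∀ b, b ≠ idxC → b ≠ arrUsed → b ≠ varHole → s₄ b = s₁ b := fun b h₁ h₂ h₃ => by
    rw [hs₄', Store.set_ne _ _ _ _ _ h₃, Store.set_ne _ _ _ _ _ h₂, f₂ b h₁ h₂]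
  have h0₄ : s₄ 0 = s 0 := by rw [f₄ 0 (by decide) (by decide) (by decide), h0₁]
  have hP₄ : ∀ c, s₄ arrP c 0 0 = if c = N then (m : ℤ) else s arrP c 0 0 := by
    intro c
    rw [f₄ _ (by decide) (by decide) (by decide), hs₁']
    simp [Store.set_apply]
  have hused₄ : ∀ c < N, s₄ arrUsed c 0 0 = 0 := by
    intro c hc
    rw [hs₄']
    simp [Store.set_apply, hc.ne, hused₂ c hc]
  have T : TreeIn N m s₄ 0 := by
    have fr : ∀ b, b ≠ idxC → b ≠ arrUsed → b ≠ varHole → b ≠ arrP → s₄ b = s b :=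
      fun b h₁ h₂ h₃ h₄ => by rw [f₄ b h₁ h₂ h₃, hs₁', Store.set_ne _ _ _ _ _ h₄]
    unfold TreeIn
    rw [fr arrA (by decide) (by decide) (by decide) (by decide),
      fr arrU (by decide) (by decide) (by decide) (by decide),
      fr arrV (by decide) (by decide) (by decide) (by decide)]
    refine Tree.init M ?_ ?_ hused₄ ?_
    · intro c hc
      rw [hP₄, if_neg hc.ne]
    · rw [hP₄, if_pos rfl]
    · rw [hs₄']
      simp [Store.set_apply]
  have hgrow : GrowInv N m N (exec (forTo idxG dimNN growTree) s₄) := by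
    -- The invariant does not read the loop counter, so both sides unfold to the same statement.
    have hG : ∀ g t (v : ℤ), GrowInv N m g t → GrowInv N m g (t.set idxG 0 0 0 v) := by
      intro g t v h
      exact h
    refine exec_forTo (m := N) (fun j t => GrowInv N m j t) (by decide) ?_ ?_ ?_
    · apply hNN
      rw [Store.set_ne _ _ _ _ _ (by decide), h0₄]
    · apply hG
      refine Or.inl ⟨?_, T, fun c hc h => ?_, ?_⟩
      · rw [hs₄']
        simp [Store.set_apply]
      · rw [hused₄ c hc] at h
        omega
      · rw [Finset.card_eq_zero, Finset.filter_eq_empty_iff]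
        intro c hc
        rw [hused₄ c (Finset.mem_range.1 hc)]
        omega
    · intro j t hj hf hGj hJ
      apply hG
      refine growTree_spec ?_ hm hj hGj hJ
      rw [hf 0 (by decide) (by decide), h0₄, hN]
  have h0₅ : exec (forTo idxG dimNN growTree) s₄ 0 = s 0 := by
    rw [exec_frame (by decide), h0₄]
  -- After `N` rounds without a free column the tree would contain all `N` columns, matched to fewer
  -- than `N` rows.
  rcases hgrow with ⟨-, T, hmat, hcard⟩ | ⟨h, hh, H, hle⟩
  · exfalso
    obtain ⟨d, hd, hdu⟩ := T.exists_unused hm hmat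
    have hall := Finset.eq_of_subset_of_card_le (Finset.filter_subset
      (fun c => 0 < exec (forTo idxG dimNN growTree) s₄ arrUsed c 0 0) (Finset.range N))
      (by rw [hcard, Finset.card_range])
    have := Finset.mem_range.2 hd
    rw [← hall] at this
    have := (Finset.mem_filter.1 this).2
    omega
  · exact augment_spec (by rw [h0₅, hN]) hh H hle

/-- The Hungarian method finds an assignment of all rows, with dual variables. -/
theorem hungarian_spec {N : ℕ} {s : Store} (hN : s 0 0 0 0 + s 0 0 0 0 = N)
    (hA : ∀ i < N, ∀ j < N, 0 ≤ s arrA i j 0) : MatchedIn N N (exec hungarian s) := by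
  rw [hungarian, exec_seq]
  set c₁ := forTo idxC dimNN (seq (setVec arrP (var idxC) (const (-1)))
      (seq (setVec arrU (var idxC) (const 0)) (setVec arrV (var idxC) (const 0)))) with hc₁
  have hinit : ∀ c < N, exec c₁ s arrP c 0 0 = -1 ∧ exec c₁ s arrU c 0 0 = 0 ∧
      exec c₁ s arrV c 0 0 = 0 := by
    refine exec_forTo (m := N) (fun j t => ∀ c < j, t arrP c 0 0 = -1 ∧ t arrU c 0 0 = 0 ∧
      t arrV c 0 0 = 0) (by decide) ?_ ?_ ?_
    · rw [eval_dimNN, Store.set_ne _ _ _ _ _ (by decide), hN]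
    · intro c hc
      omega
    · intro j t hj hf hC hJ c hc
      simp only [exec_seq, exec_setVec, eval_var, hC, Int.toNat_natCast, eval_const,
        Store.set_apply, Nat.reduceEqDiff, false_and, if_false, and_true, true_and]
      by_cases hcj : c = j
      · simp [hcj]
      · simp only [hcj, if_false]
        exact hJ c (by omega)
  have h0 : exec c₁ s 0 = s 0 := exec_frame (by decide) s
  have hA₁ : exec c₁ s arrA = s arrA := exec_frame (by decide) s
  refine exec_forTo (m := N) (fun j t => MatchedIn N j t) (by decide) ?_ ?_ ?_
  · rw [eval_dimNN, Store.set_ne _ _ _ _ _ (by decide), h0, hN]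
  -- With no row matched, zero dual variables are feasible because the entries are nonnegative.
  · refine ⟨?_, ?_, ?_, ?_, ?_⟩
    · intro i hi j hj
      have := hA i hi j hj
      simp only [Store.set_apply, Nat.reduceEqDiff, false_and, if_false, hA₁, (hinit i hi).2.1,
        (hinit j hj).2.2]
      omega
    · intro c hc
      left
      simp only [Store.set_apply, Nat.reduceEqDiff, false_and, if_false, (hinit c hc).1]
    · intro c hc d hd i hi
      simp only [Store.set_apply, Nat.reduceEqDiff, false_and, if_false, (hinit c hc).1] at hi
      omega
    · intro i hi
      omega
    · intro c hc i hi
      simp only [Store.set_apply, Nat.reduceEqDiff, false_and, if_false, (hinit c hc).1] at hi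
      omega
  · intro j t hj hf hM hJ
    have : MatchedIn N (j + 1) (exec insertRow t) := by
      refine insertRow_spec ?_ hj hM hJ
      rw [hf 0 (by decide) (by decide), h0, hN]
    exact this

/-! ## The program for Algorithm A -/

notation "varStart" => (15 : ℕ)
notation "varBig" => (16 : ℕ)
notation "arrOk" => (33 : ℕ)
notation "arrNext" => (34 : ℕ)
notation "arrCost" => (35 : ℕ)
notation "varBest" => (36 : ℕ)
notation "varCur" => (37 : ℕ)
notation "idxR" => (38 : ℕ)
notation "idxQ" => (39 : ℕ)
notation "idxI" => (40 : ℕ)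
notation "idxJ" => (41 : ℕ)

/-- The number of resource types. -/
def dimK : Expr := vec 0 (const 1)
/-- The number of starting locations. -/
def dimP : Expr := vec 0 (const 2)

/-- Find the common starting location. -/
def findStart : Prog :=
  forTo idxI dimP (ifLe (const 1) (mat 1 (const 0) (var idxI)) (setVar varStart (var idxI)) skip)

/-- Compute the cost of forbidden pairs: one more than the total reward. -/
def sumRewards : Prog :=
  seq (setVar varBig (const 1))
    (forTo idxI dimN (setVar varBig (add (var varBig) (vec 6 (var idxI)))))

/-- Run `c₁` if the type `q` is processed before the type `r`, else `c₂`. -/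
def ifBefore (q r : Expr) (c₁ c₂ : Prog) : Prog :=
  ifLt (mat 2 q (var varStart)) (mat 2 r (var varStart)) c₁
    (ifEq (mat 2 q (var varStart)) (mat 2 r (var varStart)) (ifLt q r c₁ c₂) c₂)

/-- Mark the demands that may be served in the subproblem of the type `idxR`. -/
def markDemands : Prog :=
  forTo idxI dimN
    (seq (setVec arrOk (var idxI) (const 0))
      (ifLe (const 1) (mat 3 (var idxI) (var idxR))
        (ifLe (mat 7 (var varStart) (var idxI)) (vec 4 (var idxI))
          (seq (setVec arrOk (var idxI) (const 1))
            (forTo idxQ dimK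
              (ifLe (const 1) (mat 3 (var idxI) (var idxQ))
                (ifBefore (var idxQ) (var idxR) (setVec arrOk (var idxI) (const 0)) skip) skip)))
          skip) skip))

/-- Compute one entry of the cost matrix. -/
def fillEntry : Prog :=
  ifLt (var idxI) dimN
    (ifEq (var idxJ) (var idxI) (setMat arrA (var idxI) (var idxJ) (vec 6 (var idxI)))
      (ifLe (const 1) (vec arrOk (var idxI))
        (ifLt (var idxJ) dimN
          (ifLe (add (add (vec 4 (var idxJ)) (vec 5 (var idxJ))) (mat 8 (var idxJ) (var idxI)))
            (vec 4 (var idxI)) (setMat arrA (var idxI) (var idxJ) (const 0))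
            (setMat arrA (var idxI) (var idxJ) (var varBig)))
          (ifLt (sub (var idxJ) dimN) (mat 2 (var idxR) (var varStart))
            (setMat arrA (var idxI) (var idxJ) (const 0))
            (setMat arrA (var idxI) (var idxJ) (var varBig))))
        (setMat arrA (var idxI) (var idxJ) (var varBig))))
    (setMat arrA (var idxI) (var idxJ) (const 0))

/-- Compute the cost matrix. -/
def fillMatrix : Prog := forTo idxI dimNN (forTo idxJ dimNN fillEntry)

/-- Store the assignment and the lost reward. -/
def storeResult : Prog :=
  seq (forTo idxI dimNN (setMat arrNext (var idxR) (var idxI) (vec arrP (var idxI))))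
    (seq (setVec arrCost (var idxR) (const 0))
      (forTo idxI dimN (ifEq (vec arrP (var idxI)) (var idxI)
        (setVec arrCost (var idxR) (add (vec arrCost (var idxR)) (vec 6 (var idxI)))) skip)))

/-- Solve the subproblem of the type `idxR`. -/
def solveType : Prog := seq markDemands (seq fillMatrix (seq hungarian storeResult))

/-- Find the best type. -/
def chooseBest : Prog :=
  seq (setVar varBest (const 0))
    (forTo idxR dimK
      (ifLt (vec arrCost (var idxR)) (vec arrCost (var varBest)) (setVar varBest (var idxR))
        (ifEq (vec arrCost (var idxR)) (vec arrCost (var varBest))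
          (ifBefore (var varBest) (var idxR) (setVar varBest (var idxR)) skip) skip)))

/-- Mark the demands which are met. -/
def outputServed : Prog :=
  forTo idxI dimN
    (ifEq (mat arrNext (var varBest) (var idxI)) (var idxI) skip (setVec 11 (var idxI) (const 1)))

/-- Move on to the next demand if the current one does not require the type `idxQ`. -/
def chaseStep : Prog :=
  ifLt (var varCur) dimN
    (ifLe (const 1) (mat 3 (var varCur) (var idxQ)) skip
      (setVar varCur (mat arrNext (var varBest) (var varCur)))) skip

/-- The variables of the resource of the type `idxQ` which leaves `idxI`. -/
def outputNext : Prog :=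
  seq (setVar varCur (mat arrNext (var varBest) (var idxI)))
    (seq (loop dimN chaseStep)
      (ifLt (var idxI) dimN
        (ifEq (mat arrNext (var varBest) (var idxI)) (var idxI) skip
          (ifLe (const 1) (mat 3 (var idxI) (var idxQ))
            (ifLt (var varCur) dimN (assign 13 (var idxQ) (var idxI) (var varCur) (const 1))
              (setMat 14 (var idxQ) (var idxI) (const 1))) skip))
        (ifLt (var varCur) dimN (assign 12 (var idxQ) (var varStart) (var varCur) (const 1))
          skip)))

/-- An implementation of Algorithm A. -/
def algorithm : Prog :=
  seq findStart (seq sumRewards (seq (forTo idxR dimK solveType) (seq chooseBest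
    (seq outputServed (forTo idxQ dimK (forTo idxI dimNN outputNext))))))

/-! ## Correctness -/

/-- The index of a demand or terminal in the arrays. -/
def code (x : Fin n ⊕ Fin n) : ℕ := (finSumFinEquiv x : Fin (n + n))

theorem code_inl (d : Fin n) : code (Sum.inl d) = d := by simp [code]

theorem code_inr (a : Fin n) : code (Sum.inr a) = n + a := by
  simp [code, Nat.add_comm]

theorem code_lt (x : Fin n ⊕ Fin n) : code x < n + n := (finSumFinEquiv x).2

theorem code_injective {x y : Fin n ⊕ Fin n} (h : code x = code y) : x = y :=
  finSumFinEquiv.injective (Fin.ext h)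

theorem exists_code {i : ℕ} (hi : i < n + n) : ∃ x : Fin n ⊕ Fin n, code x = i :=
  ⟨finSumFinEquiv.symm ⟨i, hi⟩, by simp [code]⟩

/-- The memory holds the instance, the starting location and the cost of forbidden pairs. -/
structure Ctx (I : Instance n k p) (s₀ : Fin p) (s : Store) : Prop where
  input : ∀ b < 11, s b = I.encode b
  start : s varStart 0 0 0 = (s₀ : ℕ)
  big : s varBig 0 0 0 = 1 + ∑ d, I.reward d

section Correctness

variable {I : Instance n k p} {s₀ : Fin p} {s : Store}

theorem Ctx.congr (h : Ctx I s₀ s) {t : Store} (ht : ∀ b, b < 11 ∨ b = 15 ∨ b = 16 → t b = s b) :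
    Ctx I s₀ t where
  input b hb := by rw [ht b (Or.inl hb), h.input b hb]
  start := by rw [ht _ (by simp), h.start]
  big := by rw [ht _ (by simp), h.big]

/-- The test on the written arrays is computable, so `decide` settles it for each concrete program.
-/
theorem Ctx.exec (h : Ctx I s₀ s) {c : Prog}
    (hc : (c.writes.all fun b => decide (11 ≤ b ∧ b ≠ 15 ∧ b ≠ 16)) = true) :
    Ctx I s₀ (exec c s) := by
  refine h.congr fun b hb => exec_frame (fun hm => ?_) s
  have := of_decide_eq_true (List.all_eq_true.1 hc b hm)
  omega

theorem Ctx.set (h : Ctx I s₀ s) {b : ℕ} (hb : 17 ≤ b) (i j l : ℕ) (v : ℤ) :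
    Ctx I s₀ (s.set b i j l v) :=
  h.congr fun b' hb' => Store.set_ne _ _ _ _ _ (by omega)

theorem Ctx.entry_n (h : Ctx I s₀ s) : s 0 0 0 0 = n := by rw [h.input 0 (by decide)]; rfl

theorem Ctx.entry_k (h : Ctx I s₀ s) : s 0 1 0 0 = k := by rw [h.input 0 (by decide)]; rfl

theorem Ctx.dimN (h : Ctx I s₀ s) : dimN.eval s = n := h.entry_n

theorem Ctx.dimNN (h : Ctx I s₀ s) : dimNN.eval s = (n + n : ℕ) := by
  rw [eval_dimNN, h.entry_n]
  push_cast
  rfl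

theorem Ctx.dimK (h : Ctx I s₀ s) : dimK.eval s = k := h.entry_k

theorem Ctx.count (h : Ctx I s₀ s) {r : ℕ} (hr : r < k) :
    s 2 r s₀ 0 = I.count ⟨r, hr⟩ s₀ := by
  rw [h.input 2 (by decide)]
  simp [Instance.encode, matArray, hr]

open Classical in
theorem Ctx.req (h : Ctx I s₀ s) {d r : ℕ} (hd : d < n) (hr : r < k) :
    s 3 d r 0 = if (⟨r, hr⟩ : Fin k) ∈ I.req ⟨d, hd⟩ then 1 else 0 := by
  rw [h.input 3 (by decide)]
  simp [Instance.encode, matArray, hr, hd]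

theorem Ctx.one_le_req (h : Ctx I s₀ s) {d r : ℕ} (hd : d < n) (hr : r < k) :
    1 ≤ s 3 d r 0 ↔ (⟨r, hr⟩ : Fin k) ∈ I.req ⟨d, hd⟩ := by
  rw [h.req hd hr]
  split_ifs with h <;> simp [h]

theorem Ctx.time (h : Ctx I s₀ s) {d : ℕ} (hd : d < n) : s 4 d 0 0 = I.time ⟨d, hd⟩ := by
  rw [h.input 4 (by decide)]
  simp [Instance.encode, vecArray, hd]

theorem Ctx.dur (h : Ctx I s₀ s) {d : ℕ} (hd : d < n) : s 5 d 0 0 = I.dur ⟨d, hd⟩ := by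
  rw [h.input 5 (by decide)]
  simp [Instance.encode, vecArray, hd]

theorem Ctx.reward (h : Ctx I s₀ s) {d : ℕ} (hd : d < n) : s 6 d 0 0 = I.reward ⟨d, hd⟩ := by
  rw [h.input 6 (by decide)]
  simp [Instance.encode, vecArray, hd]

theorem Ctx.travelStart (h : Ctx I s₀ s) {d : ℕ} (hd : d < n) :
    s 7 s₀ d 0 = I.travel (Sum.inl s₀) ⟨d, hd⟩ := by
  rw [h.input 7 (by decide)]
  simp [Instance.encode, matArray, hd]

theorem Ctx.travel (h : Ctx I s₀ s) {d e : ℕ} (hd : d < n) (he : e < n) :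
    s 8 d e 0 = I.travel (Sum.inr ⟨d, hd⟩) ⟨e, he⟩ := by
  rw [h.input 8 (by decide)]
  simp [Instance.encode, matArray, hd, he]

/-- The order in which the types are processed. -/
def Instance.Before (I : Instance n k p) (s₀ : Fin p) (q r : Fin k) : Prop :=
  I.count q s₀ < I.count r s₀ ∨ (I.count q s₀ = I.count r s₀ ∧ q < r)

open Classical in
/-- The demands of the subproblem of type `r`. -/
noncomputable def Instance.part (I : Instance n k p) (s₀ : Fin p) (r : Fin k) : Finset (Fin n) :=
  Finset.univ.filter fun d => r ∈ I.req d ∧ ∀ q, I.Before s₀ q r → q ∉ I.req d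

theorem mem_part {r : Fin k} {d : Fin n} :
    d ∈ I.part s₀ r ↔ r ∈ I.req d ∧ ∀ q, I.Before s₀ q r → q ∉ I.req d := by
  simp [Instance.part]

open Classical in
theorem exec_ifBefore (h : Ctx I s₀ s) {e₁ e₂ : Expr} {q r : Fin k} (hq : e₁.eval s = (q : ℕ))
    (hr : e₂.eval s = (r : ℕ)) (c₁ c₂ : Prog) :
    exec (ifBefore e₁ e₂ c₁ c₂) s = if I.Before s₀ q r then exec c₁ s else exec c₂ s := by
  simp only [ifBefore, exec_ifLt, exec_ifEq, eval_mat, eval_var, hq, hr, h.start,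
    Int.toNat_natCast, h.count q.2, h.count r.2, Instance.Before, Fin.lt_def, Fin.eta]
  split_ifs <;> first | rfl | omega

/-- The program inspects the starting set of type `0` only; it exists as `0 < k`, and all types
share it. -/
theorem findStart_spec (hs : ∀ r, I.startSet r = {s₀}) (hk : 0 < k)
    (h : ∀ b < 11, s b = I.encode b) : exec findStart s varStart 0 0 0 = (s₀ : ℕ) := by
  refine exec_forTo (m := p) (fun j t => (s₀ : ℕ) < j → t varStart 0 0 0 = (s₀ : ℕ)) (by decide)
    ?_ ?_ ?_ s₀.2
  · rw [dimP, eval_vec, eval_const, Store.set_ne _ _ _ _ _ (by decide), h 0 (by decide)]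
    rfl
  · intro h
    omega
  · intro j t hj hf hI hJ hlt
    have h1 : t 1 0 j 0 = if (⟨j, hj⟩ : Fin p) = s₀ then 1 else 0 := by
      rw [hf 1 (by decide) (by decide), h 1 (by decide)]
      simp [Instance.encode, matArray, hj, hk, hs]
    rw [exec_ifLe, eval_mat, eval_const, eval_const, eval_var, hI, Int.toNat_natCast,
      Int.toNat_zero, h1]
    by_cases hjs : (⟨j, hj⟩ : Fin p) = s₀
    · rw [if_pos hjs, if_pos le_rfl, exec_setVar, eval_var, hI, ← hjs]
      simp [Store.set_apply]
    · rw [if_neg hjs, if_neg (by norm_num), exec_skip, Store.set_ne _ _ _ _ _ (by decide)]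
      apply hJ
      have : (s₀ : ℕ) ≠ j := by
        rintro rfl
        exact hjs rfl
      omega

theorem sumRewards_spec (h : ∀ b < 11, s b = I.encode b) :
    exec sumRewards s varBig 0 0 0 = 1 + ∑ d, I.reward d := by
  rw [sumRewards, exec_seq]
  have h1 : ∀ b < 11, exec (setVar varBig (const 1)) s b = I.encode b := fun b hb => by
    rw [exec_setVar, Store.set_ne _ _ _ _ _ (by omega), h b hb]
  have := exec_forTo (m := n) (i := idxI) (e := dimN)
    (c := setVar varBig (add (var varBig) (vec 6 (var idxI))))
    (s := exec (setVar varBig (const 1)) s)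
    (fun j t => t varBig 0 0 0 = 1 + ∑ d ∈ Finset.range j, I.encode 6 d 0 0) (by decide) ?_ ?_ ?_
  · rw [this, Finset.sum_range]
    congr 1
    refine Finset.sum_congr rfl fun d _ => ?_
    simp [Instance.encode, vecArray]
  · rw [dimN, eval_var, Store.set_ne _ _ _ _ _ (by decide), h1 0 (by decide)]
    rfl
  · simp [exec_setVar, Store.set_apply, eval_const]
  · intro j t hj hf hI hJ
    rw [Store.set_ne _ _ _ _ _ (by decide), exec_setVar, eval_add, eval_var, eval_vec, eval_var,
      hI, Int.toNat_natCast, hJ, hf 6 (by decide) (by decide), h1 6 (by decide),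
      Finset.sum_range_succ, ← add_assoc]
    simp [Store.set_apply]

/-- A demand is first marked if it requires `r` and is reachable; the inner loop clears the mark
when it meets a required type that comes earlier. -/
theorem markDemands_spec (h : Ctx I s₀ s) {r : Fin k} (hr : s idxR 0 0 0 = (r : ℕ)) :
    ∀ d : Fin n, 1 ≤ exec markDemands s arrOk d 0 0 ↔ d ∈ I.part s₀ r ∧ I.Reach s₀ d := by
  have key : ∀ d : Fin n, (d : ℕ) < n →
      (1 ≤ exec markDemands s arrOk d 0 0 ↔ d ∈ I.part s₀ r ∧ I.Reach s₀ d) := by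
    refine exec_forTo (m := n) (fun j t => ∀ d : Fin n, (d : ℕ) < j →
      (1 ≤ t arrOk d 0 0 ↔ d ∈ I.part s₀ r ∧ I.Reach s₀ d)) (by decide) ?_ ?_ ?_
    · exact (h.set (by decide) _ _ _ _).dimN
    · intro d hd
      omega
    · intro j t hj hf hi hJ
      have ht : Ctx I s₀ t := by
        refine h.congr fun b hb => hf b (by omega) ?_
        intro hm
        simp [writes, ifBefore, setVec, setVar, forTo, ifLt, ifEq] at hm
        omega
      have htr : t idxR 0 0 0 = (r : ℕ) := by rw [hf _ (by decide) (by decide), hr]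
      rw [exec_seq, exec_setVec, eval_var, eval_const, hi, Int.toNat_natCast]
      set t₁ := t.set arrOk j 0 0 0 with ht₁
      have h₁ : Ctx I s₀ t₁ := ht.set (by decide) _ _ _ _
      have hi₁ : t₁ idxI 0 0 0 = j := by rw [ht₁, Store.set_ne _ _ _ _ _ (by decide), hi]
      have hr₁ : t₁ idxR 0 0 0 = (r : ℕ) := by rw [ht₁, Store.set_ne _ _ _ _ _ (by decide), htr]
      have hold : ∀ d : ℕ, d ≠ j → t₁ arrOk d 0 0 = t arrOk d 0 0 := by
        intro d hd
        simp [ht₁, Store.set_apply, hd]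
      -- it suffices to treat the entry `j`
      suffices H : ∀ t₂ : Store, (∀ d : ℕ, d ≠ j → t₂ arrOk d 0 0 = t₁ arrOk d 0 0) →
          (1 ≤ t₂ arrOk j 0 0 ↔ (⟨j, hj⟩ : Fin n) ∈ I.part s₀ r ∧ I.Reach s₀ ⟨j, hj⟩) →
          ∀ d : Fin n, (d : ℕ) < j + 1 →
            (1 ≤ (t₂.set idxI 0 0 0 ((j + 1 : ℕ) : ℤ)) arrOk d 0 0 ↔
              d ∈ I.part s₀ r ∧ I.Reach s₀ d) by
        have hj0 : t₁ arrOk j 0 0 = 0 := by simp [ht₁, Store.set_apply]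
        simp only [exec_ifLe, eval_const, eval_mat, eval_var, eval_vec, hi₁, hr₁, h₁.start,
          Int.toNat_natCast, h₁.one_le_req hj r.2, h₁.travelStart hj, h₁.time hj, exec_skip]
        split_ifs with h1 h2
        · rw [exec_seq, exec_setVec, eval_var, eval_const, hi₁, Int.toNat_natCast]
          set t₂ := t₁.set arrOk j 0 0 1 with ht₂
          have h₂ : Ctx I s₀ t₂ := h₁.set (by decide) _ _ _ _
          have hloop := exec_forTo (m := k) (i := idxQ) (e := dimK) (s := t₂)
            (c := ifLe (const 1) (mat 3 (var idxI) (var idxQ))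
                (ifBefore (var idxQ) (var idxR) (setVec arrOk (var idxI) (const 0)) skip) skip)
            (fun l t' => (∀ d : ℕ, d ≠ j → t' arrOk d 0 0 = t₁ arrOk d 0 0) ∧
              (1 ≤ t' arrOk j 0 0 ↔ ∀ q : Fin k, (q : ℕ) < l → I.Before s₀ q r →
                q ∉ I.req ⟨j, hj⟩)) (by decide) (h₂.set (by decide) _ _ _ _).dimK ?_ ?_
          · refine H _ hloop.1 ?_
            rw [hloop.2, mem_part]
            constructor
            · intro h3
              exact ⟨⟨h1, fun q => h3 q q.2⟩, h2⟩
            · rintro ⟨⟨-, h3⟩, -⟩ q -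
              exact h3 q
          · refine ⟨fun d hd => ?_, ?_⟩
            · simp [ht₂, Store.set_apply, hd]
            · simp [ht₂, Store.set_apply]
          · intro l t' hl hg hq hJ'
            have h' : Ctx I s₀ t' := by
              refine h₂.congr fun b hb => hg b (by omega) ?_
              intro hm
              have : b = 33 := by simpa [writes, ifBefore, setVec, ifLt, ifEq] using hm
              omega
            have hi' : t' idxI 0 0 0 = j := by
              rw [hg _ (by decide) (by decide), ht₂, Store.set_ne _ _ _ _ _ (by decide), hi₁]
            have hr' : t' idxR 0 0 0 = (r : ℕ) := by
              rw [hg _ (by decide) (by decide), ht₂, Store.set_ne _ _ _ _ _ (by decide), hr₁]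
            rw [exec_ifLe, eval_mat, eval_const, eval_var, eval_var, hi', hq, Int.toNat_natCast,
              Int.toNat_natCast, exec_ifBefore h' (q := ⟨l, hl⟩) (r := r) (by rw [eval_var, hq])
              (by rw [eval_var, hr'])]
            have hsplit : ∀ q : Fin k, (q : ℕ) < l + 1 → (q : ℕ) < l ∨ q = ⟨l, hl⟩ := by
              intro q hq
              rcases (Nat.lt_succ_iff.1 hq).lt_or_eq with h | h
              · exact Or.inl h
              · exact Or.inr (Fin.ext h)
            have hskip : ¬ (I.Before s₀ ⟨l, hl⟩ r ∧ (⟨l, hl⟩ : Fin k) ∈ I.req ⟨j, hj⟩) →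
                (1 ≤ t' arrOk j 0 0 ↔ ∀ q : Fin k, (q : ℕ) < l + 1 → I.Before s₀ q r →
                  q ∉ I.req ⟨j, hj⟩) := by
              intro hn
              rw [hJ'.2]
              constructor
              · intro h3 q hq hb hm
                rcases hsplit q hq with h4 | rfl
                · exact h3 q h4 hb hm
                · exact hn ⟨hb, hm⟩
              · intro h3 q hq
                exact h3 q (by omega)
            by_cases h3 : (⟨l, hl⟩ : Fin k) ∈ I.req ⟨j, hj⟩
            · rw [if_pos ((h'.one_le_req hj hl).2 h3)]
              by_cases h4 : I.Before s₀ ⟨l, hl⟩ r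
              · rw [if_pos h4, exec_setVec, eval_var, eval_const, hi', Int.toNat_natCast]
                refine ⟨fun d hd => ?_, ?_⟩
                · rw [← hJ'.1 d hd]
                  simp [Store.set_apply, hd]
                · simp only [Store.set_apply, Nat.reduceEqDiff, false_and, if_false, and_self,
                    if_true]
                  constructor
                  · intro h5
                    omega
                  · intro h5
                    exact absurd h3 (h5 ⟨l, hl⟩ (Nat.lt_succ_self l) h4)
              · rw [if_neg h4, exec_skip]
                exact ⟨hJ'.1, hskip fun h5 => h4 h5.1⟩
            · rw [if_neg (fun h5 => h3 ((h'.one_le_req hj hl).1 h5)), exec_skip]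
              exact ⟨hJ'.1, hskip fun h5 => h3 h5.2⟩
        · refine H _ (fun _ _ => rfl) ?_
          rw [hj0]
          constructor
          · intro h3
            omega
          · rintro ⟨-, h3⟩
            exact absurd h3 h2
        · refine H _ (fun _ _ => rfl) ?_
          rw [hj0, mem_part]
          constructor
          · intro h3
            omega
          · rintro ⟨⟨h3, -⟩, -⟩
            exact absurd h3 h1
      intro t₂ hne hjj d hd
      rw [Store.set_ne _ _ _ _ _ (by decide)]
      by_cases hdj : (d : ℕ) = j
      · subst hdj
        exact hjj
      · rw [hne d hdj, hold d hdj]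
        exact hJ d (by omega)
  exact fun d => key d d.2

end Correctness

/-! ### The subproblems: cost matrix, optimal assignment and choice of the best type. -/

section Correctness

variable {I : Instance n k p} {s₀ : Fin p} {s : Store}

theorem fillEntry_spec (h : Ctx I s₀ s) {r : Fin k} (hr : s idxR 0 0 0 = (r : ℕ))
    (hok : ∀ d : Fin n, 1 ≤ s arrOk d 0 0 ↔ d ∈ I.part s₀ r ∧ I.Reach s₀ d)
    {x y : Fin n ⊕ Fin n} (hx : s idxI 0 0 0 = (code x : ℕ)) (hy : s idxJ 0 0 0 = (code y : ℕ)) :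
    exec fillEntry s = s.set arrA (code x) (code y) 0
      (I.entry s₀ (I.part s₀ r) (I.count r s₀) (1 + ∑ d, I.reward d) x y) := by
  have hexec : ∀ e : Expr, exec (setMat arrA (var idxI) (var idxJ) e) s =
      s.set arrA (code x) (code y) 0 (e.eval s) := by
    intro e
    rw [exec_setMat, eval_var, eval_var, hx, hy, Int.toNat_natCast, Int.toNat_natCast]
  simp only [fillEntry, exec_ifLt, exec_ifEq, exec_ifLe, hexec]
  simp only [eval_var, eval_const, eval_vec, eval_mat, eval_add, eval_sub, h.dimN, hx, hy, hr,
    h.start, h.big, Int.toNat_natCast, h.count r.2, Fin.eta]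
  rcases x with e | b
  · rw [code_inl, if_pos (by exact_mod_cast e.2)]
    simp only [h.reward e.2, h.time e.2, Fin.eta]
    rcases y with d | a
    · rw [code_inl]
      simp only [h.time d.2, h.dur d.2, h.travel d.2 e.2, Fin.eta, Instance.entry]
      by_cases hde : d = e
      · rw [if_pos (by rw [hde]), if_pos hde]
      · rw [if_neg (by rw [Nat.cast_inj, Fin.val_inj]; exact hde), if_neg hde]
        by_cases h1 : e ∈ I.part s₀ r ∧ I.Reach s₀ e
        · rw [if_pos ((hok e).2 h1), if_pos (by exact_mod_cast d.2)]
          by_cases h2 : I.Prec d e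
          · rw [if_pos (show I.time d + I.dur d + I.travel (Sum.inr d) e ≤ I.time e from h2),
              if_pos ⟨h1, h2⟩]
          · rw [if_neg (show ¬ (I.time d + I.dur d + I.travel (Sum.inr d) e ≤ I.time e) from h2),
              if_neg fun h => h2 h.2]
        · rw [if_neg fun hh => h1 ((hok e).1 hh), if_neg fun h => h1 h.1]
    · rw [code_inr]
      have he := e.2
      simp only [Instance.entry]
      rw [if_neg (by push_cast; omega)]
      by_cases h1 : e ∈ I.part s₀ r ∧ I.Reach s₀ e
      · rw [if_pos ((hok e).2 h1), if_neg (by push_cast; omega)]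
        by_cases h2 : (a : ℕ) < I.count r s₀
        · rw [if_pos (by push_cast; omega), if_pos ⟨h1, h2⟩]
        · rw [if_neg (by push_cast; omega), if_neg fun h => h2 h.2]
      · rw [if_neg fun hh => h1 ((hok e).1 hh), if_neg fun h => h1 h.1]
  · rw [code_inr, if_neg (by push_cast; omega)]
    rfl

theorem fillMatrix_spec (h : Ctx I s₀ s) {r : Fin k} (hr : s idxR 0 0 0 = (r : ℕ))
    (hok : ∀ d : Fin n, 1 ≤ s arrOk d 0 0 ↔ d ∈ I.part s₀ r ∧ I.Reach s₀ d) :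
    ∀ x y, exec fillMatrix s arrA (code x) (code y) 0 =
      I.entry s₀ (I.part s₀ r) (I.count r s₀) (1 + ∑ d, I.reward d) x y := by
  set a := I.entry s₀ (I.part s₀ r) (I.count r s₀) (1 + ∑ d, I.reward d)
  have key : ∀ x y : Fin n ⊕ Fin n, code x < n + n →
      exec fillMatrix s arrA (code x) (code y) 0 = a x y := by
    refine exec_forTo (m := n + n) (fun i t => ∀ x y : Fin n ⊕ Fin n, code x < i →
      t arrA (code x) (code y) 0 = a x y) (by decide) (h.set (by decide) _ _ _ _).dimNN ?_ ?_
    · intro x y hx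
      omega
    · intro i t hi hf hI hJ
      have ht : ∀ b, b ≠ idxI → b ≠ idxJ → b ≠ arrA → t b = s b := by
        intro b h₁ h₂ h₃
        refine hf b h₁ ?_
        simp [writes, forTo, setVar, setMat, fillEntry, ifLt, ifEq, h₂, h₃]
      have hCt : Ctx I s₀ t := h.congr fun b hb => ht b (by omega) (by omega) (by omega)
      have := exec_forTo (m := n + n) (i := idxJ) (e := dimNN) (c := fillEntry) (s := t)
        (fun j t' => ∀ x y : Fin n ⊕ Fin n, code x < i ∨ (code x = i ∧ code y < j) →
          t' arrA (code x) (code y) 0 = a x y) (by decide) (hCt.set (by decide) _ _ _ _).dimNN ?_ ?_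
      · intro x y hx
        rw [Store.set_ne _ _ _ _ _ (by decide)]
        exact this x y (by have := code_lt y; omega)
      · intro x y hxy
        rw [Store.set_ne _ _ _ _ _ (by decide)]
        exact hJ x y (by omega)
      · intro j t' hj hg hIJ hJ' x y hxy
        have ht' : ∀ b, b ≠ idxI → b ≠ idxJ → b ≠ arrA → t' b = s b := by
          intro b h₁ h₂ h₃
          rw [hg b h₂, ht b h₁ h₂ h₃]
          simp [writes, setMat, fillEntry, ifLt, ifEq, h₃]
        obtain ⟨x', hx'⟩ := exists_code hi
        obtain ⟨y', hy'⟩ := exists_code hj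
        rw [Store.set_ne _ _ _ _ _ (by decide), fillEntry_spec (x := x') (y := y') (r := r)
          (h.congr fun b hb => ht' b (by omega) (by omega) (by omega))
          (by rw [ht' _ (by decide) (by decide) (by decide), hr])
          (by rw [ht' _ (by decide) (by decide) (by decide)]; exact hok)
          (by rw [hg _ (by decide) (by decide), hI, hx']) (by rw [hIJ, hy']),
          Store.set_apply]
        by_cases hc : code x = code x' ∧ code y = code y'
        · rw [if_pos ⟨rfl, hc.1, hc.2, rfl⟩, code_injective hc.1, code_injective hc.2]
        · rw [if_neg fun hh => hc ⟨hh.2.1, hh.2.2.1⟩]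
          apply hJ'
          omega
  exact fun x y => key x y (code_lt x)

/-- The optimal permutation of array indices is carried over to demands and terminals along
`finSumFinEquiv`. -/
theorem hungarian_perm (h : Ctx I s₀ s) {a : Fin n ⊕ Fin n → Fin n ⊕ Fin n → ℤ}
    (hA : ∀ x y, s arrA (code x) (code y) 0 = a x y) (ha : ∀ x y, 0 ≤ a x y) :
    ∃ π : Equiv.Perm (Fin n ⊕ Fin n),
      (∀ x, exec hungarian s arrP (code x) 0 0 = (code (π x) : ℕ)) ∧
      ∀ ρ : Equiv.Perm (Fin n ⊕ Fin n), ∑ x, a (π x) x ≤ ∑ x, a (ρ x) x := by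
  have M : MatchedIn (n + n) (n + n) (exec hungarian s) := by
    refine hungarian_spec (by rw [h.entry_n]; push_cast; rfl) fun i hi j hj => ?_
    obtain ⟨x, rfl⟩ := exists_code hi
    obtain ⟨y, rfl⟩ := exists_code hj
    rw [hA]
    exact ha x y
  obtain ⟨f, hf, hopt⟩ := M.optimal
  have hA' : exec hungarian s arrA = s arrA := exec_frame (by decide) s
  rw [hA'] at hopt
  have hsum : ∀ ρ : Equiv.Perm (Fin n ⊕ Fin n), ∑ x, a (ρ x) x =
      ∑ c : Fin (n + n), s arrA (((finSumFinEquiv.symm.trans ρ).trans finSumFinEquiv) c) c 0 := by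
    intro ρ
    rw [← Equiv.sum_comp finSumFinEquiv]
    refine Finset.sum_congr rfl fun x _ => ?_
    rw [← hA]
    simp [code]
  refine ⟨(finSumFinEquiv.trans f).trans finSumFinEquiv.symm, fun x => ?_, fun ρ => ?_⟩
  · have := hf (finSumFinEquiv x)
    simpa [code] using this
  · rw [hsum, hsum]
    refine le_trans (le_of_eq ?_) (hopt _)
    refine Finset.sum_congr rfl fun c _ => ?_
    simp

/-- The memory holds an optimal solution of the subproblem of type `r`. -/
def Solved (I : Instance n k p) (s₀ : Fin p) (r : Fin k) (s : Store) : Prop :=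
  ∃ π : Equiv.Perm (Fin n ⊕ Fin n), I.Routing s₀ (I.part s₀ r) (I.count r s₀) π ∧
    I.RoutesOptimal r (I.part s₀ r) (routesOf s₀ π) ∧
    (∀ x, s arrNext r (code x) 0 = (code (π x) : ℕ)) ∧
    s arrCost r 0 0 = ∑ d, I.reward d - I.routesValue (routesOf s₀ π)

/-- The stored cost counts all unserved demands, including those outside the subproblem. It is thus
the same total minus the value for every type, and costs of different types are comparable. The last
clause keeps earlier results. -/
theorem storeResult_spec (h : Ctx I s₀ s) {r : Fin k} (hr : s idxR 0 0 0 = (r : ℕ))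
    {π : Equiv.Perm (Fin n ⊕ Fin n)} (hπ : ∀ x, s arrP (code x) 0 0 = (code (π x) : ℕ)) :
    (∀ x, exec storeResult s arrNext r (code x) 0 = (code (π x) : ℕ)) ∧
    exec storeResult s arrCost r 0 0 =
      ∑ d, (if π (Sum.inl d) = Sum.inl d then I.reward d else 0) ∧
    ∀ i : ℕ, i ≠ r → (∀ j, exec storeResult s arrNext i j 0 = s arrNext i j 0) ∧
      exec storeResult s arrCost i 0 0 = s arrCost i 0 0 := by
  rw [storeResult, exec_seq, exec_seq]
  set t₁ := exec (forTo idxI dimNN (setMat arrNext (var idxR) (var idxI) (vec arrP (var idxI)))) s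
    with ht₁
  have h1 : (∀ j < n + n, t₁ arrNext r j 0 = s arrP j 0 0) ∧
      ∀ i : ℕ, i ≠ r → ∀ j, t₁ arrNext i j 0 = s arrNext i j 0 := by
    refine exec_forTo (m := n + n) (fun j t => (∀ i < j, t arrNext r i 0 = s arrP i 0 0) ∧
      ∀ i : ℕ, i ≠ r → ∀ j, t arrNext i j 0 = s arrNext i j 0) (by decide)
      (h.set (by decide) _ _ _ _).dimNN ?_ ?_
    · refine ⟨fun i hi => by omega, fun i hi j => ?_⟩
      rw [Store.set_ne _ _ _ _ _ (by decide)]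
    · intro j t hj hf hI hJ
      rw [exec_setMat, eval_var, eval_var, eval_vec, eval_var, hI,
        hf _ (by decide) (by decide), hr, hf arrP (by decide) (by decide),
        Int.toNat_natCast, Int.toNat_natCast]
      refine ⟨fun i hi => ?_, fun i hi j' => ?_⟩
      · rw [Store.set_ne _ _ _ _ _ (by decide), Store.set_apply]
        by_cases hij : i = j
        · rw [hij, if_pos ⟨rfl, rfl, rfl, rfl⟩]
        · rw [if_neg fun hh => hij hh.2.2.1]
          exact hJ.1 i (by omega)
      · rw [Store.set_ne _ _ _ _ _ (by decide), Store.set_apply, if_neg fun hh => hi hh.2.1]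
        exact hJ.2 i hi j'
  have f₁ : ∀ b, b ≠ idxI → b ≠ arrNext → t₁ b = s b := fun b h₁ h₂ => by
    rw [ht₁]
    apply exec_frame
    simp [forTo, writes, setMat, setVar, h₁, h₂]
  have hC₁ : Ctx I s₀ t₁ := h.congr fun b hb => f₁ b (by omega) (by omega)
  have hr₁ : t₁ idxR 0 0 0 = (r : ℕ) := by rw [f₁ _ (by decide) (by decide), hr]
  have ht₂ : exec (setVec arrCost (var idxR) (const 0)) t₁ = t₁.set arrCost r 0 0 0 := by
    rw [exec_setVec, eval_var, hr₁, eval_const, Int.toNat_natCast]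
  rw [ht₂]
  have hC₂ : Ctx I s₀ (t₁.set arrCost r 0 0 0) := hC₁.set (by decide) _ _ _ _
  have h2 := exec_forTo (m := n) (i := idxI) (e := dimN)
    (c := ifEq (vec arrP (var idxI)) (var idxI)
        (setVec arrCost (var idxR) (add (vec arrCost (var idxR)) (vec 6 (var idxI)))) skip)
    (s := t₁.set arrCost r 0 0 0)
    (fun j t => t arrCost r 0 0 = ∑ d ∈ Finset.range j,
        (if s arrP d 0 0 = d then I.encode 6 d 0 0 else 0) ∧
      ∀ i : ℕ, i ≠ r → t arrCost i 0 0 = s arrCost i 0 0) (by decide)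
    (hC₂.set (by decide) _ _ _ _).dimN ?_ ?_
  · have f₂ : exec (forTo idxI dimN (ifEq (vec arrP (var idxI)) (var idxI)
        (setVec arrCost (var idxR) (add (vec arrCost (var idxR)) (vec 6 (var idxI)))) skip))
        (t₁.set arrCost r 0 0 0) arrNext = t₁ arrNext := by
      rw [exec_frame (by decide), Store.set_ne _ _ _ _ _ (by decide)]
    rw [f₂]
    refine ⟨fun x => by rw [h1.1 _ (code_lt x), hπ], ?_, fun i hi => ⟨h1.2 i hi, h2.2 i hi⟩⟩
    rw [h2.1, Finset.sum_range]
    refine Finset.sum_congr rfl fun d _ => ?_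
    have e1 : s arrP (d : ℕ) 0 0 = (code (π (Sum.inl d)) : ℕ) := by rw [← hπ, code_inl]
    have e2 : ((code (π (Sum.inl d)) : ℕ) : ℤ) = ((d : ℕ) : ℤ) ↔ π (Sum.inl d) = Sum.inl d := by
      rw [Nat.cast_inj]
      constructor
      · intro h
        exact code_injective (h.trans (code_inl d).symm)
      · intro h
        rw [h, code_inl]
    rw [e1]
    simp only [e2]
    simp [Instance.encode, vecArray]
  · refine ⟨by simp [Store.set_apply], fun i hi => ?_⟩
    rw [Store.set_ne _ _ _ _ _ (by decide), Store.set_apply, if_neg fun hh => hi hh.2.1,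
      f₁ _ (by decide) (by decide)]
  · intro j t hj hf hI hJ
    have hP : t arrP = s arrP := by
      rw [hf _ (by decide) (by decide), Store.set_ne _ _ _ _ _ (by decide),
        f₁ _ (by decide) (by decide)]
    have hR : t idxR 0 0 0 = (r : ℕ) := by
      rw [hf _ (by decide) (by decide), Store.set_ne _ _ _ _ _ (by decide), hr₁]
    have h6 : t 6 = I.encode 6 := by
      rw [hf _ (by decide) (by decide), hC₂.input 6 (by decide)]
    rw [exec_ifEq, eval_vec, eval_var, hI, hP, Int.toNat_natCast, Finset.sum_range_succ,
      Store.set_ne _ _ _ _ _ (by decide)]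
    by_cases hj' : s arrP j 0 0 = j
    · rw [if_pos hj', if_pos hj', exec_setVec, eval_add, eval_vec, eval_vec, eval_var, eval_var,
        hR, hI, h6, Int.toNat_natCast, Int.toNat_natCast, hJ.1]
      refine ⟨by simp [Store.set_apply], fun i hi => ?_⟩
      rw [Store.set_apply, if_neg fun hh => hi hh.2.1, hJ.2 i hi]
    · rw [if_neg hj', if_neg hj', exec_skip, add_zero]
      exact hJ

theorem solveType_spec (hI : I.Standing) (hs : ∀ r, I.startSet r = {s₀})
    (hw : ∀ d, 0 ≤ I.reward d) (h : Ctx I s₀ s) {r : Fin k} (hr : s idxR 0 0 0 = (r : ℕ)) :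
    Solved I s₀ r (exec solveType s) ∧ ∀ q, q ≠ r → Solved I s₀ q s →
      Solved I s₀ q (exec solveType s) := by
  rw [solveType, exec_seq, exec_seq, exec_seq]
  have hM : 0 ≤ ∑ d, I.reward d := Finset.sum_nonneg fun d _ => hw d
  set t₁ := exec markDemands s with ht₁
  have h₁ : Ctx I s₀ t₁ := h.exec (by decide)
  have hr₁ : t₁ idxR 0 0 0 = (r : ℕ) := by rw [ht₁, exec_frame (by decide), hr]
  set t₂ := exec fillMatrix t₁ with ht₂
  have h₂ : Ctx I s₀ t₂ := h₁.exec (by decide)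
  have hr₂ : t₂ idxR 0 0 0 = (r : ℕ) := by rw [ht₂, exec_frame (by decide), hr₁]
  obtain ⟨π, hπ, hopt⟩ := hungarian_perm h₂ (fillMatrix_spec h₁ hr₁ (markDemands_spec h hr))
    (entry_nonneg hw (by omega))
  set t₃ := exec hungarian t₂ with ht₃
  have h₃ : Ctx I s₀ t₃ := h₂.exec (by decide)
  have hr₃ : t₃ idxR 0 0 0 = (r : ℕ) := by rw [ht₃, exec_frame (by decide), hr₂]
  obtain ⟨h4, h5, h6⟩ := storeResult_spec h₃ hr₃ hπ
  have hE : ∀ d ∈ I.part s₀ r, r ∈ I.req d := fun d hd => (mem_part.1 hd).1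
  have hrout := routing_of_optimal hw (by omega) hopt
  constructor
  · refine ⟨π, hrout, routesOptimal_of_optimal hI hw (hs r) hE (by omega) hopt, h4, ?_⟩
    classical
    rw [h5, routesValue_eq_sum (hrout.routesFeasible hI (hs r) hE).disjoint, eq_sub_iff_add_eq,
      ← Finset.sum_filter, ← Finset.sum_filter_add_sum_filter_not Finset.univ
        (fun d => π (Sum.inl d) = Sum.inl d)]
    congr 1
    congr 1
    ext d
    rw [List.mem_toFinset, hrout.served_iff hI]
    simp
  · rintro q hq ⟨ρ, h7, h8, h9, h10⟩
    have hqr : (q : ℕ) ≠ r := fun hh => hq (Fin.ext hh)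
    have f₃ : ∀ b, b ∉ (seq markDemands (seq fillMatrix hungarian)).writes → t₃ b = s b :=
      fun b hb => exec_frame hb s
    refine ⟨ρ, h7, h8, fun x => ?_, ?_⟩
    · rw [(h6 q hqr).1, f₃ _ (by decide), h9]
    · rw [(h6 q hqr).2, f₃ _ (by decide), h10]

theorem solveAll_spec (hI : I.Standing) (hs : ∀ r, I.startSet r = {s₀})
    (hw : ∀ d, 0 ≤ I.reward d) (h : Ctx I s₀ s) :
    ∀ r, Solved I s₀ r (exec (forTo idxR dimK solveType) s) := by
  have key : ∀ r : Fin k, (r : ℕ) < k → Solved I s₀ r (exec (forTo idxR dimK solveType) s) := by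
    refine exec_forTo (m := k) (fun j t => ∀ r : Fin k, (r : ℕ) < j → Solved I s₀ r t) (by decide)
      (h.set (by decide) _ _ _ _).dimK ?_ ?_
    · intro r hr
      omega
    · intro j t hj hf hR hJ r hr
      have ht : Ctx I s₀ t := by
        refine h.congr fun b hb => hf b (by omega) fun hm => ?_
        have : (solveType.writes.all fun b => decide (11 ≤ b ∧ b ≠ 15 ∧ b ≠ 16)) = true := by
          decide
        have := of_decide_eq_true (List.all_eq_true.1 this b hm)
        omega
      obtain ⟨h1, h2⟩ := solveType_spec hI hs hw ht (r := ⟨j, hj⟩) hR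
      have h3 : Solved I s₀ r (exec solveType t) := by
        rcases (Nat.lt_succ_iff.1 hr).lt_or_eq with h | h
        · exact h2 r (fun hh => by rw [hh] at h; simp at h) (hJ r h)
        · have : r = ⟨j, hj⟩ := Fin.ext h
          exact this ▸ h1
      exact h3
  exact fun r => key r r.2

/-- Least lost reward means largest value. Array order need not be processing order, so ties are
resolved by `Before`, in favour of the type processed last. -/
theorem chooseBest_spec (hk : 0 < k) (h : Ctx I s₀ s) : ∃ b : Fin k,
    exec chooseBest s varBest 0 0 0 = (b : ℕ) ∧ ∀ r : Fin k, s arrCost b 0 0 ≤ s arrCost r 0 0 ∧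
      (s arrCost r 0 0 = s arrCost b 0 0 → r = b ∨ I.Before s₀ r b) := by
  have key : ∃ b : Fin k, exec chooseBest s varBest 0 0 0 = (b : ℕ) ∧
      ((b : ℕ) = 0 ∨ (b : ℕ) < k) ∧
      ∀ r : Fin k, (r : ℕ) < k → s arrCost b 0 0 ≤ s arrCost r 0 0 ∧
      (s arrCost r 0 0 = s arrCost b 0 0 → r = b ∨ I.Before s₀ r b) := by
    rw [chooseBest, exec_seq]
    have h₁ : Ctx I s₀ (exec (setVar varBest (const 0)) s) := h.exec (by decide)
    refine exec_forTo (m := k) (fun j t => ∃ b : Fin k, t varBest 0 0 0 = (b : ℕ) ∧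
      ((b : ℕ) = 0 ∨ (b : ℕ) < j) ∧
      ∀ r : Fin k, (r : ℕ) < j → s arrCost b 0 0 ≤ s arrCost r 0 0 ∧
      (s arrCost r 0 0 = s arrCost b 0 0 → r = b ∨ I.Before s₀ r b)) (by decide)
      (h₁.set (by decide) _ _ _ _).dimK ?_ ?_
    · refine ⟨⟨0, hk⟩, ?_, Or.inl rfl, fun r hr => by omega⟩
      rw [Store.set_ne _ _ _ _ _ (by decide), exec_setVar]
      simp [Store.set_apply, eval_const]
    · rintro j t hj hf hR ⟨b, hb, hb', hJ⟩
      have hcost : t arrCost = s arrCost := by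
        rw [hf _ (by decide) (by decide), exec_frame (by decide)]
      have ht : Ctx I s₀ t := by
        refine h₁.congr fun b hb => hf b (by omega) fun hm => ?_
        simp [writes, ifBefore, setVar, ifLt, ifEq] at hm
        omega
      have hsplit : ∀ r : Fin k, (r : ℕ) < j + 1 → (r : ℕ) < j ∨ r = ⟨j, hj⟩ := by
        intro r hr
        rcases (Nat.lt_succ_iff.1 hr).lt_or_eq with h | h
        · exact Or.inl h
        · exact Or.inr (Fin.ext h)
      have hset : exec (setVar varBest (var idxR)) t varBest 0 0 0 = (j : ℤ) := by
        rw [exec_setVar, eval_var, hR]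
        simp [Store.set_apply]
      rw [Store.set_ne _ _ _ _ _ (by decide), exec_ifLt, exec_ifEq,
        exec_ifBefore ht (q := b) (r := ⟨j, hj⟩) (by rw [eval_var, hb]) (by rw [eval_var, hR]),
        eval_vec, eval_vec, eval_var, eval_var, hb, hR, hcost, Int.toNat_natCast,
        Int.toNat_natCast]
      by_cases h1 : s arrCost j 0 0 < s arrCost b 0 0
      · rw [if_pos h1]
        refine ⟨⟨j, hj⟩, hset, Or.inr (Nat.lt_succ_self j), fun r hr => ?_⟩
        rcases hsplit r hr with h2 | rfl
        · have := (hJ r h2).1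
          refine ⟨by simp only; omega, fun h3 => ?_⟩
          simp only at h3
          omega
        · exact ⟨le_rfl, fun _ => Or.inl rfl⟩
      · rw [if_neg h1]
        by_cases h2 : s arrCost j 0 0 = s arrCost b 0 0
        · rw [if_pos h2]
          by_cases h3 : I.Before s₀ b ⟨j, hj⟩
          · rw [if_pos h3]
            refine ⟨⟨j, hj⟩, hset, Or.inr (Nat.lt_succ_self j), fun r hr => ?_⟩
            rcases hsplit r hr with h4 | rfl
            · have h5 := hJ r h4
              refine ⟨by simp only; omega, fun h6 => ?_⟩
              simp only at h6
              right
              rcases h5.2 (by omega) with rfl | h7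
              · exact h3
              · simp only [Instance.Before, Fin.lt_def] at h3 h7 ⊢
                omega
            · exact ⟨le_rfl, fun _ => Or.inl rfl⟩
          · rw [if_neg h3, exec_skip]
            refine ⟨b, hb, hb'.imp_right fun h => by omega, fun r hr => ?_⟩
            rcases hsplit r hr with h4 | rfl
            · exact hJ r h4
            · refine ⟨by simp only; omega, fun _ => ?_⟩
              simp only [Instance.Before, Fin.lt_def, Fin.ext_iff] at h3 ⊢
              omega
        · rw [if_neg h2, exec_skip]
          refine ⟨b, hb, hb'.imp_right fun h => by omega, fun r hr => ?_⟩
          rcases hsplit r hr with h4 | rfl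
          · exact hJ r h4
          · refine ⟨by simp only; omega, fun h5 => ?_⟩
            simp only at h5
            omega
  obtain ⟨b, hb, -, h1⟩ := key
  exact ⟨b, hb, fun r => h1 r r.2⟩

end Correctness

/-! ### Writing the solution, and the whole program. -/

section Correctness

variable {I : Instance n k p} {s₀ : Fin p} {s : Store}

/-- The memory holds the number `b` of a type and the permutation `π` found for it. -/
structure Chosen (b : Fin k) (π : Equiv.Perm (Fin n ⊕ Fin n)) (s : Store) : Prop where
  best : s varBest 0 0 0 = (b : ℕ)
  next : ∀ x, s arrNext b (code x) 0 = (code (π x) : ℕ)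

theorem Chosen.congr {b : Fin k} {π : Equiv.Perm (Fin n ⊕ Fin n)} (h : Chosen b π s) {t : Store}
    (h₁ : t varBest = s varBest) (h₂ : t arrNext = s arrNext) : Chosen b π t where
  best := by rw [h₁, h.best]
  next x := by rw [h₂, h.next]

variable {b : Fin k} {π : Equiv.Perm (Fin n ⊕ Fin n)}

theorem Chosen.next_inl (hb : Chosen b π s) (d : Fin n) :
    s arrNext b d 0 = ((d : ℕ) : ℤ) ↔ π (Sum.inl d) = Sum.inl d := by
  rw [← code_inl d, hb.next, Nat.cast_inj]
  exact ⟨fun h => code_injective h, fun h => by rw [h]⟩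

theorem outputServed_spec (h : Ctx I s₀ s) (hb : Chosen b π s) (h0 : s 11 = fun _ _ _ => 0)
    (d : Fin n) :
    exec outputServed s 11 d 0 0 = if π (Sum.inl d) ≠ Sum.inl d then 1 else 0 := by
  have key : ∀ d : Fin n, exec outputServed s 11 d 0 0 =
      if (d : ℕ) < n ∧ π (Sum.inl d) ≠ Sum.inl d then 1 else 0 := by
    refine exec_forTo (m := n) (fun j t => ∀ d : Fin n, t 11 d 0 0 =
      if (d : ℕ) < j ∧ π (Sum.inl d) ≠ Sum.inl d then 1 else 0) (by decide)
      (h.set (by decide) _ _ _ _).dimN ?_ ?_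
    · intro d
      rw [Store.set_ne _ _ _ _ _ (by decide), h0]
      simp
    · intro j t hj hf hI hJ d
      have hbt : Chosen b π t :=
        hb.congr (hf _ (by decide) (by decide)) (hf _ (by decide) (by decide))
      have hn := hbt.next_inl ⟨j, hj⟩
      simp only at hn
      rw [Store.set_ne _ _ _ _ _ (by decide), exec_ifEq, eval_mat, eval_var, eval_var, hbt.best, hI,
        Int.toNat_natCast, Int.toNat_natCast]
      by_cases h1 : π (Sum.inl ⟨j, hj⟩) = Sum.inl ⟨j, hj⟩
      · rw [if_pos (hn.2 h1), exec_skip, hJ]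
        refine if_congr (and_congr_left fun h2 => ?_) rfl rfl
        have : (d : ℕ) ≠ j := by
          rintro rfl
          exact h2 h1
        omega
      · rw [if_neg (mt hn.1 h1), exec_setVec, eval_var, eval_const, hI, Int.toNat_natCast,
          Store.set_apply]
        by_cases h2 : (d : ℕ) = j
        · subst h2
          rw [if_pos ⟨rfl, rfl, rfl, rfl⟩, if_pos ⟨Nat.lt_succ_self _, h1⟩]
        · rw [if_neg fun hh => h2 hh.2.1, hJ]
          refine if_congr (and_congr_left fun _ => ?_) rfl rfl
          omega
  rw [key d]
  simp

/-- Each run of the loop body applies `chase` once to the coded position. -/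
theorem chase_spec (h : Ctx I s₀ s) (hb : Chosen b π s) {q : Fin k}
    (hq : s idxQ 0 0 0 = (q : ℕ)) {x : Fin n ⊕ Fin n} (hx : s varCur 0 0 0 = (code x : ℕ)) :
    exec (loop dimN chaseStep) s varCur 0 0 0 = (code ((I.chase q π)^[n] x) : ℕ) := by
  rw [exec_loop, h.dimN, Int.toNat_natCast]
  suffices H : ∀ m : ℕ, (exec chaseStep)^[m] s varCur 0 0 0 = (code ((I.chase q π)^[m] x) : ℕ) ∧
      ∀ a, a ≠ varCur → (exec chaseStep)^[m] s a = s a from (H n).1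
  intro m
  induction m with
  | zero => exact ⟨hx, fun _ _ => rfl⟩
  | succ m ih =>
    rw [Function.iterate_succ_apply', Function.iterate_succ_apply']
    set t := (exec chaseStep)^[m] s
    set y := (I.chase q π)^[m] x
    have ht : Ctx I s₀ t := h.congr fun b hb => ih.2 b (by omega)
    have hbt : Chosen b π t := hb.congr (ih.2 _ (by decide)) (ih.2 _ (by decide))
    have hqt : t idxQ 0 0 0 = (q : ℕ) := by rw [ih.2 _ (by decide), hq]
    refine ⟨?_, fun a ha => ?_⟩
    · rw [chaseStep, exec_ifLt, eval_var, ih.1, ht.dimN]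
      rcases hy : y with d | a
      · have hy' := ih.1
        rw [hy, code_inl] at hy'
        rw [code_inl, if_pos (by exact_mod_cast d.2), exec_ifLe, eval_const, eval_mat, eval_var,
          eval_var, hy', hqt, Int.toNat_natCast, Int.toNat_natCast, Instance.chase]
        have := ht.one_le_req d.2 q.2
        by_cases h1 : q ∈ I.req d
        · rw [if_pos (this.2 h1), if_pos h1, exec_skip, hy', code_inl]
        · rw [if_neg (mt this.1 h1), if_neg h1, exec_setVar, eval_mat, eval_var, eval_var, hbt.best,
            hy', Int.toNat_natCast, Int.toNat_natCast, ← hbt.next, code_inl]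
          simp [Store.set_apply]
      · rw [if_neg (by rw [code_inr]; push_cast; omega), exec_skip, ih.1, hy]
        rfl
    · rw [exec_frame (by simpa [writes, chaseStep, ifLt, setVar] using ha), ih.2 a ha]

-- One run handles one pair of a type and an origin. A served demand that requires the type sets its
-- outgoing variable, to the next demand or to the sink; a terminal sets the variable of a route's
-- first stop.
open Classical in
theorem outputNext_spec (h : Ctx I s₀ s) (hb : Chosen b π s) {q : Fin k}
    (hq : s idxQ 0 0 0 = (q : ℕ)) {x : Fin n ⊕ Fin n} (hx : s idxI 0 0 0 = (code x : ℕ)) :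
    (∀ (q' : Fin k) (s' : Fin p) (d : Fin n), exec outputNext s 12 q' s' d =
      if q' = q ∧ s' = s₀ ∧ (∃ a, Sum.inr a = x) ∧ (I.chase q π)^[n] (π x) = Sum.inl d then 1
      else s 12 q' s' d) ∧
    (∀ (q' : Fin k) (i j : Fin n), exec outputNext s 13 q' i j =
      if q' = q ∧ Sum.inl i = x ∧ (π (Sum.inl i) ≠ Sum.inl i ∧ q ∈ I.req i) ∧
        (I.chase q π)^[n] (π x) = Sum.inl j then 1 else s 13 q' i j) ∧
    (∀ (q' : Fin k) (i : Fin n), exec outputNext s 14 q' i 0 =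
      if q' = q ∧ Sum.inl i = x ∧ (π (Sum.inl i) ≠ Sum.inl i ∧ q ∈ I.req i) ∧
        ((I.chase q π)^[n] (π x)).isRight then 1 else s 14 q' i 0) := by
  rw [outputNext, exec_seq, exec_seq]
  set t₁ := exec (setVar varCur (mat arrNext (var varBest) (var idxI))) s with ht₁
  have f₁ : ∀ a, a ≠ varCur → t₁ a = s a := fun a ha => Store.set_ne _ _ _ _ _ ha
  have hc₁ : t₁ varCur 0 0 0 = (code (π x) : ℕ) := by
    rw [ht₁, exec_setVar, eval_mat, eval_var, eval_var, hb.best, hx, Int.toNat_natCast,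
      Int.toNat_natCast, ← hb.next]
    simp [Store.set_apply]
  have hc := chase_spec (h.congr fun b hb => f₁ b (by omega))
    (hb.congr (f₁ _ (by decide)) (f₁ _ (by decide))) (q := q)
    (by rw [f₁ _ (by decide), hq]) hc₁
  set t := exec (loop dimN chaseStep) t₁ with ht
  have f : ∀ a, a ≠ varCur → t a = s a := fun a ha => by
    rw [ht, exec_frame (by simpa [writes, chaseStep, ifLt, setVar] using ha), f₁ a ha]
  have hC : Ctx I s₀ t := h.congr fun b hb => f b (by omega)
  have hB : Chosen b π t := hb.congr (f _ (by decide)) (f _ (by decide))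
  have hQ : t idxQ 0 0 0 = (q : ℕ) := by rw [f _ (by decide), hq]
  have hX : t idxI 0 0 0 = (code x : ℕ) := by rw [f _ (by decide), hx]
  rw [← f 12 (by decide), ← f 13 (by decide), ← f 14 (by decide)]
  generalize (I.chase q π)^[n] (π x) = y at hc ⊢
  clear_value t
  rw [exec_ifLt, eval_var, hX, hC.dimN]
  rcases x with i | a
  · rw [code_inl] at hX ⊢
    have hn := hB.next_inl i
    rw [if_pos (by exact_mod_cast i.2), exec_ifEq, eval_mat, eval_var, eval_var, hX, hB.best,
      Int.toNat_natCast, Int.toNat_natCast]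
    by_cases h1 : π (Sum.inl i) = Sum.inl i
    · rw [if_pos (hn.2 h1), exec_skip]
      refine ⟨fun q' s' d => ?_, fun q' i' j => ?_, fun q' i' => ?_⟩
      · simp
      · rw [if_neg]
        rintro ⟨-, h2, h3, -⟩
        rw [h2] at h3
        exact h3.1 h1
      · rw [if_neg]
        rintro ⟨-, h2, h3, -⟩
        rw [h2] at h3
        exact h3.1 h1
    rw [if_neg (mt hn.1 h1), exec_ifLe, eval_const, eval_mat, eval_var, eval_var, hX, hQ,
      Int.toNat_natCast, Int.toNat_natCast]
    have hreq := hC.one_le_req i.2 q.2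
    by_cases h2 : q ∈ I.req i
    · rw [if_pos (hreq.2 h2), exec_ifLt, eval_var, hc, hC.dimN]
      rcases y with j | a
      · rw [code_inl] at hc ⊢
        rw [if_pos (by exact_mod_cast j.2), exec_assign, eval_var, eval_var, eval_var, eval_const,
          hQ, hX, hc]
        simp only [Int.toNat_natCast]
        refine ⟨fun q' s' d => ?_, fun q' i' j' => ?_, fun q' i' => ?_⟩
        · simp [Store.set_apply]
        · simp only [Store.set_apply, Fin.val_inj, Sum.inl.injEq, true_and]
          refine if_congr ⟨?_, ?_⟩ rfl rfl
          · rintro ⟨rfl, rfl, rfl⟩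
            exact ⟨rfl, rfl, ⟨h1, h2⟩, rfl⟩
          · rintro ⟨rfl, rfl, -, rfl⟩
            exact ⟨rfl, rfl, rfl⟩
        · simp [Store.set_apply]
      · rw [if_neg (by rw [code_inr]; push_cast; omega), exec_setMat, eval_var, eval_var,
          eval_const, hQ, hX]
        simp only [Int.toNat_natCast]
        refine ⟨fun q' s' d => ?_, fun q' i' j' => ?_, fun q' i' => ?_⟩
        · simp [Store.set_apply]
        · simp [Store.set_apply]
        · simp only [Store.set_apply, Fin.val_inj, Sum.inl.injEq, true_and, and_true]
          refine if_congr ⟨?_, ?_⟩ rfl rfl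
          · rintro ⟨rfl, rfl⟩
            exact ⟨rfl, rfl, ⟨h1, h2⟩, rfl⟩
          · rintro ⟨rfl, rfl, -⟩
            exact ⟨rfl, rfl⟩
    · rw [if_neg (mt hreq.1 h2), exec_skip]
      refine ⟨fun q' s' d => ?_, fun q' i' j => ?_, fun q' i' => ?_⟩
      · simp
      · rw [if_neg]
        rintro ⟨-, h3, h4, -⟩
        exact h2 (Sum.inl.inj h3 ▸ h4.2)
      · rw [if_neg]
        rintro ⟨-, h3, h4, -⟩
        exact h2 (Sum.inl.inj h3 ▸ h4.2)
  · rw [if_neg (by rw [code_inr]; push_cast; omega), exec_ifLt, eval_var, hc, hC.dimN]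
    rcases y with j | a'
    · rw [code_inl] at hc ⊢
      rw [if_pos (by exact_mod_cast j.2), exec_assign, eval_var, eval_var, eval_var, eval_const,
        hQ, hC.start, hc]
      simp only [Int.toNat_natCast]
      refine ⟨fun q' s' d => ?_, fun q' i' j' => ?_, fun q' i' => ?_⟩
      · simp only [Store.set_apply, Fin.val_inj, Sum.inr.injEq, Sum.inl.injEq, true_and,
          exists_eq]
        refine if_congr (and_congr_right fun _ => and_congr_right fun _ => eq_comm) rfl rfl
      · simp [Store.set_apply]
      · simp [Store.set_apply]
    · rw [if_neg (by rw [code_inr]; push_cast; omega), exec_skip]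
      simp

open Classical in
/-- The arrays of the output after the treatment of the pairs in `T`. -/
def OutputInv (I : Instance n k p) (s₀ : Fin p) (π : Equiv.Perm (Fin n ⊕ Fin n))
    (T : Fin k → Fin n ⊕ Fin n → Prop) (s : Store) : Prop :=
  (∀ (q : Fin k) (s' : Fin p) (d : Fin n), s 12 q s' d =
    if s' = s₀ ∧ ∃ a, T q (Sum.inr a) ∧ (I.chase q π)^[n] (π (Sum.inr a)) = Sum.inl d then 1
    else 0) ∧
  (∀ (q : Fin k) (i j : Fin n), s 13 q i j =
    if T q (Sum.inl i) ∧ (π (Sum.inl i) ≠ Sum.inl i ∧ q ∈ I.req i) ∧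
      (I.chase q π)^[n] (π (Sum.inl i)) = Sum.inl j then 1 else 0) ∧
  (∀ (q : Fin k) (i : Fin n), s 14 q i 0 =
    if T q (Sum.inl i) ∧ (π (Sum.inl i) ≠ Sum.inl i ∧ q ∈ I.req i) ∧
      ((I.chase q π)^[n] (π (Sum.inl i))).isRight then 1 else 0)

theorem OutputInv.congr {T U : Fin k → Fin n ⊕ Fin n → Prop} (h : OutputInv I s₀ π T s) {t : Store}
    (h₁ : ∀ b, b = 12 ∨ b = 13 ∨ b = 14 → t b = s b) (h₂ : ∀ q x, T q x ↔ U q x) :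
    OutputInv I s₀ π U t := by
  have hTU : T = U := by
    funext q x
    exact propext (h₂ q x)
  subst hTU
  rw [OutputInv, h₁ 12 (by decide), h₁ 13 (by decide), h₁ 14 (by decide)]
  exact h

theorem ite_or_eq {A B C : Prop} {_ : Decidable A} {_ : Decidable B} {_ : Decidable C}
    (h : C ↔ B ∨ A) :
    (if A then (1 : ℤ) else if B then 1 else 0) = if C then 1 else 0 := by
  by_cases hA : A <;> by_cases hB : B <;> simp [h, hA, hB]

theorem OutputInv.step {T : Fin k → Fin n ⊕ Fin n → Prop} (hT : OutputInv I s₀ π T s)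
    (h : Ctx I s₀ s) (hb : Chosen b π s) {q : Fin k}
    (hq : s idxQ 0 0 0 = (q : ℕ)) {x : Fin n ⊕ Fin n} (hx : s idxI 0 0 0 = (code x : ℕ)) :
    OutputInv I s₀ π (fun q' x' => T q' x' ∨ (q' = q ∧ x' = x)) (exec outputNext s) := by
  obtain ⟨h1, h2, h3⟩ := outputNext_spec h hb hq hx
  refine ⟨fun q' s' d => ?_, fun q' i j => ?_, fun q' i => ?_⟩
  · rw [h1, hT.1]
    refine ite_or_eq ⟨?_, ?_⟩
    · rintro ⟨rfl, a, h4 | ⟨rfl, rfl⟩, h5⟩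
      · exact Or.inl ⟨rfl, a, h4, h5⟩
      · exact Or.inr ⟨rfl, rfl, ⟨a, rfl⟩, h5⟩
    · rintro (⟨rfl, a, h4, h5⟩ | ⟨rfl, rfl, ⟨a, rfl⟩, h5⟩)
      · exact ⟨rfl, a, Or.inl h4, h5⟩
      · exact ⟨rfl, a, Or.inr ⟨rfl, rfl⟩, h5⟩
  · rw [h2, hT.2.1]
    refine ite_or_eq ⟨?_, ?_⟩
    · rintro ⟨h4 | ⟨rfl, rfl⟩, h5⟩
      · exact Or.inl ⟨h4, h5⟩
      · exact Or.inr ⟨rfl, rfl, h5⟩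
    · rintro (⟨h4, h5⟩ | ⟨rfl, rfl, h5⟩)
      · exact ⟨Or.inl h4, h5⟩
      · exact ⟨Or.inr ⟨rfl, rfl⟩, h5⟩
  · rw [h3, hT.2.2]
    refine ite_or_eq ⟨?_, ?_⟩
    · rintro ⟨h4 | ⟨rfl, rfl⟩, h5⟩
      · exact Or.inl ⟨h4, h5⟩
      · exact Or.inr ⟨rfl, rfl, h5⟩
    · rintro (⟨h4, h5⟩ | ⟨rfl, rfl, h5⟩)
      · exact ⟨Or.inl h4, h5⟩
      · exact ⟨Or.inr ⟨rfl, rfl⟩, h5⟩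

theorem outputAll_spec (h : Ctx I s₀ s) (hb : Chosen b π s)
    (h0 : ∀ b, b = 12 ∨ b = 13 ∨ b = 14 → s b = fun _ _ _ => 0) :
    OutputInv I s₀ π (fun _ _ => True)
      (exec (forTo idxQ dimK (forTo idxI dimNN outputNext)) s) := by
  have key : OutputInv I s₀ π (fun q _ => (q : ℕ) < k)
      (exec (forTo idxQ dimK (forTo idxI dimNN outputNext)) s) := by
    refine exec_forTo (m := k) (fun l t => OutputInv I s₀ π (fun q _ => (q : ℕ) < l) t) (by decide)
      (h.set (by decide) _ _ _ _).dimK ?_ ?_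
    · refine ⟨fun q s' d => ?_, fun q i j => ?_, fun q i => ?_⟩ <;>
        rw [Store.set_ne _ _ _ _ _ (by decide), h0 _ (by decide)] <;> simp
    · intro l t hl hf hQ hJ
      have ht : Ctx I s₀ t := by
        refine h.congr fun b hb => hf b (by omega) fun hm => ?_
        have : ((forTo idxI dimNN outputNext).writes.all
          fun b => decide (11 ≤ b ∧ b ≠ 15 ∧ b ≠ 16)) = true := by decide
        have := of_decide_eq_true (List.all_eq_true.1 this b hm)
        omega
      have hbt : Chosen b π t :=
        hb.congr (hf _ (by decide) (by decide)) (hf _ (by decide) (by decide))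
      have key := exec_forTo (m := n + n) (i := idxI) (e := dimNN) (c := outputNext) (s := t)
        (fun i t' => OutputInv I s₀ π (fun q x => (q : ℕ) < l ∨ ((q : ℕ) = l ∧ code x < i)) t')
        (by decide) (ht.set (by decide) _ _ _ _).dimNN ?_ ?_
      · refine key.congr (fun b hb => Store.set_ne _ _ _ _ _ (by omega)) fun q x => ?_
        have := code_lt x
        omega
      · refine hJ.congr (fun b hb => Store.set_ne _ _ _ _ _ (by omega)) fun q x => ?_
        omega
      · intro i t' hi hg hI hJ'
        obtain ⟨x, rfl⟩ := exists_code hi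
        have ht' : Ctx I s₀ t' := by
          refine ht.congr fun b hb => hg b (by omega) fun hm => ?_
          have : (outputNext.writes.all fun b => decide (11 ≤ b ∧ b ≠ 15 ∧ b ≠ 16)) = true := by
            decide
          have := of_decide_eq_true (List.all_eq_true.1 this b hm)
          omega
        have hbt' : Chosen b π t' :=
          hbt.congr (hg _ (by decide) (by decide)) (hg _ (by decide) (by decide))
        refine (hJ'.step ht' hbt' (q := ⟨l, hl⟩) (by rw [hg _ (by decide) (by decide), hQ])
          hI).congr (fun b hb => Store.set_ne _ _ _ _ _ (by omega)) fun q x' => ?_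
        have : x' = x ↔ code x' = code x := ⟨fun h => by rw [h], code_injective⟩
        rw [this, Fin.ext_iff]
        simp only
        omega
  exact key.congr (fun _ _ => rfl) fun q x => by simp

theorem output_spec (hI : I.Standing) (hs : ∀ r, I.startSet r = {s₀}) (h : Ctx I s₀ s)
    (hb : Chosen b π s) (hπ : I.Routing s₀ (I.part s₀ b) (I.count b s₀) π)
    (h0 : ∀ b, 11 ≤ b → b ≤ 14 → s b = fun _ _ _ => 0) :
    readSolution n k p (exec (seq outputServed
      (forTo idxQ dimK (forTo idxI dimNN outputNext))) s) = I.follow (routesOf s₀ π) := by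
  rw [hπ.follow_eq hI (hs b) fun d hd => (mem_part.1 hd).1, exec_seq]
  have h1 : Ctx I s₀ (exec outputServed s) := h.exec (by decide)
  have h2 := outputAll_spec h1 (hb.congr (exec_frame (by decide) s) (exec_frame (by decide) s))
    fun b hb => by
      rw [exec_frame (by rcases hb with rfl | rfl | rfl <;> decide), h0 b (by omega) (by omega)]
  rw [readSolution, Solution.mk.injEq]
  refine ⟨?_, ?_, ?_, ?_⟩
  · funext d
    rw [exec_frame (by decide), outputServed_spec h hb (h0 11 le_rfl (by decide))]
  · funext q s' d
    simpa using h2.1 q s' d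
  · funext q i j
    simpa using h2.2.1 q i j
  · funext q i
    simpa using h2.2.2 q i

/-- The program computes an output of Algorithm A. -/
theorem algorithm_spec (hI : I.Standing) (hs : ∀ r, I.startSet r = {s₀})
    (hw : ∀ d, 0 ≤ I.reward d) :
    I.AlgorithmA (readSolution n k p (exec algorithm I.encode)) := by
  set t₁ := exec findStart I.encode with ht₁
  have f₁ : ∀ b, b < 15 → t₁ b = I.encode b := fun b hb => exec_frame (fun hm => by
    have : (findStart.writes.all fun b => decide (15 ≤ b)) = true := by decide
    have := of_decide_eq_true (List.all_eq_true.1 this b hm)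
    omega) _
  set t₂ := exec sumRewards t₁ with ht₂
  have f₂ : ∀ b, b < 16 → t₂ b = t₁ b := fun b hb => exec_frame (fun hm => by
    have : (sumRewards.writes.all fun b => decide (16 ≤ b)) = true := by decide
    have := of_decide_eq_true (List.all_eq_true.1 this b hm)
    omega) _
  have h₂ : Ctx I s₀ t₂ :=
    { input := fun b hb => by rw [f₂ b (by omega), f₁ b (by omega)]
      start := by
        rw [f₂ _ (by decide)]
        exact findStart_spec hs hI.types_pos fun _ _ => rfl
      big := sumRewards_spec fun b hb => f₁ b (by omega) }
  have hsol := solveAll_spec hI hs hw h₂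
  set t₃ := exec (forTo idxR dimK solveType) t₂ with ht₃
  have h₃ : Ctx I s₀ t₃ := h₂.exec (by decide)
  obtain ⟨b, hb, hbest⟩ := chooseBest_spec hI.types_pos h₃
  set t₄ := exec chooseBest t₃ with ht₄
  have h₄ : Ctx I s₀ t₄ := h₃.exec (by decide)
  choose π hπ hopt hnext hcost using hsol
  have h0 : ∀ b, 11 ≤ b → b ≤ 14 → t₄ b = fun _ _ _ => 0 := by
    intro b h1 h2
    have : t₄ b = t₂ b := exec_frame (c := seq (forTo idxR dimK solveType) chooseBest) (fun hm => by
      have : ((seq (forTo idxR dimK solveType) chooseBest).writes.all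
        fun b => decide (15 ≤ b)) = true := by decide
      have := of_decide_eq_true (List.all_eq_true.1 this b hm)
      omega) _
    rw [this, f₂ b (by omega), f₁ b (by omega)]
    interval_cases b <;> rfl
  have hout := output_spec hI hs h₄ (b := b) (π := π b)
    ⟨hb, fun x => by rw [ht₄, exec_frame (by decide), hnext]⟩ (hπ b) h0
  -- This sort keeps equal keys in index order, so its order of the types is exactly `Before`, the
  -- one used by the program.
  set σ : Equiv.Perm (Fin k) := Tuple.sort fun r => I.count r s₀ with hσ
  have hbefore : ∀ i j, j < i ↔ I.Before s₀ (σ j) (σ i) := by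
    have hlt : ∀ i j, j < i → I.Before s₀ (σ j) (σ i) := by
      intro i j hij
      have h1 := (Tuple.eq_sort_iff (f := fun r => I.count r s₀) (σ := σ)).1 rfl
      rcases (h1.1 hij.le).lt_or_eq with h2 | h2
      · exact Or.inl h2
      · exact Or.inr ⟨h2, h1.2 j i hij h2⟩
    intro i j
    refine ⟨hlt i j, fun h => ?_⟩
    by_contra hn
    rcases (not_lt.1 hn).lt_or_eq with h1 | rfl
    · have := hlt j i h1
      simp only [Instance.Before, Fin.lt_def] at h this
      omega
    · simp only [Instance.Before, Fin.lt_def] at h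
      omega
  have hrem : ∀ i, I.remaining σ i = I.part s₀ (σ i) := by
    intro i
    ext d
    rw [mem_remaining, mem_part]
    refine and_congr_right fun _ => ⟨fun h q hq => ?_, fun h j hj => h _ ((hbefore i j).1 hj)⟩
    have := h (σ.symm q) ((hbefore _ _).2 (by rwa [Equiv.apply_symm_apply]))
    rwa [Equiv.apply_symm_apply] at this
  refine ⟨σ, fun i => routesOf s₀ (π (σ i)), σ.symm b, ?_, fun i => ?_, fun i => ?_, fun i hi => ?_,
    ?_⟩
  · simp only [numResources_eq (hs _)]
    exact Tuple.monotone_sort fun r => I.count r s₀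
  · rw [hrem]
    exact hopt _
  · have := (hbest (σ i)).1
    rw [hcost, hcost] at this
    simp only [Equiv.apply_symm_apply]
    omega
  · obtain ⟨h1, h2⟩ := hbest (σ i)
    rw [hcost, hcost] at h1 h2
    simp only [Equiv.apply_symm_apply]
    refine lt_of_le_of_ne (by omega) fun h3 => ?_
    rcases h2 (by omega) with h4 | h4
    · rw [← h4, Equiv.symm_apply_apply] at hi
      exact lt_irrefl _ hi
    · have := (hbefore (σ.symm b) i).2 (by rwa [Equiv.apply_symm_apply])
      exact lt_asymm hi this
  · simp only [Equiv.apply_symm_apply]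
    rw [← hout]
    rfl

/-- The program runs in polynomial time. -/
theorem algorithm_steps_le (I : Instance n k p) :
    (algorithm.run I.encode).2 ≤ algorithm.timeBound.eval I.size := by
  -- The two computed checks say that all loop lengths come from dimensions and that array `0` is
  -- never written.
  refine algorithm.steps_le (by decide) (by decide) _ fun i j l => ?_
  have hn : n + k + p ≤ I.size := by
    simp only [Instance.size]
    omega
  simp only [Instance.encode, vecArray]
  split_ifs with h
  · obtain ⟨h1, -, -⟩ := h
    interval_cases i
    · change ((n : ℕ) : ℤ) ≤ _
      omega
    · change ((k : ℕ) : ℤ) ≤ _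
      omega
    · change ((p : ℕ) : ℤ) ≤ _
      omega
  · exact Int.natCast_nonneg _

end Correctness

end MRMD

theorem mainTheorem12 :
    MRMD.IsApproxAlgorithm
      (fun I => I.Standing ∧ I.SameStart ∧ I.SmallCosts)
      (fun I z => I.AlgorithmA z)
      (fun k => 2 * k) := by
  refine ⟨fun I hI z hz => hz.guarantee hI.1 hI.2.1 hI.2.2, MRMD.algorithm,
    MRMD.algorithm.timeBound, fun I hI => ⟨?_, MRMD.algorithm_steps_le I⟩⟩
  obtain ⟨hI, ⟨s, hs⟩, hC⟩ := hI
  exact MRMD.algorithm_spec hI hs (hC.reward_nonneg hI.types_pos)
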